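/- \textbf{Setting.} Let $X=(\tilde x_i,x^i)$, $i=1,\dots,D$, be coordinates on $\mathbb R^{2D}$, $\partial_i=\partial/\partial x^i$, $\tilde\partial^i=\partial/\partial\tilde x_i$. Let $\mathcal E_{ij}(X)$ (a $D\times D$ real matrix) and $d(X)$ (a real function) be smooth, with $g_{ij}=\frac12(\mathcal E_{ij}+\mathcal E_{ji})$ invertible at every $X$ and $g^{ij}=(g_{ij})^{-1}$. Repeated indices are summed, and indices are raised and lowered with $g$. Put $$\mathcal D_i=\partial_i-\mathcal E_{ik}\tilde\partial^k,\qquad \bar{\mathcal D}_i=\partial_i+\mathcal E_{ki}\tilde\partial^k .$$ The first index of $\mathcal E_{ij}$ and the index of $\mathcal D_i$ are unbarred; the second index of $\mathcal E_{ij}$ and the index of $\bar{\mathcal D}_i$ are barred. The covariant derivatives $\nabla_i=\mathcal D_i-\cdots$ and $\bar\nabla_i=\bar{\mathcal D}_i-\cdots$ subtract one connection term for each lower index, with $$\Gamma_{ij}^{k}=\tfrac12g^{kl}\mathcal D_i\mathcal E_{jl},\quad \Gamma_{i\bar j}^{\bar k}=\tfrac12 g^{kl}(\mathcal D_i\mathcal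 E_{lj}+\bar{\mathcal D}_j\mathcal E_{il}-\bar{\mathcal D}_l\mathcal E_{ij}),$$ $$\Gamma_{\bar ij}^{k}=\tfrac12g^{kl}(\bar{\mathcal D}_i\mathcal E_{jl}+\mathcal D_j\mathcal E_{li}-\mathcal D_l\mathcal E_{ji}),\quad \Gamma_{\bar i\bar j}^{\bar k}=\tfrac12 g^{kl}\bar{\mathcal D}_i\mathcal E_{lj},$$ so that for instance $\nabla_i\bar\eta_j=\mathcal D_i\bar\eta_j-\Gamma_{i\bar j}^{\bar k}\bar\eta_k$ and $\bar\nabla_j\eta_i=\bar{\mathcal D}_j\eta_i-\Gamma_{\bar ji}^k\eta_k$. Define $$\begin{aligned}\mathcal K_{pq}={}&\tfrac14(\nabla^s\mathcal D_s\mathcal E_{pq}+\bar\nabla^s\bar{\mathcal D}_s\mathcal E_{pq}-2\nabla^s\mathcal D_p\mathcal E_{sq}-2\bar\nabla^s\bar{\mathcal D}_q\mathcal E_{ps})-(\bar\nabla_q\mathcal D_pd+\nabla_p\bar{\mathcal D}_qd)\\&+\tfrac14g^{jk}(\bar{\mathcal D}_q\mathcal E_{pj}\mathcal D^i\mathcal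 E_{ik}+\tfrac12\bar{\mathcal D}_q\mathcal E_{ik}\mathcal D^i\mathcal E_{pj}+\mathcal D_p\mathcal E_{jq}\bar{\mathcal D}^i\mathcal E_{ki}+\tfrac12\mathcal D_p\mathcal E_{ki}\bar{\mathcal D}^i\mathcal E_{jq})\\&-\tfrac14(\bar{\mathcal D}^j\mathcal E_{iq}\mathcal D^i\mathcal E_{pj}+\tfrac12\bar{\mathcal D}^i\mathcal E_{ji}\mathcal D^j\mathcal E_{pq}+\tfrac12\bar{\mathcal D}^i\mathcal E_{pq}\mathcal D^j\mathcal E_{ji})-\tfrac14g^{ik}g^{jl}\bar{\mathcal D}_q\mathcal E_{ij}\mathcal D_p\mathcal E_{kl}\end{aligned}$$ and $\mathcal K^{pq}=g^{pk}g^{ql}\mathcal K_{kl}$. The action is $S=\int dx\,d\tilde x\,e^{-2d}L$ with $$L=-\tfrac14g^{ik}g^{jl}\mathcal D^p\mathcal E_{kl}\mathcal D_p\mathcal E_{ij}+\tfrac14g^{kl}(\mathcal D^j\mathcal E_{ik}\mathcal D^i\mathcal E_{jl}+\bar{\mathcal D}^j\mathcal E_{ki}\bar{\mathcal D}^i\mathcal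 E_{lj})+(\mathcal D^id\,\bar{\mathcal D}^j\mathcal E_{ij}+\bar{\mathcal D}^id\,\mathcal D^j\mathcal E_{ji})+4\mathcal D^id\,\mathcal D_id .$$ Its $\mathbb Z_2$-symmetrized form has the bracket $L_{\rm sym}$ obtained from $L$ by replacing $\mathcal D^p\mathcal E_{kl}\mathcal D_p\mathcal E_{ij}$ by $\tfrac12(\mathcal D^p\mathcal E_{kl}\mathcal D_p\mathcal E_{ij}+\bar{\mathcal D}^p\mathcal E_{kl}\bar{\mathcal D}_p\mathcal E_{ij})$ and $4\mathcal D^id\,\mathcal D_id$ by $2(\mathcal D^id\,\mathcal D_id+\bar{\mathcal D}^id\,\bar{\mathcal D}_id)$. The strong constraint says that $\partial_i\tilde\partial^iA=0$ and $\partial_i\tilde\partial^i(AB)=0$ for all $A,B$ among the components of $\mathcal E$ and $d$. Each of the $2D$ coordinates is either a line or a circle of some circumference. The fields and variations are periodic in the circle coordinates, integrals run over a fundamental domain, and variations $\delta\mathcal E$ are smooth with compact support on the resulting space. (They need not satisfy the strong constraint; those that do are included.) The variation $\delta_{\mathcal E}S$ is the derivative at $s=0$ of $S[\mathcal E+s\,\delta\mathcal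 E,d]-S[\mathcal E,d]$, the integral of the difference of the integrands, which is integrable for small $s$. \textbf{Claim.} (1) Assume the strong constraint. Then $L=L_{\rm sym}$, and for the action with bracket $L$ and equally for the one with bracket $L_{\rm sym}$, every variation satisfies $$\delta_{\mathcal E}S=\int dx\,d\tilde x\;e^{-2d}\,\delta\mathcal E_{pq}\,\mathcal K^{pq},$$ the integrand on the right being integrable. Hence $\delta_{\mathcal E}S=0$ for all variations $\delta\mathcal E$ if and only if $\mathcal K_{pq}=0$ everywhere. More generally, if $\mathcal E$ and $d$ depend only on a subset $I$ of the coordinates and all coordinates outside $I$ are circles, then $\mathcal K_{pq}=0$ everywhere if and only if $\delta_{\mathcal E}S=0$ for all variations that depend only on the coordinates in $I$. (If $I$ contains at most one of $x^i,\tilde x_i$ for each $i$, these are variations within fields that satisfy the strong constraint.) (2) $\mathcal K_{pq}$ is an $O(D,D)$ tensor whose first index is unbarred and whose second is barred: let $h=\begin{pmatrix}a&b\\c&\mathsf d\end{pmatrix}$ preserve $\begin{pmatrix}0&1\\1&0\end{pmatrix}$, let $c\,\mathcal E(X)+\mathsf d$ be invertible for all $X$, and let $\mathcal E'(hX)=(a\mathcal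 E(X)+b)(c\,\mathcal E(X)+\mathsf d)^{-1}$ and $d'(hX)=d(X)$. With $M(X)=\mathsf d^t-\mathcal E(X)c^t$ and $\bar M(X)=\mathsf d^t+\mathcal E(X)^tc^t$, which are invertible, and with $\mathcal K'$ built from $(\mathcal E',d')$, $$\mathcal K_{pq}(X)=M_p{}^k\bar M_q{}^l\,\mathcal K'_{kl}(hX),\qquad \mathcal K^{pq}(X)=\mathcal K'^{kl}(hX)\,(M^{-1})_k{}^p(\bar M^{-1})_l{}^q .$$ (3) The $\mathbb Z_2$ transformation $\mathcal E_{ij}(\tilde x,x)\mapsto\mathcal E_{ji}(-\tilde x,x)$, $d(\tilde x,x)\mapsto d(-\tilde x,x)$ exchanges $\mathcal D_i$ and $\bar{\mathcal D}_i$ (acting on functions composed with the reflection $\tilde x\mapsto-\tilde x$), and it maps $\mathcal K^{pq}(\tilde x,x)\mapsto\mathcal K^{qp}(-\tilde x,x)$ and likewise $\mathcal K_{pq}(\tilde x,x)\mapsto\mathcal K_{qp}(-\tilde x,x)$. -/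

import Mathlib

open scoped ContDiff Topology

noncomputable section

namespace DFT

/-- Doubled coordinates `X = (x̃, x)`: `X (Sum.inl i)` is the winding coordinate `x̃_i` and
`X (Sum.inr i)` is the coordinate `x^i`. -/
abbrev Dbl (D : ℕ) : Type := Fin D ⊕ Fin D → ℝ

/-- A `D × D` matrix valued field on the doubled space, such as `ℰ_{ij} = g_{ij} + b_{ij}`. -/
abbrev MField (D : ℕ) : Type := Dbl D → Matrix (Fin D) (Fin D) ℝ

/-- A real valued field on the doubled space, such as the dilaton. -/
abbrev SField (D : ℕ) : Type := Dbl D → ℝ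

variable {D : ℕ}

/-- The partial derivative in the coordinate `m`:
`pd (Sum.inr i)` is `∂_i = ∂/∂x^i` and `pd (Sum.inl i)` is `∂̃^i = ∂/∂x̃_i`. -/
def pd (m : Fin D ⊕ Fin D) (f : SField D) : SField D :=
  fun X => fderiv ℝ f X (Pi.single m 1)

/-- The metric `g_{ij} = (ℰ_{ij} + ℰ_{ji}) / 2`. -/
def gLow (E : MField D) (X : Dbl D) : Matrix (Fin D) (Fin D) ℝ :=
  (1 / 2 : ℝ) • (E X + (E X).transpose)

/-- The inverse metric `g^{ij}`. -/
def gUp (E : MField D) (X : Dbl D) : Matrix (Fin D) (Fin D) ℝ := (gLow E X)⁻¹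

/-- Smooth fields with nondegenerate metric (of any signature). -/
structure IsBackground (E : MField D) (d : SField D) : Prop where
  smooth_E : ∀ i j, ContDiff ℝ ∞ (fun X => E X i j)
  smooth_d : ContDiff ℝ ∞ d
  nondeg : ∀ X, (gLow E X).det ≠ 0

/-- `∂^M ∂_M f = 2 ∂_i ∂̃^i f`. -/
def box (f : SField D) : SField D :=
  fun X => 2 * ∑ i, pd (Sum.inr i) (pd (Sum.inl i) f) X

/-- The component functions of the fields `ℰ` and `d`. -/
def components (E : MField D) (d : SField D) : Set (SField D) :=
  {f | f = d ∨ ∃ i j, f = fun X => E X i j}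

/-- The strong constraint: `∂^M ∂_M` annihilates the fields and all their products. -/
def StrongConstraint (E : MField D) (d : SField D) : Prop :=
  (∀ A ∈ components E d, ∀ X, box A X = 0) ∧
  ∀ A ∈ components E d, ∀ B ∈ components E d, ∀ X, box (fun Y => A Y * B Y) X = 0

/-- `𝒟_i = ∂_i - ℰ_{ik} ∂̃^k`. -/
def cD (E : MField D) (i : Fin D) (f : SField D) : SField D :=
  fun X => pd (Sum.inr i) f X - ∑ k, E X i k * pd (Sum.inl k) f X

/-- `𝒟̄_i = ∂_i + ℰ_{ki} ∂̃^k`. -/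
def cDb (E : MField D) (i : Fin D) (f : SField D) : SField D :=
  fun X => pd (Sum.inr i) f X + ∑ k, E X k i * pd (Sum.inl k) f X

/-- `𝒟_i ℰ_{kl}`. -/
def DE (E : MField D) (i k l : Fin D) : SField D := cD E i (fun X => E X k l)

/-- `𝒟̄_i ℰ_{kl}`. -/
def DbE (E : MField D) (i k l : Fin D) : SField D := cDb E i (fun X => E X k l)

/-- `𝒟^i f = g^{is} 𝒟_s f`. -/
def cDUp (E : MField D) (i : Fin D) (f : SField D) : SField D :=
  fun X => ∑ s, gUp E X i s * cD E s f X

/-- `𝒟̄^i f = g^{is} 𝒟̄_s f`. -/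
def cDbUp (E : MField D) (i : Fin D) (f : SField D) : SField D :=
  fun X => ∑ s, gUp E X i s * cDb E s f X

/-- `𝒟^i ℰ_{kl}`. -/
def DEUp (E : MField D) (i k l : Fin D) : SField D := cDUp E i (fun X => E X k l)

/-- `𝒟̄^i ℰ_{kl}`. -/
def DbEUp (E : MField D) (i k l : Fin D) : SField D := cDbUp E i (fun X => E X k l)

/-- The bracket of the background independent action (the Lagrangian without `e^{-2d}`). -/
def lag (E : MField D) (d : SField D) : SField D := fun X =>
  - (1 / 4) * (∑ i, ∑ j, ∑ k, ∑ l, ∑ p,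
      gUp E X i k * gUp E X j l * DEUp E p k l X * DE E p i j X)
  + (1 / 4) * (∑ i, ∑ j, ∑ k, ∑ l, gUp E X k l *
      (DEUp E j i k X * DEUp E i j l X + DbEUp E j k i X * DbEUp E i l j X))
  + (∑ i, ∑ j, (cDUp E i d X * DbEUp E j i j X + cDbUp E i d X * DEUp E j j i X))
  + 4 * ∑ i, cDUp E i d X * cD E i d X

/-- The bracket of the manifestly `ℤ₂` symmetric form of the action. -/
def lagSym (E : MField D) (d : SField D) : SField D := fun X =>
  - (1 / 4) * (∑ i, ∑ j, ∑ k, ∑ l, ∑ p,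
      gUp E X i k * gUp E X j l *
        ((1 / 2) * (DEUp E p k l X * DE E p i j X) + (1 / 2) * (DbEUp E p k l X * DbE E p i j X)))
  + (1 / 4) * (∑ i, ∑ j, ∑ k, ∑ l, gUp E X k l *
      (DEUp E j i k X * DEUp E i j l X + DbEUp E j k i X * DbEUp E i l j X))
  + (∑ i, ∑ j, (cDUp E i d X * DbEUp E j i j X + cDbUp E i d X * DEUp E j j i X))
  + 2 * ∑ i, (cDUp E i d X * cD E i d X + cDbUp E i d X * cDb E i d X)

/-! Christoffel-like symbols; the last argument is the upper index, `u` stands for an unbarred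
and `b` for a barred lower index. -/

/-- `Γ_{ij}^k = ½ g^{kl} 𝒟_i ℰ_{jl}`. -/
def Guu (E : MField D) (i j k : Fin D) : SField D := fun X =>
  (1 / 2) * ∑ l, gUp E X k l * DE E i j l X

/-- `Γ_{i j̄}^{k̄} = ½ g^{kl} (𝒟_i ℰ_{lj} + 𝒟̄_j ℰ_{il} - 𝒟̄_l ℰ_{ij})`. -/
def Gub (E : MField D) (i j k : Fin D) : SField D := fun X =>
  (1 / 2) * ∑ l, gUp E X k l * (DE E i l j X + DbE E j i l X - DbE E l i j X)

/-- `Γ_{ī j}^k = ½ g^{kl} (𝒟̄_i ℰ_{jl} + 𝒟_j ℰ_{li} - 𝒟_l ℰ_{ji})`. -/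
def Gbu (E : MField D) (i j k : Fin D) : SField D := fun X =>
  (1 / 2) * ∑ l, gUp E X k l * (DbE E i j l X + DE E j l i X - DE E l j i X)

/-- `Γ_{ī j̄}^{k̄} = ½ g^{kl} 𝒟̄_i ℰ_{lj}`. -/
def Gbb (E : MField D) (i j k : Fin D) : SField D := fun X =>
  (1 / 2) * ∑ l, gUp E X k l * DbE E i l j X

/-- `∇_i η̄_j` for a barred covector. -/
def nabB (E : MField D) (η : Fin D → SField D) (i j : Fin D) : SField D := fun X =>
  cD E i (η j) X - ∑ k, Gub E i j k X * η k X

/-- `∇̄_j η_i` for an unbarred covector. -/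
def nabbU (E : MField D) (η : Fin D → SField D) (j i : Fin D) : SField D := fun X =>
  cDb E j (η i) X - ∑ k, Gbu E j i k X * η k X

/-- `∇_r T_{a b c}` where `a`, `b` are unbarred and `c` is barred. -/
def nabUUB (E : MField D) (T : Fin D → Fin D → Fin D → SField D) (r a b c : Fin D) :
    SField D := fun X =>
  cD E r (T a b c) X - ∑ k, Guu E r a k X * T k b c X - ∑ k, Guu E r b k X * T a k c X
    - ∑ k, Gub E r c k X * T a b k X

/-- `∇̄_r T_{a b c}` where `b` is unbarred and `a`, `c` are barred. -/
def nabbBUB (E : MField D) (T : Fin D → Fin D → Fin D → SField D) (r a b c : Fin D) :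
    SField D := fun X =>
  cDb E r (T a b c) X - ∑ k, Gbb E r a k X * T k b c X - ∑ k, Gbu E r b k X * T a k c X
    - ∑ k, Gbb E r c k X * T a b k X

/-- The Ricci-like tensor `𝒦_{pq}`. -/
def KLow (E : MField D) (d : SField D) : MField D := fun X => Matrix.of fun p q =>
  (1 / 4) * (∑ s, ∑ r, gUp E X s r *
      (nabUUB E (DE E) r s p q X + nabbBUB E (DbE E) r s p q X
        - 2 * nabUUB E (DE E) r p s q X - 2 * nabbBUB E (DbE E) r q p s X))
  - (nabbU E (fun i => cD E i d) q p X + nabB E (fun i => cDb E i d) p q X)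
  + (1 / 4) * (∑ i, ∑ j, ∑ k, gUp E X j k *
      (DbE E q p j X * DEUp E i i k X + (1 / 2) * (DbE E q i k X * DEUp E i p j X)
        + DE E p j q X * DbEUp E i k i X + (1 / 2) * (DE E p k i X * DbEUp E i j q X)))
  - (1 / 4) * (∑ i, ∑ j,
      (DbEUp E j i q X * DEUp E i p j X + (1 / 2) * (DbEUp E i j i X * DEUp E j p q X)
        + (1 / 2) * (DbEUp E i p q X * DEUp E j j i X)))
  - (1 / 4) * (∑ i, ∑ j, ∑ k, ∑ l, gUp E X i k * gUp E X j l * (DbE E q i j X * DE E p k l X))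

/-- `𝒦^{pq} = g^{pk} g^{ql} 𝒦_{kl}`. -/
def KUp (E : MField D) (d : SField D) : MField D := fun X => Matrix.of fun p q =>
  ∑ k, ∑ l, gUp E X p k * gUp E X q l * KLow E d X k l

/-! The space of integration. The coordinate `m` is a circle of circumference `ℓ m` if `0 < ℓ m`
and a line if `ℓ m = 0`. -/

/-- Periodicity with period `ℓ m` in every coordinate `m` (no condition where `ℓ m = 0`). -/
def HasPeriods {α : Type*} (ℓ : Fin D ⊕ Fin D → ℝ) (f : Dbl D → α) : Prop :=
  ∀ m X, f (X + Pi.single m (ℓ m)) = f X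

/-- A fundamental domain of the space of integration. -/
def cell (ℓ : Fin D ⊕ Fin D → ℝ) : Set (Dbl D) :=
  {X | ∀ m, 0 < ℓ m → X m ∈ Set.Ico 0 (ℓ m)}

/-- An admissible variation `δℰ`: smooth, and compactly supported on the space of integration. -/
structure IsVariation (ℓ : Fin D ⊕ Fin D → ℝ) (δE : MField D) : Prop where
  smooth : ∀ i j, ContDiff ℝ ∞ (fun X => δE X i j)
  periodic : HasPeriods ℓ δE
  bounded_support : Bornology.IsBounded {X ∈ cell ℓ | δE X ≠ 0}

/-- `f` depends only on the coordinates in `I`. -/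
def DependsOnlyOn {α : Type*} (I : Set (Fin D ⊕ Fin D)) (f : Dbl D → α) : Prop :=
  ∀ m ∉ I, ∀ (t : ℝ) (X : Dbl D), f (X + Pi.single m t) = f X

/-- The integrand of `S[ℰ + s δℰ, d] - S[ℰ, d]`, where `S = ∫ dx dx̃ e^{-2d} L`. -/
def actionDiffDensity (L : MField D → SField D → SField D) (E : MField D) (d : SField D)
    (δE : MField D) (s : ℝ) : SField D := fun X =>
  Real.exp (-2 * d X) * L (fun Y => E Y + s • δE Y) d X - Real.exp (-2 * d X) * L E d X

/-- `δ_ℰ S = v` for the action `S = ∫ dx dx̃ e^{-2d} L`: the derivative at `s = 0` of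
`S[ℰ + s δℰ, d] - S[ℰ, d]` is `v`. The difference is integrated, since `S` itself may diverge. -/
def HasActionVariation (L : MField D → SField D → SField D) (ℓ : Fin D ⊕ Fin D → ℝ)
    (E : MField D) (d : SField D) (δE : MField D) (v : ℝ) : Prop :=
  (∀ᶠ s in 𝓝 (0 : ℝ), MeasureTheory.IntegrableOn (actionDiffDensity L E d δE s) (cell ℓ)) ∧
  HasDerivAt (fun s : ℝ => ∫ X in cell ℓ, actionDiffDensity L E d δE s X) v 0

/-- The integrand `e^{-2d} δℰ_{pq} 𝒦^{pq}`. -/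
def variationDensity (E : MField D) (d : SField D) (δE : MField D) : SField D := fun X =>
  Real.exp (-2 * d X) * ∑ p, ∑ q, δE X p q * KUp E d X p q

/-! The `ℤ₂` symmetry. -/

/-- The reflection `(x̃, x) ↦ (-x̃, x)`. -/
def reflect (X : Dbl D) : Dbl D := Sum.elim (fun i => - X (Sum.inl i)) (fun i => X (Sum.inr i))

/-- The `ℤ₂` image of `ℰ`: transposition, together with the reflection of `x̃`. -/
def z2E (E : MField D) : MField D := fun X => (E (reflect X)).transpose

/-- The `ℤ₂` image of a scalar field such as `d`. -/
def z2S (f : SField D) : SField D := fun X => f (reflect X)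

/-! The group `O(D,D)`, with `h = (a b; c d)` acting on `X = (x̃, x)`. -/

/-- The invariant metric `η`. -/
def etaMat (D : ℕ) : Matrix (Fin D ⊕ Fin D) (Fin D ⊕ Fin D) ℝ := Matrix.fromBlocks 0 1 1 0

/-- `h ∈ O(D,D)`. -/
def IsODD (h : Matrix (Fin D ⊕ Fin D) (Fin D ⊕ Fin D) ℝ) : Prop :=
  h.transpose * etaMat D * h = etaMat D

/-- `(ℰ', d')` is the transform of `(ℰ, d)` under `h`:
`ℰ'(hX) = (a ℰ(X) + b) (c ℰ(X) + d)⁻¹` with `c ℰ(X) + d` invertible, and `d'(hX) = d(X)`. -/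
structure IsODDTransform (h : Matrix (Fin D ⊕ Fin D) (Fin D ⊕ Fin D) ℝ)
    (E : MField D) (d : SField D) (E' : MField D) (d' : SField D) : Prop where
  isUnit_det : ∀ X, (h.toBlocks₂₁ * E X + h.toBlocks₂₂).det ≠ 0
  map_E : ∀ X, E' (h.mulVec X) =
    (h.toBlocks₁₁ * E X + h.toBlocks₁₂) * (h.toBlocks₂₁ * E X + h.toBlocks₂₂)⁻¹
  map_d : ∀ X, d' (h.mulVec X) = d X

/-- `M(X) = dᵗ - ℰ(X) cᵗ`. -/
def oddM (h : Matrix (Fin D ⊕ Fin D) (Fin D ⊕ Fin D) ℝ) (E : MField D) : MField D := fun X =>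
  h.toBlocks₂₂.transpose - E X * h.toBlocks₂₁.transpose

/-- `M̄(X) = dᵗ + ℰ(X)ᵗ cᵗ`. -/
def oddMb (h : Matrix (Fin D ⊕ Fin D) (Fin D ⊕ Fin D) ℝ) (E : MField D) : MField D := fun X =>
  h.toBlocks₂₂.transpose + (E X).transpose * h.toBlocks₂₁.transpose

/-- `T_{i j̄}(X) = M_i^k M̄_j^l T'_{k l̄}(X')`: a tensor with a first lower index that is unbarred
and a second that is barred. -/
def TransformsLower (h : Matrix (Fin D ⊕ Fin D) (Fin D ⊕ Fin D) ℝ) (E : MField D)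
    (T T' : MField D) : Prop :=
  ∀ X i j, T X i j = ∑ k, ∑ l, oddM h E X i k * oddMb h E X j l * T' (h.mulVec X) k l

/-- `U^{i j̄}(X) = U'^{k l̄}(X') (M⁻¹)_k^i (M̄⁻¹)_l^j`, with `M` and `M̄` invertible: a tensor with a
first upper index that is unbarred and a second that is barred. -/
def TransformsUpper (h : Matrix (Fin D ⊕ Fin D) (Fin D ⊕ Fin D) ℝ) (E : MField D)
    (U U' : MField D) : Prop :=
  ∀ X, (oddM h E X).det ≠ 0 ∧ (oddMb h E X).det ≠ 0 ∧
    ∀ i j, U X i j =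
      ∑ k, ∑ l, U' (h.mulVec X) k l * (oddM h E X)⁻¹ k i * (oddMb h E X)⁻¹ l j

end DFT

end

set_option linter.unusedSimpArgs false

noncomputable section

namespace DFT

variable {D : ℕ}

/-! Write A_{ijk} = 𝒟_i ℰ_{jk}, C_{ijk} = 𝒟̄_i ℰ_{kj}, u = 𝒟d, v = 𝒟̄d. The symmetrized bracket and
𝒦 are each a sum of two halves of the same algebraic shape (`lagSym_eq`, `KLow_eq`), and the second
half is the first with A, C and u, v exchanged. Hence most of the work concerns one half, with A and
C treated as bare arrays, and the ℤ₂ statement is immediate.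

The calculus rests on one observation. If the metric moves with velocity w + wᵗ, the derivative of a
contraction is the contraction of derivatives corrected by w on both contracted indices
(`ctr_hasDerivAt`), and each contracted pair may use its own w. In the direction δℰ one takes w =
δℰ/2 or its transpose; along the frame vectors one takes the Christoffel-like symbols, whose
unbarred and barred versions induce the same velocity of g.

Variation of L_sym: since 𝒟̄_i - 𝒟_i = 2 g_{ik} ∂̃^k, varying the ℰ inside 𝒟 produces only A and C
again, and the corrected variation of A is ∇δℰ plus algebraic terms (`cov3_eq_covA`,
`lhalf_hasDerivAt`). Integrating ∇ by parts against e^{-2d} (`sum_div_flux`) gives a half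
Euler-Lagrange expression. It is not the corresponding half of 𝒦, but the excess is odd under the
exchange of the halves and drops out of the sum (`elHalf_add_elHalf`). The result is the pointwise
identity `lagSymVar_eq`: first variation = density with 𝒦 + divergence. The divergence integrates to
zero by periodicity and compact support (`hasActionVariation_of`).

Passage to L: L - L_sym is a combination of ∂^M ℰ ∂_M ℰ and ∂^M d ∂_M d (`lag_eq`), which the strong
constraint annihilates on the background. A variation need not obey the constraint, so a term in ∂^M
δℰ ∂_M ℰ survives. Weighted with e^{-2d} and two inverse metrics it is a divergence, because ∂^M ∂_M
ℰ = 0 and the gradients of d and g^{ij} are η-orthogonal to that of ℰ (`sum_pd_pairBdry`).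

Field equation: the test variation is 𝒦^{pq} times a cutoff in the line coordinates. It inherits the
periods and the coordinate dependence of the background, and its density is a positive multiple of a
sum of squares.

O(D,D): the linear map h sends the frame vectors to those of ℰ' with coefficients M and M̄
(`mulVec_uVec`, `mulVec_bVec`), dℰ = M dℰ' M̄ᵗ (`fderiv_E`), and both M and M̄ relate the two
metrics. The inhomogeneous terms come from derivatives of M and M̄, which are -dℰ cᵗ and dℰᵗ cᵗ.
Because M̄ = M + 2 g cᵗ, the contractions in the connections that mix an unbarred with a barred
index fail to be covariant by exactly the opposite amount (`unbarred_connection`,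
`barred_connection`). -/

/-- The contraction `G^{ij} f_{ij}`. -/
def ctr (G : Matrix (Fin D) (Fin D) ℝ) (f : Fin D → Fin D → ℝ) : ℝ :=
  ∑ i, ∑ j, G i j * f i j

/-! ### Algebra of contractions with a fixed matrix -/

section ctr
variable (G : Matrix (Fin D) (Fin D) ℝ)

lemma ctr_congr {f f' : Fin D → Fin D → ℝ} (h : ∀ i j, f i j = f' i j) : ctr G f = ctr G f' := by
  simp only [ctr, h]

lemma ctr_add (f f' : Fin D → Fin D → ℝ) :
    ctr G (fun i j => f i j + f' i j) = ctr G f + ctr G f' := by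
  simp only [ctr, mul_add, Finset.sum_add_distrib]

lemma ctr_sub (f f' : Fin D → Fin D → ℝ) :
    ctr G (fun i j => f i j - f' i j) = ctr G f - ctr G f' := by
  simp only [ctr, mul_sub, Finset.sum_sub_distrib]

lemma ctr_neg (f : Fin D → Fin D → ℝ) : ctr G (fun i j => - f i j) = - ctr G f := by
  simp only [ctr, mul_neg, Finset.sum_neg_distrib]

lemma mul_ctr (c : ℝ) (f : Fin D → Fin D → ℝ) : c * ctr G f = ctr G (fun i j => c * f i j) := by
  simp only [ctr, Finset.mul_sum]
  exact Finset.sum_congr rfl fun i _ => Finset.sum_congr rfl fun j _ => by ring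

lemma ctr_mul (c : ℝ) (f : Fin D → Fin D → ℝ) : ctr G f * c = ctr G (fun i j => f i j * c) := by
  simp only [ctr, Finset.sum_mul]
  exact Finset.sum_congr rfl fun i _ => Finset.sum_congr rfl fun j _ => by ring

lemma ctr_comm (f : Fin D → Fin D → Fin D → Fin D → ℝ) :
    ctr G (fun i j => ctr G (fun k l => f i j k l)) =
      ctr G (fun k l => ctr G (fun i j => f i j k l)) := by
  simp only [ctr, Finset.mul_sum, ← Finset.sum_product', Finset.univ_product_univ]
  exact Fintype.sum_equiv ⟨fun x => (x.2.2.1, x.2.2.2, x.1, x.2.1),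
    fun x => (x.2.2.1, x.2.2.2, x.1, x.2.1), fun _ => rfl, fun _ => rfl⟩ _ _ fun x => by
      simp only [Equiv.coe_fn_mk]; ring

variable {G}

lemma ctr_flip (hG : ∀ i j, G i j = G j i) (f : Fin D → Fin D → ℝ) :
    ctr G f = ctr G (fun i j => f j i) := by
  unfold ctr
  rw [Finset.sum_comm]
  exact Finset.sum_congr rfl fun i _ => Finset.sum_congr rfl fun j _ => by rw [hG]

end ctr

/-! ### 𝒦 as a sum of two halves exchanged by ℤ₂ -/

/-- Covariant derivative of a tensor with two unbarred indices and a barred one, in components: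
`A_{ijk}` and `C_{ikj}` are the two calligraphic derivatives of `ℰ`, and `dT` the plain
derivative of `T`. -/
def nab3 (G : Matrix (Fin D) (Fin D) ℝ) (A C : Fin D → Fin D → Fin D → ℝ)
    (dT : Fin D → Fin D → Fin D → Fin D → ℝ) (T : Fin D → Fin D → Fin D → ℝ)
    (r a b c : Fin D) : ℝ :=
  dT r a b c - ctr G (fun l m => 1 / 2 * A r a l * T m b c)
    - ctr G (fun l m => 1 / 2 * A r b l * T a m c)
    - ctr G (fun l m => 1 / 2 * (A r l c + C c l r - C l c r) * T a b m)

/-- Covariant derivative of a barred covector, in components. -/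
def nab1 (G : Matrix (Fin D) (Fin D) ℝ) (A C : Fin D → Fin D → Fin D → ℝ)
    (dη : Fin D → Fin D → ℝ) (η : Fin D → ℝ) (r c : Fin D) : ℝ :=
  dη r c - ctr G (fun l m => 1 / 2 * (A r l c + C c l r - C l c r) * η m)

/-- One of the two `ℤ₂` related halves of `𝒦`. -/
def khalf (G : Matrix (Fin D) (Fin D) ℝ) (A C : Fin D → Fin D → Fin D → ℝ)
    (nA : Fin D → Fin D → Fin D → Fin D → ℝ) (nv : Fin D → Fin D → ℝ) (p q : Fin D) : ℝ :=
  1 / 4 * ctr G (fun s r => nA r s p q) - 1 / 2 * ctr G (fun s r => nA r p s q) - nv p q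
  + 1 / 4 * ctr G (fun j j' => ctr G (fun i i' => A p j q * C i i' j'))
  + 1 / 8 * ctr G (fun j j' => ctr G (fun i i' => A p j i * C i' q j'))
  - 1 / 8 * ctr G (fun j j' => ctr G (fun i i' => C i i' j * A j' p q))
  - 1 / 8 * ctr G (fun j j' => ctr G (fun i i' => C j q i * A i' p j'))
  - 1 / 8 * ctr G (fun j j' => ctr G (fun i i' => C q j i * A p i' j'))

/-- The components `𝒟̄_i ℰ_{kj}`, the `ℤ₂` image of `𝒟_i ℰ_{jk}`. -/
def CE (E : MField D) (i j k : Fin D) : SField D := DbE E i k j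

lemma gLow_symm (E : MField D) (X : Dbl D) (i j : Fin D) : gLow E X i j = gLow E X j i := by
  simp [gLow, add_comm]

lemma gUp_symm (E : MField D) (X : Dbl D) (i j : Fin D) : gUp E X i j = gUp E X j i := by
  have h : (gLow E X).transpose = gLow E X := by
    ext i j; exact gLow_symm E X j i
  conv_lhs => rw [gUp, ← h, ← Matrix.transpose_nonsing_inv]
  rfl

lemma nabUUB_eq (E : MField D) (T : Fin D → Fin D → Fin D → SField D) (r a b c : Fin D)
    (X : Dbl D) : nabUUB E T r a b c X =
      nab3 (gUp E X) (fun i j k => DE E i j k X) (fun i j k => CE E i j k X)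
        (fun r a b c => cD E r (T a b c) X) (fun a b c => T a b c X) r a b c := by
  have key : ∀ f g : Fin D → ℝ, ∑ k, (1 / 2) * (∑ l, gUp E X k l * f l) * g k =
      ctr (gUp E X) (fun l m => 1 / 2 * f l * g m) := by
    intro f g
    rw [ctr_flip (gUp_symm E X)]
    simp only [ctr, Finset.mul_sum, Finset.sum_mul]
    exact Finset.sum_congr rfl fun i _ => Finset.sum_congr rfl fun j _ => by ring
  simp only [nabUUB, nab3, Guu, Gub, key, CE]

lemma nabbBUB_eq (E : MField D) (T : Fin D → Fin D → Fin D → SField D) (r a b c : Fin D)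
    (X : Dbl D) : nabbBUB E T r a c b X =
      nab3 (gUp E X) (fun i j k => CE E i j k X) (fun i j k => DE E i j k X)
        (fun r a b c => cDb E r (T a c b) X) (fun a b c => T a c b X) r a b c := by
  have key : ∀ f g : Fin D → ℝ, ∑ k, (1 / 2) * (∑ l, gUp E X k l * f l) * g k =
      ctr (gUp E X) (fun l m => 1 / 2 * f l * g m) := by
    intro f g
    rw [ctr_flip (gUp_symm E X)]
    simp only [ctr, Finset.mul_sum, Finset.sum_mul]
    exact Finset.sum_congr rfl fun i _ => Finset.sum_congr rfl fun j _ => by ring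
  simp only [nabbBUB, nab3, Gbb, Gbu, key, CE]
  ring

lemma nabB_eq (E : MField D) (η : Fin D → SField D) (i j : Fin D) (X : Dbl D) :
    nabB E η i j X = nab1 (gUp E X) (fun i j k => DE E i j k X) (fun i j k => CE E i j k X)
      (fun i j => cD E i (η j) X) (fun j => η j X) i j := by
  simp only [nabB, nab1, Gub, CE]
  rw [ctr_flip (gUp_symm E X)]
  simp only [ctr, Finset.mul_sum, Finset.sum_mul]
  congr 1
  exact Finset.sum_congr rfl fun i _ => Finset.sum_congr rfl fun j _ => by ring

lemma nabbU_eq (E : MField D) (η : Fin D → SField D) (i j : Fin D) (X : Dbl D) :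
    nabbU E η i j X = nab1 (gUp E X) (fun i j k => CE E i j k X) (fun i j k => DE E i j k X)
      (fun i j => cDb E i (η j) X) (fun j => η j X) i j := by
  simp only [nabbU, nab1, Gbu, CE]
  rw [ctr_flip (gUp_symm E X)]
  simp only [ctr, Finset.mul_sum, Finset.sum_mul]
  congr 1
  exact Finset.sum_congr rfl fun i _ => Finset.sum_congr rfl fun j _ => by ring

/-- The half of `𝒦` built from `𝒟ℰ` and `∇`. -/
def kHalfU (E : MField D) (d : SField D) (p q : Fin D) : SField D := fun X =>
  khalf (gUp E X) (fun i j k => DE E i j k X) (fun i j k => CE E i j k X)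
    (fun r a b c => nabUUB E (DE E) r a b c X)
    (fun i j => nabB E (fun i => cDb E i d) i j X) p q

/-- The half of `𝒦` built from `𝒟̄ℰ` and `∇̄`. -/
def kHalfB (E : MField D) (d : SField D) (p q : Fin D) : SField D := fun X =>
  khalf (gUp E X) (fun i j k => CE E i j k X) (fun i j k => DE E i j k X)
    (fun r a b c => nabbBUB E (DbE E) r a c b X)
    (fun i j => nabbU E (fun i => cD E i d) i j X) p q

lemma sum4_congr {f f' : Fin D → Fin D → Fin D → Fin D → ℝ} (e : Fin D × Fin D × Fin D × Fin D ≃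
    Fin D × Fin D × Fin D × Fin D)
    (h : ∀ x, f x.1 x.2.1 x.2.2.1 x.2.2.2 =
      f' (e x).1 (e x).2.1 (e x).2.2.1 (e x).2.2.2) :
    ∑ i, ∑ j, ∑ k, ∑ l, f i j k l = ∑ i, ∑ j, ∑ k, ∑ l, f' i j k l := by
  have (f : Fin D → Fin D → Fin D → Fin D → ℝ) : ∑ i, ∑ j, ∑ k, ∑ l, f i j k l =
      ∑ x : Fin D × Fin D × Fin D × Fin D, f x.1 x.2.1 x.2.2.1 x.2.2.2 := by
    simp only [← Finset.sum_product', Finset.univ_product_univ]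
  rw [this, this]
  exact Fintype.sum_equiv e _ _ h

/-- Every term of 𝒦 either has a distinct ℤ₂ partner, and the two go to different halves, or is its
own partner and is shared equally. What remains is renaming of summation indices with the symmetry
of g^{ij}. -/
lemma KLow_eq (E : MField D) (d : SField D) (X : Dbl D) (p q : Fin D) :
    KLow E d X p q = kHalfU E d p q X + kHalfB E d q p X := by
  have hs := gUp_symm E X
  simp only [KLow, Matrix.of_apply, kHalfU, kHalfB, khalf]
  have h1 : ∑ s, ∑ r, gUp E X s r *
      (nabUUB E (DE E) r s p q X + nabbBUB E (DbE E) r s p q X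
        - 2 * nabUUB E (DE E) r p s q X - 2 * nabbBUB E (DbE E) r q p s X) =
      ctr (gUp E X) (fun s r => nabUUB E (DE E) r s p q X) +
      ctr (gUp E X) (fun s r => nabbBUB E (DbE E) r s p q X) -
      2 * ctr (gUp E X) (fun s r => nabUUB E (DE E) r p s q X) -
      2 * ctr (gUp E X) (fun s r => nabbBUB E (DbE E) r q p s X) := by
    rw [mul_ctr, mul_ctr, ← ctr_add, ← ctr_sub, ← ctr_sub]; rfl
  have t1 : ∑ i, ∑ j, ∑ k, gUp E X j k * (DbE E q p j X * DEUp E i i k X) =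
      ctr (gUp E X) (fun j j' => ctr (gUp E X) (fun i i' => CE E q j p X * DE E i i' j' X)) := by
    simp only [ctr, DEUp, DbEUp, cDUp, cDbUp, Finset.mul_sum, Finset.sum_mul]
    refine sum4_congr ⟨fun x => (x.2.1, x.2.2.1, x.2.2.2, x.1), fun x => (x.2.2.2, x.1, x.2.1, x.2.2.1),
      fun _ => rfl, fun _ => rfl⟩ fun x => ?_
    simp only [Equiv.coe_fn_mk, CE, DE, DbE]
    rw [hs x.1]; ring
  have t2 : ∑ i, ∑ j, ∑ k, gUp E X j k * (DbE E q i k X * DEUp E i p j X) =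
      ctr (gUp E X) (fun j j' => ctr (gUp E X) (fun i i' => CE E q j i X * DE E i' p j' X)) := by
    simp only [ctr, DEUp, DbEUp, cDUp, cDbUp, Finset.mul_sum, Finset.sum_mul]
    refine sum4_congr ⟨fun x => (x.2.2.1, x.2.1, x.1, x.2.2.2), fun x => (x.2.2.1, x.2.1, x.1, x.2.2.2),
      fun _ => rfl, fun _ => rfl⟩ fun x => ?_
    simp only [Equiv.coe_fn_mk, CE, DE, DbE]
    rw [hs x.2.1]; ring
  have t3 : ∑ i, ∑ j, ∑ k, gUp E X j k * (DE E p j q X * DbEUp E i k i X) =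
      ctr (gUp E X) (fun j j' => ctr (gUp E X) (fun i i' => DE E p j q X * CE E i i' j' X)) := by
    simp only [ctr, DEUp, DbEUp, cDUp, cDbUp, Finset.mul_sum, Finset.sum_mul]
    refine sum4_congr ⟨fun x => (x.2.1, x.2.2.1, x.2.2.2, x.1), fun x => (x.2.2.2, x.1, x.2.1, x.2.2.1),
      fun _ => rfl, fun _ => rfl⟩ fun x => ?_
    simp only [Equiv.coe_fn_mk, CE, DE, DbE]
    rw [hs x.1]; ring
  have t4 : ∑ i, ∑ j, ∑ k, gUp E X j k * (DE E p k i X * DbEUp E i j q X) =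
      ctr (gUp E X) (fun j j' => ctr (gUp E X) (fun i i' => DE E p j i X * CE E i' q j' X)) := by
    simp only [ctr, DEUp, DbEUp, cDUp, cDbUp, Finset.mul_sum, Finset.sum_mul]
    refine sum4_congr ⟨fun x => (x.2.2.1, x.2.1, x.1, x.2.2.2), fun x => (x.2.2.1, x.2.1, x.1, x.2.2.2),
      fun _ => rfl, fun _ => rfl⟩ fun x => ?_
    simp only [Equiv.coe_fn_mk, CE, DE, DbE]
    rw [hs x.2.1]; ring
  -- This term is its own ℤ₂ image. It is brought to the form of the first half here and of the
  -- second half in `t6`, so that its coefficient 1/4 splits as 1/8 + 1/8; `t9` and `t10` do the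
  -- same for the last term.
  have t5 : ∑ i, ∑ j, DbEUp E j i q X * DEUp E i p j X =
      ctr (gUp E X) (fun j j' => ctr (gUp E X) (fun i i' => CE E j q i X * DE E i' p j' X)) := by
    simp only [ctr, DEUp, DbEUp, cDUp, cDbUp, Finset.mul_sum, Finset.sum_mul]
    refine sum4_congr ⟨fun x => (x.2.2.2, x.2.1, x.1, x.2.2.1), fun x => (x.2.2.1, x.2.1, x.2.2.2, x.1),
      fun _ => rfl, fun _ => rfl⟩ fun x => ?_
    simp only [Equiv.coe_fn_mk, CE, DE, DbE]
    rw [hs x.2.1]; ring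
  have t6 : ∑ i, ∑ j, DbEUp E j i q X * DEUp E i p j X =
      ctr (gUp E X) (fun j j' => ctr (gUp E X) (fun i i' => DE E j p i X * CE E i' q j' X)) := by
    simp only [ctr, DEUp, DbEUp, cDUp, cDbUp, Finset.mul_sum, Finset.sum_mul]
    refine sum4_congr ⟨fun x => (x.2.2.1, x.1, x.2.1, x.2.2.2), fun x => (x.2.1, x.2.2.1, x.1, x.2.2.2),
      fun _ => rfl, fun _ => rfl⟩ fun x => ?_
    simp only [Equiv.coe_fn_mk, CE, DE, DbE]
    rw [hs x.1]; ring
  have t7 : ∑ i, ∑ j, DbEUp E i j i X * DEUp E j p q X =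
      ctr (gUp E X) (fun j j' => ctr (gUp E X) (fun i i' => CE E i i' j X * DE E j' p q X)) := by
    simp only [ctr, DEUp, DbEUp, cDUp, cDbUp, Finset.mul_sum, Finset.sum_mul]
    refine sum4_congr ⟨fun x => (x.2.1, x.2.2.1, x.2.2.2, x.1), fun x => (x.2.2.2, x.1, x.2.1, x.2.2.1),
      fun _ => rfl, fun _ => rfl⟩ fun x => ?_
    simp only [Equiv.coe_fn_mk, CE, DE, DbE]
    rw [hs x.1]; ring
  have t8 : ∑ i, ∑ j, DbEUp E i p q X * DEUp E j j i X =
      ctr (gUp E X) (fun j j' => ctr (gUp E X) (fun i i' => DE E i i' j X * CE E j' q p X)) := by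
    simp only [ctr, DEUp, DbEUp, cDUp, cDbUp, Finset.mul_sum, Finset.sum_mul]
    refine sum4_congr ⟨fun x => (x.1, x.2.2.2, x.2.2.1, x.2.1), fun x => (x.1, x.2.2.2, x.2.2.1, x.2.1),
      fun _ => rfl, fun _ => rfl⟩ fun x => ?_
    simp only [Equiv.coe_fn_mk, CE, DE, DbE]
    rw [hs x.2.1]; ring
  have t9 : ∑ i, ∑ j, ∑ k, ∑ l, gUp E X i k * gUp E X j l * (DbE E q i j X * DE E p k l X) =
      ctr (gUp E X) (fun j j' => ctr (gUp E X) (fun i i' => CE E q j i X * DE E p i' j' X)) := by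
    simp only [ctr, DEUp, DbEUp, cDUp, cDbUp, Finset.mul_sum, Finset.sum_mul]
    refine sum4_congr ⟨fun x => (x.2.1, x.2.2.2, x.1, x.2.2.1), fun x => (x.2.2.1, x.1, x.2.2.2, x.2.1),
      fun _ => rfl, fun _ => rfl⟩ fun x => ?_
    simp only [Equiv.coe_fn_mk, CE, DE, DbE]
    ring
  have t10 : ∑ i, ∑ j, ∑ k, ∑ l, gUp E X i k * gUp E X j l * (DbE E q i j X * DE E p k l X) =
      ctr (gUp E X) (fun j j' => ctr (gUp E X) (fun i i' => DE E p j i X * CE E q i' j' X)) := by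
    simp only [ctr, DEUp, DbEUp, cDUp, cDbUp, Finset.mul_sum, Finset.sum_mul]
    refine sum4_congr ⟨fun x => (x.2.2.1, x.1, x.2.2.2, x.2.1), fun x => (x.2.1, x.2.2.2, x.1, x.2.2.1),
      fun _ => rfl, fun _ => rfl⟩ fun x => ?_
    simp only [Equiv.coe_fn_mk, CE, DE, DbE]
    rw [hs x.1, hs x.2.1]; ring
  have e2 : ∑ i, ∑ j, ∑ k, gUp E X j k *
      (DbE E q p j X * DEUp E i i k X + (1 / 2) * (DbE E q i k X * DEUp E i p j X)
        + DE E p j q X * DbEUp E i k i X + (1 / 2) * (DE E p k i X * DbEUp E i j q X)) =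
      (∑ i, ∑ j, ∑ k, gUp E X j k * (DbE E q p j X * DEUp E i i k X)) +
      1 / 2 * (∑ i, ∑ j, ∑ k, gUp E X j k * (DbE E q i k X * DEUp E i p j X)) +
      (∑ i, ∑ j, ∑ k, gUp E X j k * (DE E p j q X * DbEUp E i k i X)) +
      1 / 2 * (∑ i, ∑ j, ∑ k, gUp E X j k * (DE E p k i X * DbEUp E i j q X)) := by
    simp only [mul_add, Finset.sum_add_distrib, mul_left_comm _ (1 / 2 : ℝ), ← Finset.mul_sum]
  have e3 : ∑ i, ∑ j, (DbEUp E j i q X * DEUp E i p j X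
        + (1 / 2) * (DbEUp E i j i X * DEUp E j p q X)
        + (1 / 2) * (DbEUp E i p q X * DEUp E j j i X)) =
      (∑ i, ∑ j, DbEUp E j i q X * DEUp E i p j X)
        + (1 / 2) * (∑ i, ∑ j, DbEUp E i j i X * DEUp E j p q X)
        + (1 / 2) * (∑ i, ∑ j, DbEUp E i p q X * DEUp E j j i X) := by
    simp only [Finset.sum_add_distrib, ← Finset.mul_sum]
  rw [h1, e2, e3, t1, t2, t3, t4, t7, t8]
  linear_combination (-1 / 8) * t5 - 1 / 8 * t6 - 1 / 8 * t9 - 1 / 8 * t10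

/-! The `ℤ₂` symmetry -/

lemma reflect_reflect (X : Dbl D) : reflect (reflect X) = X := by
  ext m; cases m <;> simp [reflect]

/-- The reflection as a continuous linear equivalence. -/
def reflectCLE (D : ℕ) : Dbl D ≃L[ℝ] Dbl D :=
  LinearEquiv.toContinuousLinearEquiv
    { toFun := reflect
      invFun := reflect
      map_add' := fun X Y => by ext m; cases m <;> simp [reflect, add_comm]
      map_smul' := fun c X => by ext m; cases m <;> simp [reflect]
      left_inv := reflect_reflect
      right_inv := reflect_reflect }

lemma fderiv_z2S (f : SField D) (X v : Dbl D) :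
    fderiv ℝ (z2S f) X v = fderiv ℝ f (reflect X) (reflect v) := by
  have : z2S f = f ∘ reflectCLE D := rfl
  rw [this, ContinuousLinearEquiv.comp_right_fderiv]
  rfl

lemma pd_inl_z2S (f : SField D) (i : Fin D) (X : Dbl D) :
    pd (Sum.inl i) (z2S f) X = - pd (Sum.inl i) f (reflect X) := by
  have : reflect (Pi.single (Sum.inl i) 1 : Dbl D) = - Pi.single (Sum.inl i) 1 := by
    ext m; cases m <;> simp [reflect, Pi.single_apply]
  rw [pd, fderiv_z2S, this, map_neg]; rfl

lemma pd_inr_z2S (f : SField D) (i : Fin D) (X : Dbl D) :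
    pd (Sum.inr i) (z2S f) X = pd (Sum.inr i) f (reflect X) := by
  have : reflect (Pi.single (Sum.inr i) 1 : Dbl D) = Pi.single (Sum.inr i) 1 := by
    ext m; cases m <;> simp [reflect, Pi.single_apply]
  rw [pd, fderiv_z2S, this]; rfl

lemma cD_z2 (E : MField D) (i : Fin D) (f : SField D) :
    cD (z2E E) i (z2S f) = z2S (cDb E i f) := by
  ext X
  simp [cD, cDb, pd_inl_z2S, pd_inr_z2S, z2E, z2S]

lemma cDb_z2 (E : MField D) (i : Fin D) (f : SField D) :
    cDb (z2E E) i (z2S f) = z2S (cD E i f) := by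
  ext X
  simp [cD, cDb, pd_inl_z2S, pd_inr_z2S, z2E, z2S, sub_eq_add_neg]

lemma gUp_z2 (E : MField D) (X : Dbl D) : gUp (z2E E) X = gUp E (reflect X) := by
  simp [gUp, gLow, z2E, add_comm]

lemma DE_z2 (E : MField D) (i j k : Fin D) : DE (z2E E) i j k = z2S (CE E i j k) :=
  cD_z2 E i (fun X => E X k j)

lemma DbE_z2 (E : MField D) (i j k : Fin D) : DbE (z2E E) i j k = z2S (DE E i k j) :=
  cDb_z2 E i (fun X => E X k j)

lemma kHalfU_z2 (E : MField D) (d : SField D) (p q : Fin D) (X : Dbl D) :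
    kHalfU (z2E E) (z2S d) p q X = kHalfB E d p q (reflect X) := by
  simp only [kHalfU, kHalfB, nabUUB_eq, nabbBUB_eq, nabB_eq, nabbU_eq, CE, gUp_z2, DE_z2, DbE_z2,
    cD_z2, cDb_z2]
  rfl

lemma kHalfB_z2 (E : MField D) (d : SField D) (p q : Fin D) (X : Dbl D) :
    kHalfB (z2E E) (z2S d) p q X = kHalfU E d p q (reflect X) := by
  simp only [kHalfU, kHalfB, nabUUB_eq, nabbBUB_eq, nabB_eq, nabbU_eq, CE, gUp_z2, DE_z2, DbE_z2,
    cD_z2, cDb_z2]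
  rfl

lemma KLow_z2 (E : MField D) (d : SField D) (p q : Fin D) (X : Dbl D) :
    KLow (z2E E) (z2S d) X p q = KLow E d (reflect X) q p := by
  rw [KLow_eq, KLow_eq, kHalfU_z2, kHalfB_z2, add_comm]

lemma KUp_z2 (E : MField D) (d : SField D) (p q : Fin D) (X : Dbl D) :
    KUp (z2E E) (z2S d) X p q = KUp E d (reflect X) q p := by
  simp only [KUp, Matrix.of_apply, KLow_z2, gUp_z2]
  rw [Finset.sum_comm]
  exact Finset.sum_congr rfl fun i _ => Finset.sum_congr rfl fun j _ => by ring

/-! Smoothness of matrix valued functions -/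

section matrix
variable {F : Type*} [NormedAddCommGroup F] [NormedSpace ℝ F] {m : WithTop ℕ∞}

lemma contDiffAt_det {n : Type*} [Fintype n] [DecidableEq n] {M : F → Matrix n n ℝ} {x : F}
    (h : ∀ i j, ContDiffAt ℝ m (fun y => M y i j) x) : ContDiffAt ℝ m (fun y => (M y).det) x := by
  simp only [Matrix.det_apply]
  refine ContDiffAt.sum fun σ _ => ContDiffAt.const_smul _ ?_
  exact contDiffAt_prod fun i _ => h _ _

lemma contDiffAt_inv {n : Type*} [Fintype n] [DecidableEq n] {M : F → Matrix n n ℝ} {x : F}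
    (h : ∀ i j, ContDiffAt ℝ m (fun y => M y i j) x) (hx : (M x).det ≠ 0) (i j : n) :
    ContDiffAt ℝ m (fun y => (M y)⁻¹ i j) x := by
  simp only [Matrix.inv_def, Matrix.smul_apply, Ring.inverse_eq_inv', smul_eq_mul]
  refine ((contDiffAt_det h).inv hx).mul ?_
  simp only [Matrix.adjugate_apply]
  refine contDiffAt_det fun k l => ?_
  by_cases hk : k = j
  · subst hk; simpa using contDiffAt_const
  · simpa [Matrix.updateRow_ne hk] using h k l

/-- The entries of the inverse are differentiable by the adjugate formula, so it suffices to
differentiate M⁻¹ M = 1, which holds near s because the determinant stays nonzero there. -/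
lemma hasDerivAt_inv_matrix {n : Type*} [Fintype n] [DecidableEq n] {M : ℝ → Matrix n n ℝ}
    {M' : Matrix n n ℝ} {s : ℝ} (h : ∀ i j, HasDerivAt (fun t => M t i j) (M' i j) s)
    (hs : (M s).det ≠ 0) (i j : n)
    (hM : ∀ i j, ContDiffAt ℝ 1 (fun t => M t i j) s) :
    HasDerivAt (fun t => (M t)⁻¹ i j) (-((M s)⁻¹ * M' * (M s)⁻¹) i j) s := by
  have hd : ∀ i j, DifferentiableAt ℝ (fun t => (M t)⁻¹ i j) s := fun i j =>
    (contDiffAt_inv hM hs i j).differentiableAt one_ne_zero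
  let N : Matrix n n ℝ := Matrix.of fun i j => deriv (fun t => (M t)⁻¹ i j) s
  have hN : ∀ i j, HasDerivAt (fun t => (M t)⁻¹ i j) (N i j) s := fun i j => (hd i j).hasDerivAt
  have hdet : ∀ᶠ t in 𝓝 s, (M t).det ≠ 0 :=
    (contDiffAt_det hM).continuousAt.eventually_ne hs
  have key : N * M s + (M s)⁻¹ * M' = 0 := by
    ext a b
    have h1 : HasDerivAt (fun t => ((M t)⁻¹ * M t) a b) ((N * M s + (M s)⁻¹ * M') a b) s := by
      simp only [Matrix.mul_apply, Matrix.add_apply, ← Finset.sum_add_distrib]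
      exact HasDerivAt.fun_sum fun k _ => (hN a k).mul (h k b)
    have h2 : (fun t => ((M t)⁻¹ * M t) a b) =ᶠ[𝓝 s] fun _ => (1 : Matrix n n ℝ) a b := by
      filter_upwards [hdet] with t ht
      rw [Matrix.nonsing_inv_mul _ (isUnit_iff_ne_zero.mpr ht)]
    exact h1.unique ((hasDerivAt_const s _).congr_of_eventuallyEq h2)
  have hN' : N = -((M s)⁻¹ * M' * (M s)⁻¹) := by
    have h3 : N * M s * (M s)⁻¹ = N := by
      rw [Matrix.mul_assoc, Matrix.mul_nonsing_inv _ (isUnit_iff_ne_zero.mpr hs), mul_one]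
    rw [← h3, eq_neg_of_add_eq_zero_left key, neg_mul]
  rw [← Matrix.neg_apply, ← hN']
  exact hN i j

end matrix

/-! Derivatives along the frame vectors -/

/-- The vector `∂_i - ℰ_{ik} ∂̃^k`. -/
def uVec (E : MField D) (X : Dbl D) (i : Fin D) : Dbl D :=
  Pi.single (Sum.inr i) 1 - ∑ k, E X i k • Pi.single (Sum.inl k) 1

/-- The vector `∂_i + ℰ_{ki} ∂̃^k`. -/
def bVec (E : MField D) (X : Dbl D) (i : Fin D) : Dbl D :=
  Pi.single (Sum.inr i) 1 + ∑ k, E X k i • Pi.single (Sum.inl k) 1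

lemma cD_eq_fderiv (E : MField D) (i : Fin D) (f : SField D) (X : Dbl D) :
    cD E i f X = fderiv ℝ f X (uVec E X i) := by
  simp [cD, uVec, pd, map_sub, map_sum, map_smul]

lemma cDb_eq_fderiv (E : MField D) (i : Fin D) (f : SField D) (X : Dbl D) :
    cDb E i f X = fderiv ℝ f X (bVec E X i) := by
  simp [cDb, bVec, pd, map_add, map_sum, map_smul]

lemma hasDerivAt_line {f : SField D} {X : Dbl D} (hf : DifferentiableAt ℝ f X) (ξ : Dbl D) :
    HasDerivAt (fun t : ℝ => f (X + t • ξ)) (fderiv ℝ f X ξ) 0 := by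
  have h1 : HasDerivAt (fun t : ℝ => X + t • ξ) ξ 0 := by
    simpa using ((hasDerivAt_id (0 : ℝ)).smul_const ξ).const_add X
  have h2 : HasFDerivAt f (fderiv ℝ f X) (X + (0 : ℝ) • ξ) := by simpa using hf.hasFDerivAt
  exact h2.comp_hasDerivAt 0 h1

lemma IsBackground.contDiff_gLow {E : MField D} {d : SField D} (h : IsBackground E d)
    (i j : Fin D) : ContDiff ℝ ∞ (fun X => gLow E X i j) := by
  simp only [gLow, Matrix.smul_apply, Matrix.add_apply, Matrix.transpose_apply]
  exact ((h.smooth_E i j).add (h.smooth_E j i)).const_smul _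

lemma IsBackground.contDiff_gUp {E : MField D} {d : SField D} (h : IsBackground E d)
    (i j : Fin D) : ContDiff ℝ ∞ (fun X => gUp E X i j) :=
  contDiff_iff_contDiffAt.mpr fun X =>
    contDiffAt_inv (fun a b => (h.contDiff_gLow a b).contDiffAt) (h.nondeg X) i j

lemma contDiff_pd {f : SField D} (hf : ContDiff ℝ ∞ f) (m : Fin D ⊕ Fin D) :
    ContDiff ℝ ∞ (pd m f) :=
  (hf.fderiv_right (m := ∞) le_rfl).clm_apply contDiff_const

lemma IsBackground.contDiff_cD {E : MField D} {d : SField D} (h : IsBackground E d)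
    {f : SField D} (hf : ContDiff ℝ ∞ f) (i : Fin D) :
    ContDiff ℝ ∞ (cD E i f) :=
  (contDiff_pd hf _).sub (ContDiff.sum fun k _ => (h.smooth_E i k).mul (contDiff_pd hf _))

lemma IsBackground.contDiff_cDb {E : MField D} {d : SField D} (h : IsBackground E d)
    {f : SField D} (hf : ContDiff ℝ ∞ f) (i : Fin D) :
    ContDiff ℝ ∞ (cDb E i f) :=
  (contDiff_pd hf _).add (ContDiff.sum fun k _ => (h.smooth_E k i).mul (contDiff_pd hf _))

lemma IsBackground.contDiff_DE {E : MField D} {d : SField D} (h : IsBackground E d)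
    (i j k : Fin D) : ContDiff ℝ ∞ (DE E i j k) :=
  h.contDiff_cD (h.smooth_E j k) i

lemma IsBackground.contDiff_DbE {E : MField D} {d : SField D} (h : IsBackground E d)
    (i j k : Fin D) : ContDiff ℝ ∞ (DbE E i j k) :=
  h.contDiff_cDb (h.smooth_E j k) i

/-! ### Derivatives of metric contractions -/

/-- Metric compatibility: the derivative of the inverse metric, -G(w + wᵗ)G, is absorbed as a
connection term w on each of the two contracted indices. Only the sum w + wᵗ is constrained; its
antisymmetric part is free and can be chosen to suit the application. -/
lemma ctr_hasDerivAt {G : ℝ → Matrix (Fin D) (Fin D) ℝ} {w f' : Fin D → Fin D → ℝ}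
    {f : ℝ → Fin D → Fin D → ℝ} {s : ℝ} (hs : ∀ i j, G s i j = G s j i)
    (hG : ∀ i j, HasDerivAt (fun t => G t i j)
      (-∑ a, ∑ b, G s i a * (w a b + w b a) * G s b j) s)
    (hf : ∀ i j, HasDerivAt (fun t => f t i j) (f' i j) s) :
    HasDerivAt (fun t => ctr (G t) (f t)) (ctr (G s) (fun i j => f' i j
      - ctr (G s) (fun l m => w i l * f s m j) - ctr (G s) (fun l m => w j l * f s i m))) s := by
  have h1 : HasDerivAt (fun t => ctr (G t) (f t)) (∑ i, ∑ j,
      ((-∑ a, ∑ b, G s i a * (w a b + w b a) * G s b j) * f s i j + G s i j * f' i j)) s :=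
    HasDerivAt.fun_sum fun i _ => HasDerivAt.fun_sum fun j _ => (hG i j).mul (hf i j)
  convert h1 using 1
  have e1 : ∑ i, ∑ j, ∑ a, ∑ b, G s i a * w a b * G s b j * f s i j =
      ctr (G s) (fun i j => ctr (G s) (fun l m => w j l * f s i m)) := by
    simp only [ctr, Finset.mul_sum]
    refine sum4_congr ⟨fun x => (x.1, x.2.2.1, x.2.2.2, x.2.1),
      fun x => (x.1, x.2.2.2, x.2.1, x.2.2.1), fun _ => rfl, fun _ => rfl⟩ fun x => ?_
    simp only [Equiv.coe_fn_mk]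
    ring
  have e2 : ∑ i, ∑ j, ∑ a, ∑ b, G s i a * w b a * G s b j * f s i j =
      ctr (G s) (fun i j => ctr (G s) (fun l m => w i l * f s m j)) := by
    simp only [ctr, Finset.mul_sum]
    refine sum4_congr ⟨fun x => (x.2.2.2, x.2.1, x.2.2.1, x.1),
      fun x => (x.2.2.2, x.2.1, x.2.2.1, x.1), fun _ => rfl, fun _ => rfl⟩ fun x => ?_
    simp only [Equiv.coe_fn_mk]
    rw [hs x.1]
    ring
  rw [ctr_sub, ctr_sub, ← e1, ← e2, ctr]
  simp only [← Finset.sum_sub_distrib]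
  refine Finset.sum_congr rfl fun i _ => Finset.sum_congr rfl fun j _ => ?_
  rw [neg_mul, Finset.sum_mul, neg_add_eq_sub, sub_sub, ← Finset.sum_add_distrib]
  congr 1
  refine Finset.sum_congr rfl fun a _ => ?_
  rw [Finset.sum_mul, ← Finset.sum_add_distrib]
  exact Finset.sum_congr rfl fun b _ => by ring

/-- Full contraction of two tensors with three indices. -/
def tr3 (G : Matrix (Fin D) (Fin D) ℝ) (T U : Fin D → Fin D → Fin D → ℝ) : ℝ :=
  ctr G fun i a => ctr G fun j b => ctr G fun k c => T i j k * U a b c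

/-- `T'` corrected by the connections `w₁`, `w₂`, `w₃` acting on the indices of `T`. -/
def cov3 (G : Matrix (Fin D) (Fin D) ℝ) (w₁ w₂ w₃ : Fin D → Fin D → ℝ)
    (T' T : Fin D → Fin D → Fin D → ℝ) (i j k : Fin D) : ℝ :=
  T' i j k - ctr G (fun l m => w₁ i l * T m j k) - ctr G (fun l m => w₂ j l * T i m k)
    - ctr G (fun l m => w₃ k l * T i j m)

/-- `G' = - G (w + wᵗ) G`. -/
def IsCompat (G : ℝ → Matrix (Fin D) (Fin D) ℝ) (s : ℝ) (w : Fin D → Fin D → ℝ) : Prop :=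
  ∀ i j, HasDerivAt (fun t => G t i j) (-∑ a, ∑ b, G s i a * (w a b + w b a) * G s b j) s

/-- Different contracted pairs may use different compatible connections. This is what lets unbarred
and barred indices coexist in one scalar. -/
lemma tr2_hasDerivAt {G : ℝ → Matrix (Fin D) (Fin D) ℝ} {w₁ w₂ : Fin D → Fin D → ℝ}
    {T U : ℝ → Fin D → Fin D → ℝ} {T' U' : Fin D → Fin D → ℝ}
    {s : ℝ} (hs : ∀ i j, G s i j = G s j i)
    (h1 : IsCompat G s w₁) (h2 : IsCompat G s w₂)
    (hT : ∀ i j, HasDerivAt (fun t => T t i j) (T' i j) s)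
    (hU : ∀ i j, HasDerivAt (fun t => U t i j) (U' i j) s) :
    HasDerivAt (fun t => ctr (G t) fun j b => ctr (G t) fun k c => T t j k * U t b c)
      (ctr (G s) fun j b => ctr (G s) fun k c =>
        (T' j k - ctr (G s) (fun l m => w₁ j l * T s m k)
          - ctr (G s) (fun l m => w₂ k l * T s j m)) * U s b c
        + T s j k * (U' b c - ctr (G s) (fun l m => w₁ b l * U s m c)
          - ctr (G s) (fun l m => w₂ c l * U s b m))) s := by
  have := ctr_hasDerivAt hs h1 fun j b => ctr_hasDerivAt hs h2 fun k c => (hT j k).fun_mul (hU b c)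
  convert this using 1
  refine ctr_congr _ fun j b => ?_
  simp only [mul_ctr (G s) (w₁ _ _)]
  rw [ctr_comm (G s) (fun l m k c => w₁ j l * (T s m k * U s b c)),
    ctr_comm (G s) (fun l m k c => w₁ b l * (T s j k * U s m c)), ← ctr_sub, ← ctr_sub]
  refine ctr_congr _ fun k c => ?_
  simp only [sub_mul, mul_sub, ctr_mul, mul_ctr]
  simp only [mul_assoc, mul_left_comm (T s j k)]
  ring

lemma tr3_hasDerivAt {G : ℝ → Matrix (Fin D) (Fin D) ℝ} {w₁ w₂ w₃ : Fin D → Fin D → ℝ}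
    {T U : ℝ → Fin D → Fin D → Fin D → ℝ} {T' U' : Fin D → Fin D → Fin D → ℝ}
    {s : ℝ} (hs : ∀ i j, G s i j = G s j i)
    (h1 : IsCompat G s w₁) (h2 : IsCompat G s w₂) (h3 : IsCompat G s w₃)
    (hT : ∀ i j k, HasDerivAt (fun t => T t i j k) (T' i j k) s)
    (hU : ∀ i j k, HasDerivAt (fun t => U t i j k) (U' i j k) s) :
    HasDerivAt (fun t => tr3 (G t) (T t) (U t))
      (tr3 (G s) (cov3 (G s) w₁ w₂ w₃ T' (T s)) (U s)
        + tr3 (G s) (T s) (cov3 (G s) w₁ w₂ w₃ U' (U s))) s := by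
  have := ctr_hasDerivAt hs h1 fun i a => tr2_hasDerivAt hs h2 h3 (T := fun t => T t i)
    (U := fun t => U t a) (hT i) (hU a)
  refine this.congr_deriv (Eq.symm ?_)
  unfold tr3
  rw [← ctr_add]
  refine ctr_congr _ fun i a => ?_
  simp only [mul_ctr (G s) (w₁ _ _)]
  rw [ctr_comm (G s) (fun l m j b => ctr (G s) fun k c => w₁ i l * (T s m j k * U s a b c)),
    ctr_comm (G s) (fun l m j b => ctr (G s) fun k c => w₁ a l * (T s i j k * U s m b c)),
    ← ctr_sub, ← ctr_sub, ← ctr_add]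
  refine ctr_congr _ fun j b => ?_
  rw [ctr_comm (G s) (fun l m k c => w₁ i l * (T s m j k * U s a b c)),
    ctr_comm (G s) (fun l m k c => w₁ a l * (T s i j k * U s m b c)),
    ← ctr_sub, ← ctr_sub, ← ctr_add]
  refine ctr_congr _ fun k c => ?_
  simp only [cov3, sub_mul, mul_sub, ctr_mul, mul_ctr]
  simp only [mul_assoc, mul_left_comm (T s i j k)]
  ring

/-! ### First variation of half the bracket -/

/-- The half of the bracket built from `A = 𝒟ℰ` and `v = 𝒟̄d`. -/
def lhalf (G : Matrix (Fin D) (Fin D) ℝ) (A : Fin D → Fin D → Fin D → ℝ) (v : Fin D → ℝ) : ℝ :=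
  - (1 / 8) * tr3 G A A + 1 / 4 * tr3 G A (fun i j k => A j i k)
    + ctr G (fun k c => v k * ctr G (fun j b => A j b c)) + 2 * ctr G (fun i j => v i * v j)

/-- Minus one quarter of `A_{ijk}` plus one half of `A_{jik}`. -/
def ptens (A : Fin D → Fin D → Fin D → ℝ) (i j k : Fin D) : ℝ :=
  - (1 / 4) * A i j k + 1 / 2 * A j i k

/-- The algebraic part of the variation of `lhalf`. -/
def varCoeff (G : Matrix (Fin D) (Fin D) ℝ) (A C : Fin D → Fin D → Fin D → ℝ)
    (u v : Fin D → ℝ) (p q : Fin D) : ℝ :=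
  1 / 2 * ctr G (fun i i' => ctr G (fun k k' =>
    ptens A i p k * (C k' q i' - C q k' i') - ptens A p i k * C q k' i'))
  - 1 / 2 * (u p * ctr G (fun j b => A j b q))
  + ctr G (fun k c => v k * (1 / 2 * C c q p - C q c p)) - 2 * (u p * v q)

section contraction
variable {G : Matrix (Fin D) (Fin D) ℝ}

/-- `Δ_{pq} K^{pq}`. -/
def ctr2 (G : Matrix (Fin D) (Fin D) ℝ) (Δ K : Fin D → Fin D → ℝ) : ℝ :=
  ctr G fun p p' => ctr G fun q q' => Δ p q * K p' q'

lemma tr3_add_left (T T' U : Fin D → Fin D → Fin D → ℝ) :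
    tr3 G (fun i j k => T i j k + T' i j k) U = tr3 G T U + tr3 G T' U := by
  simp only [tr3, add_mul, ctr_add]

lemma tr3_sub_right (T U U' : Fin D → Fin D → Fin D → ℝ) :
    tr3 G T (fun i j k => U i j k - U' i j k) = tr3 G T U - tr3 G T U' := by
  simp only [tr3, mul_sub, ctr_sub]

lemma tr3_add_right (T U U' : Fin D → Fin D → Fin D → ℝ) :
    tr3 G T (fun i j k => U i j k + U' i j k) = tr3 G T U + tr3 G T U' := by
  simp only [tr3, mul_add, ctr_add]

lemma tr3_mul_left (c : ℝ) (T U : Fin D → Fin D → Fin D → ℝ) :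
    tr3 G (fun i j k => c * T i j k) U = c * tr3 G T U := by
  simp only [tr3, mul_ctr, mul_assoc]

lemma tr3_comm (hG : ∀ i j, G i j = G j i) (T U : Fin D → Fin D → Fin D → ℝ) :
    tr3 G T U = tr3 G U T := by
  unfold tr3
  rw [ctr_flip hG]
  refine ctr_congr _ fun i a => ?_
  rw [ctr_flip hG]
  refine ctr_congr _ fun j b => ?_
  rw [ctr_flip hG]
  exact ctr_congr _ fun k c => mul_comm _ _

lemma tr3_swap (T U : Fin D → Fin D → Fin D → ℝ) :
    tr3 G (fun i j k => T j i k) U = tr3 G T (fun i j k => U j i k) := by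
  unfold tr3
  rw [ctr_comm]

/-- Both quadratic forms in A are symmetric, so varying the two factors doubles the coefficients
-1/8 and 1/4; `ptens` is the resulting gradient. -/
lemma tr3_ptens (hG : ∀ i j, G i j = G j i) (A A' : Fin D → Fin D → Fin D → ℝ) :
    - (1 / 8) * (tr3 G A' A + tr3 G A A') + 1 / 4 * (tr3 G A' (fun i j k => A j i k)
      + tr3 G A (fun i j k => A' j i k)) = tr3 G (ptens A) A' := by
  have h : tr3 G (ptens A) A' =
      -(1 / 4) * tr3 G A A' + 1 / 2 * tr3 G (fun i j k => A j i k) A' := by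
    rw [← tr3_mul_left, ← tr3_mul_left, ← tr3_add_left]
    rfl
  rw [h, tr3_comm hG A' A, tr3_comm hG A' (fun i j k => A j i k), ← tr3_swap A A']
  ring

end contraction

/-- Covariant derivative of a tensor with an unbarred and a barred index, in components. -/
def nab2 (G : Matrix (Fin D) (Fin D) ℝ) (A C dΔ : Fin D → Fin D → Fin D → ℝ)
    (Δ : Fin D → Fin D → ℝ) (r b c : Fin D) : ℝ :=
  dΔ r b c - ctr G (fun l m => 1 / 2 * A r b l * Δ m c)
    - ctr G (fun l m => 1 / 2 * (A r l c + C c l r - C l c r) * Δ b m)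

/-- The covariant variation of `A` without its derivative term, first part. -/
def covA₁ (G : Matrix (Fin D) (Fin D) ℝ) (C : Fin D → Fin D → Fin D → ℝ)
    (Δ : Fin D → Fin D → ℝ) (i j k : Fin D) : ℝ :=
  ctr G (fun l m => 1 / 2 * (Δ j l * (C k m i - C m k i)))

/-- The covariant variation of `A` without its derivative term, second part. -/
def covA₂ (G : Matrix (Fin D) (Fin D) ℝ) (C : Fin D → Fin D → Fin D → ℝ)
    (Δ : Fin D → Fin D → ℝ) (i j k : Fin D) : ℝ :=
  ctr G (fun l m => 1 / 2 * (Δ i l * C m k j))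

/-- The correction on the first index cancels the A-part of the variation of 𝒟_i. The corrections on
the other two indices, read with A and Δ in exchanged roles, are the A-terms of the connection in
∇_i Δ_{jk}. The C-terms of that connection are added and subtracted, which leaves `covA₁` and
`covA₂`. -/
lemma cov3_eq_covA {G : Matrix (Fin D) (Fin D) ℝ} (hG : ∀ i j, G i j = G j i)
    (A C α : Fin D → Fin D → Fin D → ℝ) (Δ : Fin D → Fin D → ℝ) (i j k : Fin D) :
    cov3 G (fun i j => 1 / 2 * Δ i j) (fun i j => 1 / 2 * Δ i j) (fun i j => 1 / 2 * Δ j i)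
      (fun i j k => α i j k - ctr G (fun l m => 1 / 2 * (Δ i l * (C m k j - A m j k)))) A i j k =
    nab2 G A C α Δ i j k + covA₁ G C Δ i j k - covA₂ G C Δ i j k := by
  simp only [cov3, nab2, covA₁, covA₂]
  rw [ctr_flip hG (fun l m => 1 / 2 * A i j l * Δ m k),
    ctr_flip hG (fun l m => 1 / 2 * (A i l k + C k l i - C l k i) * Δ j m)]
  rw [← sub_eq_zero]
  have h : ∀ x a b c d e f g h : ℝ, x - a - b - c - d - (x - e - f + g - h) =
    e + f + h - g - a - b - c - d := by intros; ring
  rw [h]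
  simp only [← ctr_add, ← ctr_sub]
  have h0 : ctr G (fun _ _ => (0 : ℝ)) = 0 := by simp [ctr]
  rw [← h0]
  exact ctr_congr _ fun l m => by ring

section reorder
variable {G : Matrix (Fin D) (Fin D) ℝ}

lemma tr3_covA₁ (hG : ∀ i j, G i j = G j i) (P C : Fin D → Fin D → Fin D → ℝ)
    (Δ : Fin D → Fin D → ℝ) :
    tr3 G P (covA₁ G C Δ) = ctr2 G Δ (fun p q => 1 / 2 * ctr G (fun i i' => ctr G (fun k k' =>
      P i p k * (C k' q i' - C q k' i')))) := by
  simp only [tr3, covA₁, ctr2, mul_ctr]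
  rw [ctr_comm, ctr_flip hG]
  refine ctr_congr _ fun p p' => ?_
  rw [ctr_comm G (fun q q' i i' => ctr G fun k k' =>
    Δ p q * (1 / 2 * (P i p' k * (C k' q' i' - C q' k' i'))))]
  have := fun i i' => ctr_comm G (fun q q' k k' =>
    Δ p q * (1 / 2 * (P i p' k * (C k' q' i' - C q' k' i'))))
  simp only [this]
  refine ctr_congr _ fun i i' => ctr_congr _ fun k k' => ctr_congr _ fun q q' => ?_
  ring

lemma tr3_covA₂ (hG : ∀ i j, G i j = G j i) (P C : Fin D → Fin D → Fin D → ℝ)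
    (Δ : Fin D → Fin D → ℝ) :
    tr3 G P (covA₂ G C Δ) = ctr2 G Δ (fun p q => 1 / 2 * ctr G (fun i i' => ctr G (fun k k' =>
      P p i k * C q k' i'))) := by
  simp only [tr3, covA₂, ctr2, mul_ctr]
  rw [ctr_flip hG]
  refine ctr_congr _ fun p p' => ?_
  rw [ctr_comm G (fun q q' i i' => ctr G fun k k' => Δ p q * (1 / 2 * (P p' i k * C q' k' i')))]
  have := fun i i' => ctr_comm G (fun q q' k k' => Δ p q * (1 / 2 * (P p' i k * C q' k' i')))
  simp only [this]
  refine ctr_congr _ fun i i' => ctr_congr _ fun k k' => ctr_congr _ fun q q' => ?_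
  ring

lemma ctr_trace_covA (hG : ∀ i j, G i j = G j i) (v : Fin D → ℝ) (C : Fin D → Fin D → Fin D → ℝ)
    (Δ : Fin D → Fin D → ℝ) :
    ctr G (fun k c => v k * ctr G (fun j b => covA₁ G C Δ j b c - covA₂ G C Δ j b c)) =
      ctr2 G Δ (fun p q => ctr G (fun k c => v k * (1 / 2 * C c q p - C q c p))) := by
  have h : ∀ c, ctr G (fun j b => covA₁ G C Δ j b c - covA₂ G C Δ j b c) =
      ctr G (fun p p' => ctr G (fun q q' => Δ p q * (1 / 2 * C c q' p' - C q' c p'))) := by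
    intro c
    rw [ctr_sub, ctr_flip hG, ← ctr_sub]
    refine ctr_congr _ fun p p' => ?_
    rw [covA₁, covA₂, ← ctr_sub]
    exact ctr_congr _ fun q q' => by ring
  simp only [h, ctr2, mul_ctr]
  rw [ctr_comm]
  refine ctr_congr _ fun p p' => ?_
  rw [ctr_comm]
  refine ctr_congr _ fun q q' => ctr_congr _ fun k c => by ring

lemma ctr2_add (Δ K K' : Fin D → Fin D → ℝ) :
    ctr2 G Δ (fun p q => K p q + K' p q) = ctr2 G Δ K + ctr2 G Δ K' := by
  simp only [ctr2, mul_add, ctr_add]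

lemma ctr2_sub (Δ K K' : Fin D → Fin D → ℝ) :
    ctr2 G Δ (fun p q => K p q - K' p q) = ctr2 G Δ K - ctr2 G Δ K' := by
  simp only [ctr2, mul_sub, ctr_sub]

lemma ctr2_mul (c : ℝ) (Δ K : Fin D → Fin D → ℝ) :
    ctr2 G Δ (fun p q => c * K p q) = c * ctr2 G Δ K := by
  simp only [ctr2, mul_ctr, mul_left_comm]

lemma ctr_var_mul (u t : Fin D → ℝ) (Δ : Fin D → Fin D → ℝ) :
    ctr G (fun k c => ctr G (fun l m => Δ l k * u m) * t c) =
      ctr2 G Δ (fun p q => u p * t q) := by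
  simp only [ctr2, ctr_mul]
  rw [ctr_comm]
  exact ctr_congr _ fun p p' => ctr_congr _ fun q q' => by ring

end reorder

/-- Here s is the variation parameter. The connection is Δ/2 on unbarred and its transpose on barred
indices; both give the metric the velocity (Δ + Δᵗ)/2. The hypotheses on A and v encode δ𝒟_i =
-Δ_{ik} ∂̃^k and δ𝒟̄_i = Δ_{ki} ∂̃^k, with ∂̃ expressed through 𝒟̄ - 𝒟. -/
lemma lhalf_hasDerivAt {G : ℝ → Matrix (Fin D) (Fin D) ℝ} {s : ℝ}
    {A : ℝ → Fin D → Fin D → Fin D → ℝ} {v : ℝ → Fin D → ℝ} {Δ : Fin D → Fin D → ℝ}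
    {u : Fin D → ℝ} {C α : Fin D → Fin D → Fin D → ℝ}
    (hs : ∀ i j, G s i j = G s j i) (hG : IsCompat G s (fun i j => 1 / 2 * Δ i j))
    (hA : ∀ i j k, HasDerivAt (fun t => A t i j k)
      (α i j k - ctr (G s) (fun l m => 1 / 2 * (Δ i l * (C m k j - A s m j k)))) s)
    (hv : ∀ i, HasDerivAt (fun t => v t i)
      (ctr (G s) (fun l m => 1 / 2 * (Δ l i * (v s m - u m)))) s) :
    HasDerivAt (fun t => lhalf (G t) (A t) (v t))
      (tr3 (G s) (ptens (A s)) (nab2 (G s) (A s) C α Δ)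
        + ctr (G s) (fun k c => v s k * ctr (G s) (fun j b => nab2 (G s) (A s) C α Δ j b c))
        + ctr2 (G s) Δ (varCoeff (G s) (A s) C u (v s))) s := by
  have hG' : IsCompat G s (fun i j => 1 / 2 * Δ j i) := fun i j => by
    refine (hG i j).congr_deriv ?_
    congr 1
    exact Finset.sum_congr rfl fun a _ => Finset.sum_congr rfl fun b _ => by ring
  set A' : Fin D → Fin D → Fin D → ℝ := fun i j k =>
    α i j k - ctr (G s) (fun l m => 1 / 2 * (Δ i l * (C m k j - A s m j k))) with hA'
  have h1 := tr3_hasDerivAt hs hG hG hG' (T' := A') (U' := A') hA hA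
  have h2 := tr3_hasDerivAt hs hG hG hG' (T' := A') (U := fun t i j k => A t j i k)
    (U' := fun i j k => A' j i k) hA (fun i j k => hA j i k)
  have h3 := ctr_hasDerivAt hs hG' fun k c => (hv k).fun_mul
    (ctr_hasDerivAt hs hG fun j b => hA j b c)
  have h4 := ctr_hasDerivAt hs hG' fun k c => (hv k).fun_mul (hv c)
  have key := (((h1.const_mul (-(1 / 8))).fun_add (h2.const_mul (1 / 4))).fun_add h3).fun_add
    (h4.const_mul 2)
  refine key.congr_deriv ?_
  set cA := cov3 (G s) (fun i j => 1 / 2 * Δ i j) (fun i j => 1 / 2 * Δ i j)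
    (fun i j => 1 / 2 * Δ j i) A' (A s) with hcA
  -- The first two indices carry the same connection, so exchanging them commutes with the
  -- correction.
  have hswap : cov3 (G s) (fun i j => 1 / 2 * Δ i j) (fun i j => 1 / 2 * Δ i j)
      (fun i j => 1 / 2 * Δ j i) (fun i j k => A' j i k) (fun i j k => A s j i k) =
      fun i j k => cA j i k := by
    funext i j k
    simp only [hcA, cov3]
    ring
  rw [hswap]
  have hcA' : cA = fun i j k => nab2 (G s) (A s) C α Δ i j k + covA₁ (G s) C Δ i j k
      - covA₂ (G s) C Δ i j k := by
    funext i j k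
    exact cov3_eq_covA hs (A s) C α Δ i j k
  have e12 := tr3_ptens hs (A s) cA
  -- The metric correction removes the v-part of the variation of v, so only u = 𝒟d survives.
  have hcv : ∀ i, ctr (G s) (fun l m => 1 / 2 * (Δ l i * (v s m - u m)))
      - ctr (G s) (fun l m => 1 / 2 * Δ l i * v s m) =
      - (1 / 2) * ctr (G s) (fun l m => Δ l i * u m) := by
    intro i
    rw [← ctr_sub, mul_ctr]
    exact ctr_congr _ fun l m => by ring
  have e3 : (ctr (G s) fun k c => ctr (G s) (fun l m => 1 / 2 * (Δ l k * (v s m - u m))) *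
        ctr (G s) (fun j b => A s j b c) + v s k * ctr (G s) (fun j b => A' j b c
          - ctr (G s) (fun l m => 1 / 2 * Δ j l * A s m b c)
          - ctr (G s) (fun l m => 1 / 2 * Δ b l * A s j m c))
        - ctr (G s) (fun l m => 1 / 2 * Δ l k * (v s m * ctr (G s) (fun j b => A s j b c)))
        - ctr (G s) (fun l m => 1 / 2 * Δ l c * (v s k * ctr (G s) (fun j b => A s j b m)))) =
      ctr (G s) (fun k c => - (1 / 2) * ctr (G s) (fun l m => Δ l k * u m)
        * ctr (G s) (fun j b => A s j b c)) +
      ctr (G s) (fun k c => v s k * ctr (G s) (fun j b => cA j b c)) := by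
    rw [← ctr_add]
    refine ctr_congr _ fun k c => ?_
    have hc : ctr (G s) (fun j b => cA j b c) = ctr (G s) (fun j b => A' j b c
          - ctr (G s) (fun l m => 1 / 2 * Δ j l * A s m b c)
          - ctr (G s) (fun l m => 1 / 2 * Δ b l * A s j m c)) -
        ctr (G s) (fun l m => 1 / 2 * Δ l c * ctr (G s) (fun j b => A s j b m)) := by
      simp only [mul_ctr (G s) (1 / 2 * Δ _ c)]
      rw [ctr_comm (G s) (fun l m j b => 1 / 2 * Δ l c * A s j b m), ← ctr_sub]
      rfl
    have a1 : ctr (G s) (fun l m => 1 / 2 * Δ l k * (v s m * ctr (G s) (fun j b => A s j b c))) =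
        ctr (G s) (fun l m => 1 / 2 * Δ l k * v s m) * ctr (G s) (fun j b => A s j b c) := by
      rw [ctr_mul (G s)]; exact ctr_congr _ fun l m => by ring
    have a2 : ctr (G s) (fun l m => 1 / 2 * Δ l c * (v s k * ctr (G s) (fun j b => A s j b m))) =
        v s k * ctr (G s) (fun l m => 1 / 2 * Δ l c * ctr (G s) (fun j b => A s j b m)) := by
      rw [mul_ctr]; exact ctr_congr _ fun l m => by ring
    rw [hc, ← hcv, a1, a2]
    ring
  have e4 : (ctr (G s) fun k c => ctr (G s) (fun l m => 1 / 2 * (Δ l k * (v s m - u m))) * v s c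
        + v s k * ctr (G s) (fun l m => 1 / 2 * (Δ l c * (v s m - u m)))
        - ctr (G s) (fun l m => 1 / 2 * Δ l k * (v s m * v s c))
        - ctr (G s) (fun l m => 1 / 2 * Δ l c * (v s k * v s m))) =
      - ctr (G s) (fun k c => ctr (G s) (fun l m => Δ l k * u m) * v s c) := by
    have : - ctr (G s) (fun k c => ctr (G s) (fun l m => Δ l k * u m) * v s c) =
      - (1 / 2) * ctr (G s) (fun k c => ctr (G s) (fun l m => Δ l k * u m) * v s c)
      - (1 / 2) * ctr (G s) (fun c k => ctr (G s) (fun l m => Δ l k * u m) * v s c) := by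
        rw [← ctr_flip hs]; ring
    rw [this, mul_ctr, mul_ctr, ← ctr_sub]
    refine ctr_congr _ fun k c => ?_
    have hk := hcv k
    have hc := hcv c
    have a1 : ctr (G s) (fun l m => 1 / 2 * Δ l k * (v s m * v s c)) =
      ctr (G s) (fun l m => 1 / 2 * Δ l k * v s m) * v s c := by
        rw [ctr_mul]; exact ctr_congr _ fun l m => by ring
    have a2 : ctr (G s) (fun l m => 1 / 2 * Δ l c * (v s k * v s m)) =
      ctr (G s) (fun l m => 1 / 2 * Δ l c * v s m) * v s k := by
        rw [ctr_mul]; exact ctr_congr _ fun l m => by ring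
    rw [a1, a2]
    linear_combination v s c * hk + v s k * hc
  have f1 : tr3 (G s) (ptens (A s)) cA = tr3 (G s) (ptens (A s)) (nab2 (G s) (A s) C α Δ)
      + tr3 (G s) (ptens (A s)) (covA₁ (G s) C Δ) - tr3 (G s) (ptens (A s)) (covA₂ (G s) C Δ) := by
    rw [hcA', tr3_sub_right, tr3_add_right]
  have f2 : ctr (G s) (fun k c => v s k * ctr (G s) (fun j b => cA j b c)) =
      ctr (G s) (fun k c => v s k * ctr (G s) (fun j b => nab2 (G s) (A s) C α Δ j b c)) +
      ctr (G s) (fun k c => v s k *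
        ctr (G s) (fun j b => covA₁ (G s) C Δ j b c - covA₂ (G s) C Δ j b c)) := by
    rw [hcA', ← ctr_add]
    refine ctr_congr _ fun k c => ?_
    rw [← mul_add, ← ctr_add]
    congr 1
    exact ctr_congr _ fun j b => by ring
  have f3 : ctr (G s) (fun k c => - (1 / 2) * ctr (G s) (fun l m => Δ l k * u m)
        * ctr (G s) (fun j b => A s j b c)) =
      - (1 / 2) * ctr2 (G s) Δ (fun p q => u p * ctr (G s) (fun j b => A s j b q)) := by
    rw [← ctr_var_mul, mul_ctr]
    exact ctr_congr _ fun k c => by ring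
  have f4 : varCoeff (G s) (A s) C u (v s) = fun p q =>
      1 / 2 * ctr (G s) (fun i i' => ctr (G s) (fun k k' =>
        ptens (A s) i p k * (C k' q i' - C q k' i')))
      - 1 / 2 * ctr (G s) (fun i i' => ctr (G s) (fun k k' => ptens (A s) p i k * C q k' i'))
      + (- (1 / 2)) * (u p * ctr (G s) (fun j b => A s j b q))
      + ctr (G s) (fun k c => v s k * (1 / 2 * C c q p - C q c p)) + (- 2) * (u p * v s q) := by
    funext p q
    simp only [varCoeff, ctr_sub]
    ring
  rw [e3, e4, e12, f1, f2, f3, tr3_covA₁ hs, tr3_covA₂ hs, ctr_trace_covA hs, ctr_var_mul, f4,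
    ctr2_add, ctr2_add, ctr2_add, ctr2_sub, ctr2_mul (-(1 / 2)), ctr2_mul (-2)]
  ring

/-! ### Integration by parts and the half Euler-Lagrange expression -/

/-- The half of the Euler-Lagrange expression that comes from `lhalf`. -/
def elHalf (G : Matrix (Fin D) (Fin D) ℝ) (A C : Fin D → Fin D → Fin D → ℝ)
    (u v : Fin D → ℝ) (nA : Fin D → Fin D → Fin D → Fin D → ℝ) (nv : Fin D → Fin D → ℝ)
    (p q : Fin D) : ℝ :=
  varCoeff G A C u v p q
  - ctr G (fun i a => - (1 / 4) * nA i a p q + 1 / 2 * nA i p a q) - nv p q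
  + 1 / 2 * ctr G (fun k a => ptens A a p q * ctr G (fun i l => C l i k))
  + 2 * ctr G (fun i a => ptens A a p q * u i)
  + 1 / 2 * (v q * ctr G (fun i l => C l i p)) + 2 * (u p * v q)

section reorder
variable {G : Matrix (Fin D) (Fin D) ℝ}

/-- The lower components of the vector `∂L/∂(∇_a ℰ_{jk}) Δ_{jk}`. -/
def flux (G : Matrix (Fin D) (Fin D) ℝ) (A : Fin D → Fin D → Fin D → ℝ) (v : Fin D → ℝ)
    (Δ : Fin D → Fin D → ℝ) (a : Fin D) : ℝ :=
  ctr G (fun j b => ctr G fun k c => ptens A a j k * Δ b c) + ctr G (fun k c => Δ a k * v c)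

lemma ctr_flux (hG : ∀ i j, G i j = G j i) (A : Fin D → Fin D → Fin D → ℝ) (v t : Fin D → ℝ)
    (Δ : Fin D → Fin D → ℝ) :
    ctr G (fun i a => flux G A v Δ a * t i) =
      ctr2 G Δ (fun p q => ctr G (fun i a => ptens A a p q * t i)) +
      ctr2 G Δ (fun p q => t p * v q) := by
  simp only [flux, add_mul, ctr_add, ctr2, ctr_mul, mul_ctr]
  congr 1
  · rw [ctr_comm, ctr_flip hG]
    refine ctr_congr _ fun p p' => ?_
    rw [ctr_comm G (fun q q' i a => Δ p q * (ptens A a p' q' * t i))]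
    refine ctr_congr _ fun i a => ?_
    rw [ctr_flip hG]
    exact ctr_congr _ fun q q' => by ring
  · rw [ctr_flip hG]
    exact ctr_congr _ fun p p' => ctr_congr _ fun q q' => by ring

lemma ctr_ctr_ctr_comm (hG : ∀ i j, G i j = G j i) (N : Fin D → Fin D → Fin D → Fin D → ℝ)
    (Δ : Fin D → Fin D → ℝ) :
    ctr G (fun i a => ctr G fun j b => ctr G fun k c => N i a j k * Δ b c) =
      ctr2 G Δ (fun p q => ctr G (fun i a => N i a p q)) := by
  simp only [ctr2, mul_ctr]
  rw [ctr_comm, ctr_flip hG]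
  refine ctr_congr _ fun p p' => ?_
  rw [ctr_comm G (fun q q' i a => Δ p q * N i a p' q')]
  refine ctr_congr _ fun i a => ?_
  rw [ctr_flip hG]
  exact ctr_congr _ fun q q' => by ring

/-- The divergence of a vector with lower components `p`, in terms of its covariant derivative. -/
lemma sum_div_eq (hG : ∀ i j, G i j = G j i) (A C : Fin D → Fin D → Fin D → ℝ)
    (u p : Fin D → ℝ) (p' : Fin D → Fin D → ℝ) :
    (∑ i, ∑ a, ((-∑ b, ∑ c, G i b * (1 / 2 * A i b c + 1 / 2 * A i c b) * G c a) * p a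
        + G i a * p' i a))
      - (∑ i, (∑ a, G i a * p a) * (1 / 2 * ctr G (fun k l => C l k i - A l i k)))
      - 2 * (∑ i, (∑ a, G i a * p a) * u i) =
    ctr G (fun i a => p' i a - ctr G (fun l m => 1 / 2 * A i a l * p m))
      - 1 / 2 * ctr G (fun k a => p a * ctr G (fun i l => C l i k))
      - 2 * ctr G (fun i a => p a * u i) := by
  have e1 : ∑ i, ∑ a, ∑ b, ∑ c, G i b * (1 / 2 * A i b c) * G c a * p a =
      ctr G (fun i a => ctr G (fun l m => 1 / 2 * A i a l * p m)) := by
    simp only [ctr, Finset.mul_sum]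
    refine sum4_congr ⟨fun x => (x.1, x.2.2.1, x.2.2.2, x.2.1),
      fun x => (x.1, x.2.2.2, x.2.1, x.2.2.1), fun _ => rfl, fun _ => rfl⟩ fun x => ?_
    simp only [Equiv.coe_fn_mk]
    ring
  -- Of the two terms from differentiating the raised index, this one cancels the trace of A that
  -- comes from the divergence ∂̃^k ℰ_{ik} of the frame; the other one is the connection in ∇. Only
  -- the trace of C is left over.
  have e2 : ∑ i, ∑ a, ∑ b, ∑ c, G i b * (1 / 2 * A i c b) * G c a * p a =
      ∑ i, (∑ a, G i a * p a) * (1 / 2 * ctr G (fun k l => A l i k)) := by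
    simp only [ctr, Finset.mul_sum, Finset.sum_mul]
    refine sum4_congr ⟨fun x => (x.2.2.2, x.2.2.1, x.1, x.2.1),
      fun x => (x.2.2.1, x.2.2.2, x.2.1, x.1), fun _ => rfl, fun _ => rfl⟩ fun x => ?_
    simp only [Equiv.coe_fn_mk]
    rw [hG x.1]
    ring
  have e3 : 1 / 2 * ctr G (fun k a => p a * ctr G (fun i l => C l i k)) =
      ∑ i, (∑ a, G i a * p a) * (1 / 2 * ctr G (fun k l => C l k i)) := by
    rw [ctr, Finset.mul_sum]
    refine Finset.sum_congr rfl fun i _ => ?_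
    rw [Finset.sum_mul, Finset.mul_sum]
    exact Finset.sum_congr rfl fun a _ => by ring
  have e4 : ctr G (fun i a => p a * u i) = ∑ i, (∑ a, G i a * p a) * u i := by
    refine Finset.sum_congr rfl fun i _ => ?_
    rw [Finset.sum_mul]
    exact Finset.sum_congr rfl fun a _ => by ring
  have e5 : (∑ i, ∑ a, ((-∑ b, ∑ c, G i b * (1 / 2 * A i b c + 1 / 2 * A i c b) * G c a) * p a
      + G i a * p' i a)) = ctr G p' - (∑ i, ∑ a, ∑ b, ∑ c, G i b * (1 / 2 * A i b c) * G c a * p a)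
      - ∑ i, ∑ a, ∑ b, ∑ c, G i b * (1 / 2 * A i c b) * G c a * p a := by
    simp only [ctr, ← Finset.sum_sub_distrib]
    refine Finset.sum_congr rfl fun i _ => Finset.sum_congr rfl fun a _ => ?_
    rw [neg_mul, Finset.sum_mul, neg_add_eq_sub, sub_sub, ← Finset.sum_add_distrib]
    congr 1
    refine Finset.sum_congr rfl fun b _ => ?_
    rw [Finset.sum_mul, ← Finset.sum_add_distrib]
    exact Finset.sum_congr rfl fun c _ => by ring
  have e6 : ∑ i, (∑ a, G i a * p a) * (1 / 2 * ctr G (fun k l => C l k i - A l i k)) =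
      ∑ i, (∑ a, G i a * p a) * (1 / 2 * ctr G (fun k l => C l k i)) -
      ∑ i, (∑ a, G i a * p a) * (1 / 2 * ctr G (fun k l => A l i k)) := by
    rw [← Finset.sum_sub_distrib]
    refine Finset.sum_congr rfl fun i _ => ?_
    rw [ctr_sub]
    ring
  rw [e5, e6, e3, e4, e1, e2, ctr_sub]
  ring

end reorder

/-- The covariant derivative of `flux`, given the derivatives of its ingredients. -/
lemma flux_hasDerivAt {G : ℝ → Matrix (Fin D) (Fin D) ℝ} {s : ℝ} {r a : Fin D}
    {A : ℝ → Fin D → Fin D → Fin D → ℝ} {v : ℝ → Fin D → ℝ} {Δ : ℝ → Fin D → Fin D → ℝ}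
    {C : Fin D → Fin D → Fin D → ℝ} {dA : Fin D → Fin D → Fin D → Fin D → ℝ}
    {α : Fin D → Fin D → Fin D → ℝ} {dv : Fin D → Fin D → ℝ}
    (hs : ∀ i j, G s i j = G s j i) (hG : IsCompat G s (fun i j => 1 / 2 * A s r i j))
    (hA : ∀ i j k, HasDerivAt (fun t => A t i j k) (dA r i j k) s)
    (hv : ∀ i, HasDerivAt (fun t => v t i) (dv r i) s)
    (hΔ : ∀ i j, HasDerivAt (fun t => Δ t i j) (α r i j) s) :
    HasDerivAt (fun t => flux (G t) (A t) (v t) (Δ t) a)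
      (ctr (G s) (fun l m => 1 / 2 * A s r a l * flux (G s) (A s) (v s) (Δ s) m)
        + ctr (G s) (fun j b => ctr (G s) fun k c =>
            (- (1 / 4) * nab3 (G s) (A s) C dA (A s) r a j k
              + 1 / 2 * nab3 (G s) (A s) C dA (A s) r j a k) * Δ s b c)
        + ctr (G s) (fun j b => ctr (G s) fun k c =>
            ptens (A s) a j k * nab2 (G s) (A s) C α (Δ s) r b c)
        + ctr (G s) (fun k c => nab2 (G s) (A s) C α (Δ s) r a k * v s c)
        + ctr (G s) (fun k c => Δ s a k * nab1 (G s) (A s) C dv (v s) r c)) s := by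
  -- The C-terms are antisymmetric in c and l, so the barred symbol gives the metric the same
  -- velocity as the unbarred one.
  have hG' : IsCompat G s (fun c l => 1 / 2 * (A s r l c + C c l r - C l c r)) := fun i j => by
    refine (hG i j).congr_deriv ?_
    congr 1
    exact Finset.sum_congr rfl fun a _ => Finset.sum_congr rfl fun b _ => by ring
  have h1 := tr2_hasDerivAt hs hG hG' (T := fun t j k => ptens (A t) a j k) (U := Δ)
    (T' := fun j k => ptens (dA r) a j k) (U' := α r)
    (fun j k => ((hA a j k).const_mul _).fun_add ((hA j a k).const_mul _)) hΔ
  have h2 := ctr_hasDerivAt hs hG' fun k c => (hΔ a k).fun_mul (hv c)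
  refine (h1.fun_add h2).congr_deriv ?_
  -- The index a is free, hence not corrected by the rule for contractions. Its connection term is
  -- supplied by hand and distributed over the two summands of the flux.
  have c1 : ctr (G s) (fun l m => 1 / 2 * A s r a l * flux (G s) (A s) (v s) (Δ s) m) =
      ctr (G s) (fun j b => ctr (G s) fun k c =>
        ctr (G s) (fun l m => 1 / 2 * A s r a l * ptens (A s) m j k) * Δ s b c) +
      ctr (G s) (fun k c => ctr (G s) (fun l m => 1 / 2 * A s r a l * Δ s m k) * v s c) := by
    simp only [flux, mul_add, ctr_add, mul_ctr, ctr_mul]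
    rw [ctr_comm, ctr_comm (G s) (fun l m k c => 1 / 2 * A s r a l * (Δ s m k * v s c))]
    congr 1
    · refine ctr_congr _ fun j b => ?_
      rw [ctr_comm]
      exact ctr_congr _ fun k c => ctr_congr _ fun l m => by ring
    · exact ctr_congr _ fun k c => ctr_congr _ fun l m => by ring
  rw [c1]
  have hP : ∀ j k, ptens (dA r) a j k
      - ctr (G s) (fun l m => 1 / 2 * A s r j l * ptens (A s) a m k)
      - ctr (G s) (fun l m => 1 / 2 * (A s r l k + C k l r - C l k r) * ptens (A s) a j m) =
      ctr (G s) (fun l m => 1 / 2 * A s r a l * ptens (A s) m j k) +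
      (- (1 / 4) * nab3 (G s) (A s) C dA (A s) r a j k
              + 1 / 2 * nab3 (G s) (A s) C dA (A s) r j a k) := by
    intro j k
    simp only [nab3, ptens, mul_add, ctr_add, mul_left_comm _ (-(1 / 4) : ℝ)]
    have e : ∀ (c : ℝ) (f g : Fin D → Fin D → ℝ),
        ctr (G s) (fun l m => f l m * (c * g l m)) = c * ctr (G s) (fun l m => f l m * g l m) := by
      intro c f g
      rw [mul_ctr]
      exact ctr_congr _ fun l m => by ring
    simp only [← mul_ctr, e]
    ring
  have e1 : ∀ k c, α r a k * v s c + Δ s a k * dv r c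
      - ctr (G s) (fun l m => 1 / 2 * (A s r l k + C k l r - C l k r) * (Δ s a m * v s c))
      - ctr (G s) (fun l m => 1 / 2 * (A s r l c + C c l r - C l c r) * (Δ s a k * v s m)) =
      nab2 (G s) (A s) C α (Δ s) r a k * v s c +
      ctr (G s) (fun l m => 1 / 2 * A s r a l * Δ s m k) * v s c +
      Δ s a k * nab1 (G s) (A s) C dv (v s) r c := by
    intro k c
    have a1 : ctr (G s) (fun l m => 1 / 2 * (A s r l k + C k l r - C l k r) * (Δ s a m * v s c)) =
        ctr (G s) (fun l m => 1 / 2 * (A s r l k + C k l r - C l k r) * Δ s a m) * v s c := by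
      rw [ctr_mul]; exact ctr_congr _ fun l m => by ring
    have a2 : ctr (G s) (fun l m => 1 / 2 * (A s r l c + C c l r - C l c r) * (Δ s a k * v s m)) =
        Δ s a k * ctr (G s) (fun l m => 1 / 2 * (A s r l c + C c l r - C l c r) * v s m) := by
      rw [mul_ctr]; exact ctr_congr _ fun l m => by ring
    rw [a1, a2, nab2, nab1]
    ring
  simp only [hP, e1]
  simp only [ctr_add, add_mul]
  simp only [nab2]
  ring

/-- The arrays of the derivatives along `ξ` of a family of functions. -/
lemma sum_div_flux {G : Dbl D → Matrix (Fin D) (Fin D) ℝ} {X : Dbl D} {ξ : Fin D → Dbl D}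
    {A : Dbl D → Fin D → Fin D → Fin D → ℝ} {v : Dbl D → Fin D → ℝ} {Δ : Dbl D → Fin D → Fin D → ℝ}
    {C : Fin D → Fin D → Fin D → ℝ} {dA : Fin D → Fin D → Fin D → Fin D → ℝ}
    {α : Fin D → Fin D → Fin D → ℝ} {dv : Fin D → Fin D → ℝ} {u V' : Fin D → ℝ}
    (hs : ∀ i j, G X i j = G X j i)
    (hG : ∀ r, IsCompat (fun t => G (X + t • ξ r)) 0 (fun i j => 1 / 2 * A X r i j))
    (hA : ∀ r i j k, HasDerivAt (fun t : ℝ => A (X + t • ξ r) i j k) (dA r i j k) 0)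
    (hv : ∀ r i, HasDerivAt (fun t : ℝ => v (X + t • ξ r) i) (dv r i) 0)
    (hΔ : ∀ r i j, HasDerivAt (fun t : ℝ => Δ (X + t • ξ r) i j) (α r i j) 0)
    (hV : ∀ i, HasDerivAt (fun t : ℝ => ∑ a, G (X + t • ξ i) i a *
      flux (G (X + t • ξ i)) (A (X + t • ξ i)) (v (X + t • ξ i)) (Δ (X + t • ξ i)) a) (V' i) 0) :
    ∑ i, V' i - (∑ i, (∑ a, G X i a * flux (G X) (A X) (v X) (Δ X) a) *
        (1 / 2 * ctr (G X) (fun k l => C l k i - A X l i k)))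
      - 2 * (∑ i, (∑ a, G X i a * flux (G X) (A X) (v X) (Δ X) a) * u i) =
    tr3 (G X) (ptens (A X)) (nab2 (G X) (A X) C α (Δ X))
      + ctr (G X) (fun k c => v X k * ctr (G X) (fun j b => nab2 (G X) (A X) C α (Δ X) j b c))
      + ctr2 (G X) (Δ X) (varCoeff (G X) (A X) C u (v X))
      - ctr2 (G X) (Δ X) (elHalf (G X) (A X) C u (v X) (nab3 (G X) (A X) C dA (A X))
          (nab1 (G X) (A X) C dv (v X))) := by
  set p' : Fin D → Fin D → ℝ := fun r a =>
    ctr (G X) (fun l m => 1 / 2 * A X r a l * flux (G X) (A X) (v X) (Δ X) m)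
        + ctr (G X) (fun j b => ctr (G X) fun k c =>
            (- (1 / 4) * nab3 (G X) (A X) C dA (A X) r a j k
              + 1 / 2 * nab3 (G X) (A X) C dA (A X) r j a k) * Δ X b c)
        + ctr (G X) (fun j b => ctr (G X) fun k c =>
            ptens (A X) a j k * nab2 (G X) (A X) C α (Δ X) r b c)
        + ctr (G X) (fun k c => nab2 (G X) (A X) C α (Δ X) r a k * v X c)
        + ctr (G X) (fun k c => Δ X a k * nab1 (G X) (A X) C dv (v X) r c) with hp'
  have hp : ∀ r a, HasDerivAt (fun t : ℝ => flux (G (X + t • ξ r)) (A (X + t • ξ r))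
      (v (X + t • ξ r)) (Δ (X + t • ξ r)) a) (p' r a) 0 := by
    intro r a
    have := flux_hasDerivAt (G := fun t => G (X + t • ξ r)) (s := 0) (r := r) (a := a)
      (A := fun t => A (X + t • ξ r)) (v := fun t => v (X + t • ξ r))
      (Δ := fun t => Δ (X + t • ξ r)) (C := C) (dA := dA) (α := α) (dv := dv)
      (by simpa using hs) (by simpa using hG r) (hA r) (hv r) (hΔ r)
    simpa only [zero_smul, add_zero] using this
  have hV' : ∀ i, V' i = ∑ a, ((-∑ b, ∑ c, G X i b * (1 / 2 * A X i b c + 1 / 2 * A X i c b)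
      * G X c a) * flux (G X) (A X) (v X) (Δ X) a + G X i a * p' i a) := by
    intro i
    refine (hV i).unique ?_
    have := HasDerivAt.fun_sum (u := Finset.univ) fun a _ => (hG i i a).fun_mul (hp i a)
    simpa only [zero_smul, add_zero] using this
  simp only [hV']
  rw [sum_div_eq hs]
  -- Leibniz rule for the divergence of the flux. The terms in which ∇ hits Δ are the derivative
  -- part of the first variation; those in which it hits the coefficients enter `elHalf`.
  have f1 : ctr (G X) (fun i a => p' i a
      - ctr (G X) (fun l m => 1 / 2 * A X i a l * flux (G X) (A X) (v X) (Δ X) m)) =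
      ctr2 (G X) (Δ X) (fun p q => ctr (G X) (fun i a =>
        (- (1 / 4) * nab3 (G X) (A X) C dA (A X) i a p q
              + 1 / 2 * nab3 (G X) (A X) C dA (A X) i p a q)))
      + tr3 (G X) (ptens (A X)) (nab2 (G X) (A X) C α (Δ X))
      + ctr (G X) (fun k c => v X k * ctr (G X) (fun j b => nab2 (G X) (A X) C α (Δ X) j b c))
      + ctr2 (G X) (Δ X) (nab1 (G X) (A X) C dv (v X)) := by
    have g1 : tr3 (G X) (ptens (A X)) (nab2 (G X) (A X) C α (Δ X)) =
        ctr (G X) (fun i a => ctr (G X) (fun j b => ctr (G X) fun k c =>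
            ptens (A X) a j k * nab2 (G X) (A X) C α (Δ X) i b c)) := by
      rw [tr3, ctr_flip hs]
    have g2 : ctr (G X)
        (fun k c => v X k * ctr (G X) (fun j b => nab2 (G X) (A X) C α (Δ X) j b c)) =
        ctr (G X) (fun i a => ctr (G X) (fun k c =>
          nab2 (G X) (A X) C α (Δ X) i a k * v X c)) := by
      simp only [mul_ctr]
      rw [ctr_comm]
      refine ctr_congr _ fun i a => ?_
      rw [ctr_flip hs]
      exact ctr_congr _ fun k c => by ring
    have g3 : ctr2 (G X) (Δ X) (nab1 (G X) (A X) C dv (v X)) =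
        ctr (G X) (fun i a => ctr (G X) (fun k c =>
          Δ X a k * nab1 (G X) (A X) C dv (v X) i c)) := by
      rw [ctr2, ctr_flip hs]
    rw [g1, g2, g3, ← ctr_ctr_ctr_comm hs, ← ctr_add, ← ctr_add, ← ctr_add]
    exact ctr_congr _ fun i a => by rw [hp']; ring
  have f2 : elHalf (G X) (A X) C u (v X) (nab3 (G X) (A X) C dA (A X))
          (nab1 (G X) (A X) C dv (v X)) = fun p q =>
      varCoeff (G X) (A X) C u (v X) p q
      - ctr (G X) (fun i a => (- (1 / 4) * nab3 (G X) (A X) C dA (A X) i a p q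
              + 1 / 2 * nab3 (G X) (A X) C dA (A X) i p a q))
      - nab1 (G X) (A X) C dv (v X) p q
      + 1 / 2 * (ctr (G X) (fun k a => ptens (A X) a p q * ctr (G X) (fun i l => C l i k))
        + ctr (G X) (fun i l => C l i p) * v X q)
      + 2 * (ctr (G X) (fun i a => ptens (A X) a p q * u i) + u p * v X q) := by
    funext p q
    rw [elHalf]
    ring
  rw [f1, f2, ctr_flux hs _ _ (fun k => ctr (G X) (fun i l => C l i k)), ctr_flux hs, ctr2_add,
    ctr2_add, ctr2_sub, ctr2_sub, ctr2_mul, ctr2_mul, ctr2_add, ctr2_add]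
  ring

/-- The two halves of the Euler-Lagrange expression add up to `𝒦`. -/
lemma elHalf_add_elHalf {G : Matrix (Fin D) (Fin D) ℝ} (hG : ∀ i j, G i j = G j i)
    (A C : Fin D → Fin D → Fin D → ℝ) (u v : Fin D → ℝ)
    (nA nC : Fin D → Fin D → Fin D → Fin D → ℝ) (nv nu : Fin D → Fin D → ℝ) (p q : Fin D) :
    elHalf G A C u v nA nv p q + elHalf G C A v u nC nu q p =
      khalf G A C nA nv p q + khalf G C A nC nu q p := by
  -- The excess of `elHalf` over `khalf` changes sign under A ↔ C, u ↔ v, p ↔ q, so it cancels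
  -- between the two halves. It contains all dilaton terms that are not second derivatives of d; the
  -- products u_p v_q have already cancelled inside `elHalf`.
  have key : ∀ (A C : Fin D → Fin D → Fin D → ℝ) (u v : Fin D → ℝ)
      (nA : Fin D → Fin D → Fin D → Fin D → ℝ) (nv : Fin D → Fin D → ℝ) (p q : Fin D),
      elHalf G A C u v nA nv p q = khalf G A C nA nv p q
        + 1 / 8 * ctr G (fun j j' => ctr G (fun i i' => A p j i * C i' q j'))
        - 1 / 8 * ctr G (fun j j' => ctr G (fun i i' => C q j i * A i' p j'))
        - 1 / 2 * (u p * ctr G (fun j b => A j b q))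
        + ctr G (fun k c => v k * (1 / 2 * C c q p - C q c p))
        + 1 / 2 * (v q * ctr G (fun i l => C i l p))
        + ctr G (fun k c => u k * (- (1 / 2) * A c p q + A p c q)) := by
    intro A C u v nA nv p q
    have perm : ∀ F : Fin D → Fin D → Fin D → Fin D → ℝ,
        ctr G (fun i i' => ctr G fun k k' => F i i' k k') =
          ctr G (fun j j' => ctr G fun i i' => F i' i j' j) := by
      intro F
      rw [ctr_comm, ctr_flip hG]
      refine ctr_congr _ fun j j' => ?_
      rw [ctr_flip hG]
    have hC : ∀ k, ctr G (fun i l => C l i k) = ctr G (fun i l => C i l k) := fun k => by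
      rw [ctr_flip hG]
    have h1 : 1 / 2 * ctr G (fun i i' => ctr G (fun k k' =>
        ptens A i p k * (C k' q i' - C q k' i') - ptens A p i k * C q k' i')) =
        - (1 / 8) * ctr G (fun j j' => ctr G (fun i i' => C j q i * A i' p j'))
        + 1 / 4 * ctr G (fun j j' => ctr G (fun i i' => A p j i * C i' q j'))
        - 1 / 8 * ctr G (fun j j' => ctr G (fun i i' => C q j i * A i' p j'))
        - 1 / 8 * ctr G (fun j j' => ctr G (fun i i' => C q j i * A p i' j')) := by
      rw [perm (fun i i' k k' => ptens A i p k * (C k' q i' - C q k' i')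
        - ptens A p i k * C q k' i'), perm (fun j j' i i' => A p j i * C i' q j')]
      simp only [mul_ctr, ← ctr_add, ← ctr_sub]
      refine ctr_congr _ fun j j' => ctr_congr _ fun i i' => ?_
      rw [ptens, ptens]
      ring
    have h2 : 1 / 2 * ctr G (fun k a => ptens A a p q * ctr G (fun i l => C l i k)) =
        1 / 4 * ctr G (fun j j' => ctr G (fun i i' => A p j q * C i i' j'))
        - 1 / 8 * ctr G (fun j j' => ctr G (fun i i' => C i i' j * A j' p q)) := by
      rw [ctr_flip hG (fun j j' => ctr G (fun i i' => A p j q * C i i' j'))]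
      simp only [hC, mul_ctr, ← ctr_sub]
      refine ctr_congr _ fun k a => ctr_congr _ fun i l => ?_
      rw [ptens]
      ring
    have h3 : 2 * ctr G (fun i a => ptens A a p q * u i) =
        ctr G (fun k c => u k * (- (1 / 2) * A c p q + A p c q)) := by
      rw [mul_ctr]
      exact ctr_congr _ fun k c => by rw [ptens]; ring
    have h4 : ctr G (fun i a => - (1 / 4) * nA i a p q + 1 / 2 * nA i p a q) =
        - (1 / 4) * ctr G (fun s r => nA r s p q) + 1 / 2 * ctr G (fun s r => nA r p s q) := by
      rw [mul_ctr, mul_ctr, ← ctr_add, ctr_flip hG]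
    rw [elHalf, varCoeff, khalf, h1, h2, h3, h4, hC]
    ring
  rw [key, key]
  have h1 : ctr G (fun k c => v k * (1 / 2 * C c q p - C q c p)) =
    - ctr G (fun k c => v k * (- (1 / 2) * C c q p + C q c p)) := by
    rw [← ctr_neg]; exact ctr_congr _ fun k c => by ring
  have h2 : ctr G (fun k c => u k * (1 / 2 * A c p q - A p c q)) =
    - ctr G (fun k c => u k * (- (1 / 2) * A c p q + A p c q)) := by
    rw [← ctr_neg]; exact ctr_congr _ fun k c => by ring
  rw [h1, h2]
  ring

/-! ### The symmetrized bracket as a sum of two halves -/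

lemma sum6_congr {f f' : Fin D → Fin D → Fin D → Fin D → Fin D → Fin D → ℝ}
    (e : Fin D × Fin D × Fin D × Fin D × Fin D × Fin D ≃
      Fin D × Fin D × Fin D × Fin D × Fin D × Fin D)
    (h : ∀ x, f x.1 x.2.1 x.2.2.1 x.2.2.2.1 x.2.2.2.2.1 x.2.2.2.2.2 =
      f' (e x).1 (e x).2.1 (e x).2.2.1 (e x).2.2.2.1 (e x).2.2.2.2.1 (e x).2.2.2.2.2) :
    ∑ i, ∑ j, ∑ k, ∑ l, ∑ m, ∑ n, f i j k l m n =
      ∑ i, ∑ j, ∑ k, ∑ l, ∑ m, ∑ n, f' i j k l m n := by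
  have (f : Fin D → Fin D → Fin D → Fin D → Fin D → Fin D → ℝ) :
      ∑ i, ∑ j, ∑ k, ∑ l, ∑ m, ∑ n, f i j k l m n =
      ∑ x : Fin D × Fin D × Fin D × Fin D × Fin D × Fin D,
        f x.1 x.2.1 x.2.2.1 x.2.2.2.1 x.2.2.2.2.1 x.2.2.2.2.2 := by
    simp only [← Finset.sum_product', Finset.univ_product_univ]
  rw [this, this]
  exact Fintype.sum_equiv e _ _ h

lemma tr3_self_eq {G : Matrix (Fin D) (Fin D) ℝ}
    (A : Fin D → Fin D → Fin D → ℝ) :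
    ∑ i, ∑ j, ∑ k, ∑ l, ∑ p, G i k * G j l * ((∑ s, G p s * A s k l) * A p i j) = tr3 G A A := by
  simp only [tr3, ctr, Finset.mul_sum, Finset.sum_mul]
  refine sum6_congr ⟨fun x => (x.2.2.2.2.1, x.2.2.2.2.2, x.1, x.2.2.1, x.2.1, x.2.2.2.1),
    fun x => (x.2.2.1, x.2.2.2.2.1, x.2.2.2.1, x.2.2.2.2.2, x.1, x.2.1), fun _ => rfl,
    fun _ => rfl⟩ fun x => ?_
  simp only [Equiv.coe_fn_mk]
  ring

lemma tr3_swap_eq {G : Matrix (Fin D) (Fin D) ℝ} (hG : ∀ i j, G i j = G j i)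
    (A : Fin D → Fin D → Fin D → ℝ) :
    ∑ i, ∑ j, ∑ k, ∑ l, G k l * ((∑ s, G j s * A s i k) * (∑ r, G i r * A r j l)) =
      tr3 G A (fun i j k => A j i k) := by
  simp only [tr3, ctr, Finset.mul_sum, Finset.sum_mul]
  refine sum6_congr ⟨fun x => (x.2.2.2.2.2, x.2.1, x.1, x.2.2.2.2.1, x.2.2.1, x.2.2.2.1),
    fun x => (x.2.2.1, x.2.1, x.2.2.2.2.1, x.2.2.2.2.2, x.2.2.2.1, x.1), fun _ => rfl,
    fun _ => rfl⟩ fun x => ?_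
  simp only [Equiv.coe_fn_mk]
  rw [hG x.2.1]
  ring

lemma ctr_mul_ctr_eq {G : Matrix (Fin D) (Fin D) ℝ} (hG : ∀ i j, G i j = G j i)
    (A : Fin D → Fin D → Fin D → ℝ) (v : Fin D → ℝ) :
    ∑ i, ∑ j, (∑ s, G i s * v s) * (∑ r, G j r * A r j i) =
      ctr G (fun k c => v k * ctr G (fun j b => A j b c)) := by
  simp only [ctr, Finset.mul_sum, Finset.sum_mul]
  refine sum4_congr ⟨fun x => (x.2.2.2, x.1, x.2.2.1, x.2.1),
    fun x => (x.2.1, x.2.2.2, x.2.2.1, x.1), fun _ => rfl, fun _ => rfl⟩ fun x => ?_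
  simp only [Equiv.coe_fn_mk]
  rw [hG x.1, hG x.2.1]
  ring

lemma ctr_self_eq {G : Matrix (Fin D) (Fin D) ℝ} (hG : ∀ i j, G i j = G j i) (v : Fin D → ℝ) :
    ∑ i, (∑ s, G i s * v s) * v i = ctr G (fun i j => v i * v j) := by
  rw [ctr_flip hG]
  refine Finset.sum_congr rfl fun i _ => ?_
  rw [Finset.sum_mul]
  exact Finset.sum_congr rfl fun j _ => by ring

/-- After the last two indices of 𝒟̄ℰ are exchanged, which turns it into C, the barred terms are the
same polynomial as the unbarred ones. The mixed dilaton terms pair v with the trace of A and u with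
the trace of C. -/
lemma lagSym_eq (E : MField D) (d : SField D) (X : Dbl D) :
    lagSym E d X =
      lhalf (gUp E X) (fun i j k => DE E i j k X) (fun i => cDb E i d X) +
      lhalf (gUp E X) (fun i j k => CE E i j k X) (fun i => cD E i d X) := by
  have hs := gUp_symm E X
  have t1 := tr3_self_eq (G := gUp E X) (fun i j k => DE E i j k X)
  have t2 := tr3_self_eq (G := gUp E X) (fun i j k => CE E i j k X)
  have t3 := tr3_swap_eq hs (fun i j k => DE E i j k X)
  have t4 := tr3_swap_eq hs (fun i j k => CE E i j k X)
  have t5 := ctr_mul_ctr_eq hs (fun i j k => DE E i j k X) (fun i => cDb E i d X)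
  have t6 := ctr_mul_ctr_eq hs (fun i j k => CE E i j k X) (fun i => cD E i d X)
  have t7 := ctr_self_eq hs (fun i => cD E i d X)
  have t8 := ctr_self_eq hs (fun i => cDb E i d X)
  have t2' : ∑ i, ∑ j, ∑ k, ∑ l, ∑ p, gUp E X i k * gUp E X j l *
      ((∑ s, gUp E X p s * CE E s k l X) * CE E p i j X) =
      ∑ i, ∑ j, ∑ k, ∑ l, ∑ p, gUp E X i k * gUp E X j l *
      ((∑ s, gUp E X p s * DbE E s k l X) * DbE E p i j X) := by
    refine (Finset.sum_comm).trans (Finset.sum_congr rfl fun i _ => Finset.sum_congr rfl fun j _ =>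
      (Finset.sum_comm).trans (Finset.sum_congr rfl fun k _ => Finset.sum_congr rfl fun l _ =>
      Finset.sum_congr rfl fun p _ => ?_))
    simp only [CE]
    ring
  simp only [lhalf]
  rw [← t1, ← t2, t2', ← t3, ← t4, ← t5, ← t6, ← t7, ← t8]
  simp only [lagSym, DEUp, DbEUp, cDUp, cDbUp, mul_add, Finset.sum_add_distrib,
    mul_left_comm _ (1 / 2 : ℝ), ← Finset.mul_sum]
  simp only [DE, DbE, CE]
  ring

/-! ### Variation of the frame derivatives with ℰ -/

/-- By definition 𝒟̄_m - 𝒟_m = 2 g_{mk} ∂̃^k; inverting g recovers the winding derivative. This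
keeps all later expressions in terms of 𝒟 and 𝒟̄. -/
lemma pd_inl_eq (E : MField D) (X : Dbl D) (hE : (gLow E X).det ≠ 0) (l : Fin D) (f : SField D) :
    pd (Sum.inl l) f X = ∑ m, gUp E X l m * (1 / 2 * (cDb E m f X - cD E m f X)) := by
  have h1 : ∀ m, 1 / 2 * (cDb E m f X - cD E m f X) =
      ∑ k, gLow E X m k * pd (Sum.inl k) f X := by
    intro m
    simp only [cDb, cD, gLow, Matrix.smul_apply, Matrix.add_apply, Matrix.transpose_apply,
      smul_eq_mul]
    rw [add_sub_sub_cancel, ← Finset.sum_add_distrib, Finset.mul_sum]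
    exact Finset.sum_congr rfl fun k _ => by ring
  simp only [h1]
  have h2 : (gUp E X * gLow E X) = 1 :=
    Matrix.nonsing_inv_mul _ (isUnit_iff_ne_zero.mpr hE)
  have h3 : (gUp E X).mulVec ((gLow E X).mulVec fun k => pd (Sum.inl k) f X) =
      fun k => pd (Sum.inl k) f X := by
    rw [Matrix.mulVec_mulVec, h2, Matrix.one_mulVec]
  exact (congrFun h3 l).symm

lemma isCompat_of_hasDerivAt {g : ℝ → Matrix (Fin D) (Fin D) ℝ} {w : Fin D → Fin D → ℝ} {s : ℝ}
    (hg : ∀ i j, HasDerivAt (fun t => g t i j) (w i j + w j i) s)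
    (hc : ∀ i j, ContDiffAt ℝ 1 (fun t => g t i j) s) (hd : (g s).det ≠ 0) :
    IsCompat (fun t => (g t)⁻¹) s w := by
  intro i j
  refine (hasDerivAt_inv_matrix (M' := Matrix.of fun i j => w i j + w j i) hg hd i j hc).congr_deriv ?_
  simp only [Matrix.mul_apply, Matrix.of_apply, Finset.sum_mul]
  rw [Finset.sum_comm]

/-- `ℰ + s δℰ`. -/
def shift (E Δ : MField D) (s : ℝ) : MField D := fun Y => E Y + s • Δ Y

lemma pd_add_mul {f g : SField D} {X : Dbl D} (hf : DifferentiableAt ℝ f X)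
    (hg : DifferentiableAt ℝ g X) (m : Fin D ⊕ Fin D) (s : ℝ) :
    pd m (fun Y => f Y + s * g Y) X = pd m f X + s * pd m g X := by
  simp only [pd]
  rw [fderiv_fun_add hf (hg.const_mul s), fderiv_const_mul hg]
  rfl

lemma gLow_shift (E Δ : MField D) (s : ℝ) (X : Dbl D) :
    gLow (shift E Δ s) X = gLow E X + s • gLow Δ X := by
  ext i j
  simp [gLow, shift]
  ring

lemma hasDerivAt_poly (a b : ℝ) : HasDerivAt (fun s : ℝ => a + s * b) b 0 := by
  simpa using ((hasDerivAt_id (0 : ℝ)).mul_const b).const_add a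

/-- Both the operator and its argument move with s: the first term differentiates the argument, the
second the ℰ inside 𝒟_i. With f a component of ℰ this gives the variation of A; with f = d and g = 0
it gives that of u. -/
lemma cD_shift_hasDerivAt {E Δ : MField D} {f g : SField D} {X : Dbl D}
    (hE : (gLow E X).det ≠ 0) (hf : DifferentiableAt ℝ f X)
    (hg : DifferentiableAt ℝ g X) (i : Fin D) :
    HasDerivAt (fun s : ℝ => cD (shift E Δ s) i (fun Y => f Y + s * g Y) X)
      (cD E i g X - ctr (gUp E X) (fun l m => 1 / 2 * (Δ X i l * (cDb E m f X - cD E m f X)))) 0 := by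
  have h1 : HasDerivAt (fun s : ℝ => cD (shift E Δ s) i (fun Y => f Y + s * g Y) X)
      (pd (Sum.inr i) g X - ∑ k, (Δ X i k * pd (Sum.inl k) f X + E X i k * pd (Sum.inl k) g X))
      0 := by
    simp only [cD, shift, pd_add_mul hf hg, Matrix.add_apply, Matrix.smul_apply, smul_eq_mul]
    refine (hasDerivAt_poly _ _).fun_sub (HasDerivAt.fun_sum fun k _ => ?_)
    simpa using (hasDerivAt_poly (E X i k) (Δ X i k)).fun_mul
      (hasDerivAt_poly (pd (Sum.inl k) f X) (pd (Sum.inl k) g X))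
  refine h1.congr_deriv ?_
  rw [Finset.sum_add_distrib, cD]
  have : ∑ k, Δ X i k * pd (Sum.inl k) f X =
      ctr (gUp E X) (fun l m => 1 / 2 * (Δ X i l * (cDb E m f X - cD E m f X))) := by
    refine Finset.sum_congr rfl fun k _ => ?_
    rw [pd_inl_eq E X hE, Finset.mul_sum]
    exact Finset.sum_congr rfl fun m _ => by ring
  rw [this]
  ring

lemma cDb_shift_hasDerivAt {E Δ : MField D} {f g : SField D} {X : Dbl D}
    (hE : (gLow E X).det ≠ 0) (hf : DifferentiableAt ℝ f X)
    (hg : DifferentiableAt ℝ g X) (i : Fin D) :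
    HasDerivAt (fun s : ℝ => cDb (shift E Δ s) i (fun Y => f Y + s * g Y) X)
      (cDb E i g X - ctr (gUp E X) (fun l m => 1 / 2 * (Δ X l i * (cD E m f X - cDb E m f X)))) 0 := by
  have h1 : HasDerivAt (fun s : ℝ => cDb (shift E Δ s) i (fun Y => f Y + s * g Y) X)
      (pd (Sum.inr i) g X + ∑ k, (Δ X k i * pd (Sum.inl k) f X + E X k i * pd (Sum.inl k) g X))
      0 := by
    simp only [cDb, shift, pd_add_mul hf hg, Matrix.add_apply, Matrix.smul_apply, smul_eq_mul]
    refine (hasDerivAt_poly _ _).fun_add (HasDerivAt.fun_sum fun k _ => ?_)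
    simpa using (hasDerivAt_poly (E X k i) (Δ X k i)).fun_mul
      (hasDerivAt_poly (pd (Sum.inl k) f X) (pd (Sum.inl k) g X))
  refine h1.congr_deriv ?_
  rw [Finset.sum_add_distrib, cDb]
  have : ∑ k, Δ X k i * pd (Sum.inl k) f X =
      - ctr (gUp E X) (fun l m => 1 / 2 * (Δ X l i * (cD E m f X - cDb E m f X))) := by
    rw [← ctr_neg]
    refine Finset.sum_congr rfl fun k _ => ?_
    rw [pd_inl_eq E X hE, Finset.mul_sum]
    exact Finset.sum_congr rfl fun m _ => by ring
  rw [this]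
  ring

/-- Covariant derivative part of the variation of the half bracket. -/
def lhalfFlux (G : Matrix (Fin D) (Fin D) ℝ) (A C : Fin D → Fin D → Fin D → ℝ) (v : Fin D → ℝ)
    (α : Fin D → Fin D → Fin D → ℝ) (Δ : Fin D → Fin D → ℝ) : ℝ :=
  tr3 G (ptens A) (nab2 G A C α Δ) + ctr G (fun k c => v k * ctr G (fun j b => nab2 G A C α Δ j b c))

/-- The first variation of `lagSym` at `ℰ` in the direction `Δ`. -/
def lagSymVar (E : MField D) (d : SField D) (Δ : MField D) : SField D := fun X =>
  lhalfFlux (gUp E X) (fun i j k => DE E i j k X) (fun i j k => CE E i j k X)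
      (fun i => cDb E i d X) (fun i j k => cD E i (fun Y => Δ Y j k) X) (fun i j => Δ X i j)
    + ctr2 (gUp E X) (fun i j => Δ X i j) (varCoeff (gUp E X) (fun i j k => DE E i j k X)
      (fun i j k => CE E i j k X) (fun i => cD E i d X) (fun i => cDb E i d X))
  + (lhalfFlux (gUp E X) (fun i j k => CE E i j k X) (fun i j k => DE E i j k X)
      (fun i => cD E i d X) (fun i j k => cDb E i (fun Y => Δ Y k j) X) (fun i j => Δ X j i)
    + ctr2 (gUp E X) (fun i j => Δ X j i) (varCoeff (gUp E X) (fun i j k => CE E i j k X)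
      (fun i j k => DE E i j k X) (fun i => cDb E i d X) (fun i => cD E i d X)))

lemma isCompat_shift (E Δ : MField D) {X : Dbl D} (hE : (gLow E X).det ≠ 0) :
    IsCompat (fun s => gUp (shift E Δ s) X) 0 (fun i j => 1 / 2 * Δ X i j) := by
  have : (fun s => gUp (shift E Δ s) X) = fun s => (gLow E X + s • gLow Δ X)⁻¹ := by
    funext s
    rw [gUp, gLow_shift]
  rw [this]
  refine isCompat_of_hasDerivAt (fun i j => ?_) (fun i j => ?_) (by simpa using hE)
  · refine (hasDerivAt_poly (gLow E X i j) (gLow Δ X i j)).congr_deriv ?_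
    simp [gLow]
    ring
  · simp only [Matrix.add_apply, Matrix.smul_apply, smul_eq_mul]
    fun_prop

lemma shift_zero (E Δ : MField D) : shift E Δ 0 = E := by
  funext Y; simp [shift]

/-- `lhalf_hasDerivAt` is used for both halves, the second with Δ transposed. The dilaton is fixed,
but 𝒟d and 𝒟̄d still vary through the frame. -/
lemma lagSym_hasDerivAt {E Δ : MField D} {d : SField D} {X : Dbl D}
    (hE : (gLow E X).det ≠ 0) (hf : ∀ i j, DifferentiableAt ℝ (fun Y => E Y i j) X)
    (hd : DifferentiableAt ℝ d X) (hΔ : ∀ i j, DifferentiableAt ℝ (fun Y => Δ Y i j) X) :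
    HasDerivAt (fun s => lagSym (shift E Δ s) d X) (lagSymVar E d Δ X) 0 := by
  simp only [lagSym_eq]
  have hs : ∀ i j, gUp (shift E Δ 0) X i j = gUp (shift E Δ 0) X j i := gUp_symm _ X
  have hd' : ∀ s : ℝ, d = fun Y => d Y + s * (fun _ => (0 : ℝ)) Y := fun s => by simp
  have h0 : ∀ i, cD E i (fun _ => (0 : ℝ)) X = 0 := fun i => by simp [cD, pd]
  have h0' : ∀ i, cDb E i (fun _ => (0 : ℝ)) X = 0 := fun i => by simp [cDb, pd]
  have hc : IsCompat (fun s => gUp (shift E Δ s) X) 0 (fun i j => 1 / 2 * Δ X j i) := by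
    intro i j
    refine (isCompat_shift E Δ hE i j).congr_deriv ?_
    congr 1
    exact Finset.sum_congr rfl fun a _ => Finset.sum_congr rfl fun b _ => by ring
  have h1 := lhalf_hasDerivAt (G := fun s => gUp (shift E Δ s) X) (s := 0)
    (A := fun s i j k => DE (shift E Δ s) i j k X) (v := fun s i => cDb (shift E Δ s) i d X)
    (Δ := fun i j => Δ X i j) (u := fun i => cD E i d X) (C := fun i j k => CE E i j k X)
    (α := fun i j k => cD E i (fun Y => Δ Y j k) X) hs (isCompat_shift E Δ hE)
    (fun i j k => by
      have := cD_shift_hasDerivAt (Δ := Δ) hE (hf j k) (hΔ j k) i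
      simp only [shift_zero]
      exact this)
    (fun i => by
      have := cDb_shift_hasDerivAt (Δ := Δ) hE hd (differentiableAt_const (0 : ℝ)) i
      simp only [shift_zero]
      rw [h0', zero_sub, ← ctr_neg] at this
      simp only [mul_zero, add_zero] at this
      refine this.congr_deriv (ctr_congr _ fun l m => by ring))
  have h2 := lhalf_hasDerivAt (G := fun s => gUp (shift E Δ s) X) (s := 0)
    (A := fun s i j k => CE (shift E Δ s) i j k X) (v := fun s i => cD (shift E Δ s) i d X)
    (Δ := fun i j => Δ X j i) (u := fun i => cDb E i d X) (C := fun i j k => DE E i j k X)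
    (α := fun i j k => cDb E i (fun Y => Δ Y k j) X) hs hc
    (fun i j k => by
      have := cDb_shift_hasDerivAt (Δ := Δ) hE (hf k j) (hΔ k j) i
      simp only [shift_zero]
      exact this)
    (fun i => by
      have := cD_shift_hasDerivAt (Δ := Δ) hE hd (differentiableAt_const (0 : ℝ)) i
      simp only [shift_zero]
      rw [h0, zero_sub, ← ctr_neg] at this
      simp only [mul_zero, add_zero] at this
      refine this.congr_deriv (ctr_congr _ fun l m => by ring))
  have h3 := h1.fun_add h2
  simp only [shift_zero] at h3
  exact h3

lemma contDiff_ctr {F : Type*} [NormedAddCommGroup F] [NormedSpace ℝ F] {m : WithTop ℕ∞}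
    {G : F → Matrix (Fin D) (Fin D) ℝ} {f : F → Fin D → Fin D → ℝ}
    (hG : ∀ i j, ContDiff ℝ m (fun x => G x i j)) (hf : ∀ i j, ContDiff ℝ m (fun x => f x i j)) :
    ContDiff ℝ m (fun x => ctr (G x) (f x)) :=
  ContDiff.sum fun i _ => ContDiff.sum fun j _ => (hG i j).mul (hf i j)

/-! ### The boundary vector and the pointwise variation identity -/

/-- The unbarred part of the boundary vector. -/
def fluxU (E : MField D) (d : SField D) (Δ : MField D) (i : Fin D) : SField D := fun X =>
  ∑ a, gUp E X i a * flux (gUp E X) (fun i j k => DE E i j k X) (fun i => cDb E i d X)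
    (fun i j => Δ X i j) a

/-- The barred part of the boundary vector. -/
def fluxB (E : MField D) (d : SField D) (Δ : MField D) (i : Fin D) : SField D := fun X =>
  ∑ a, gUp E X i a * flux (gUp E X) (fun i j k => CE E i j k X) (fun i => cD E i d X)
    (fun i j => Δ X j i) a

section
variable {E Δ : MField D} {d : SField D}

lemma contDiff_flux {G : Dbl D → Matrix (Fin D) (Fin D) ℝ} {A : Dbl D → Fin D → Fin D → Fin D → ℝ}
    {v : Dbl D → Fin D → ℝ} {Δ : Dbl D → Fin D → Fin D → ℝ}
    (hG : ∀ i j, ContDiff ℝ ∞ (fun x => G x i j)) (hA : ∀ i j k, ContDiff ℝ ∞ (fun x => A x i j k))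
    (hv : ∀ i, ContDiff ℝ ∞ (fun x => v x i)) (hΔ : ∀ i j, ContDiff ℝ ∞ (fun x => Δ x i j))
    (a : Fin D) : ContDiff ℝ ∞ (fun x => flux (G x) (A x) (v x) (Δ x) a) := by
  refine (contDiff_ctr hG fun j b => contDiff_ctr hG fun k c => ?_).add
    (contDiff_ctr hG fun k c => (hΔ a k).mul (hv c))
  exact ((contDiff_const.mul (hA a j k)).add (contDiff_const.mul (hA j a k))).mul (hΔ b c)

lemma contDiff_fluxU (h : IsBackground E d) (hΔ : ∀ i j, ContDiff ℝ ∞ (fun X => Δ X i j))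
    (i : Fin D) : ContDiff ℝ ∞ (fluxU E d Δ i) :=
  ContDiff.sum fun a _ => (h.contDiff_gUp i a).mul (contDiff_flux h.contDiff_gUp h.contDiff_DE
    (h.contDiff_cDb h.smooth_d) hΔ a)

lemma contDiff_fluxB (h : IsBackground E d) (hΔ : ∀ i j, ContDiff ℝ ∞ (fun X => Δ X i j))
    (i : Fin D) : ContDiff ℝ ∞ (fluxB E d Δ i) :=
  ContDiff.sum fun a _ => (h.contDiff_gUp i a).mul (contDiff_flux h.contDiff_gUp
    (fun i j k => h.contDiff_DbE i k j) (h.contDiff_cD h.smooth_d) (fun i j => hΔ j i) a)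

end

section
variable {E Δ : MField D} {d : SField D}

lemma differentiableAt_of_smooth {f : SField D} (hf : ContDiff ℝ ∞ f) (X : Dbl D) :
    DifferentiableAt ℝ f X := hf.differentiable (by simp) X

lemma IsBackground.hasDerivAt_line_cD {f : SField D} (hf : ContDiff ℝ ∞ f) (E : MField D)
    (X : Dbl D) (r : Fin D) :
    HasDerivAt (fun t : ℝ => f (X + t • uVec E X r)) (cD E r f X) 0 :=
  cD_eq_fderiv E r f X ▸ hasDerivAt_line (differentiableAt_of_smooth hf X) _

lemma IsBackground.hasDerivAt_line_cDb {f : SField D} (hf : ContDiff ℝ ∞ f) (E : MField D)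
    (X : Dbl D) (r : Fin D) :
    HasDerivAt (fun t : ℝ => f (X + t • bVec E X r)) (cDb E r f X) 0 :=
  cDb_eq_fderiv E r f X ▸ hasDerivAt_line (differentiableAt_of_smooth hf X) _

lemma IsBackground.isCompat_line (h : IsBackground E d) {X ξ : Dbl D} {w : Fin D → Fin D → ℝ}
    (hw : ∀ i j, HasDerivAt (fun t : ℝ => gLow E (X + t • ξ) i j) (w i j + w j i) 0) :
    IsCompat (fun t => gUp E (X + t • ξ)) 0 w := by
  refine isCompat_of_hasDerivAt (g := fun t => gLow E (X + t • ξ)) hw (fun i j => ?_)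
    (by simpa using h.nondeg X)
  have : ContDiff ℝ ∞ (fun t : ℝ => gLow E (X + t • ξ) i j) :=
    (h.contDiff_gLow i j).comp (by fun_prop)
  exact (this.of_le (by simp)).contDiffAt

/-- Up to the factor e^{-2d}, the left side is the coordinate divergence of e^{-2d} times the vector
with components `fluxU` in the frame `uVec`: the frame vector itself has divergence -∂̃^k ℰ_{ik},
and the density contributes -2 𝒟_i d. -/
lemma sum_div_fluxU (h : IsBackground E d) (hΔ : ∀ i j, ContDiff ℝ ∞ (fun X => Δ X i j))
    (X : Dbl D) :
    ∑ i, cD E i (fluxU E d Δ i) X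
      - ∑ i, fluxU E d Δ i X * ∑ k, pd (Sum.inl k) (fun Y => E Y i k) X
      - 2 * ∑ i, fluxU E d Δ i X * cD E i d X =
    lhalfFlux (gUp E X) (fun i j k => DE E i j k X) (fun i j k => CE E i j k X)
      (fun i => cDb E i d X) (fun i j k => cD E i (fun Y => Δ Y j k) X) (fun i j => Δ X i j)
      + ctr2 (gUp E X) (fun i j => Δ X i j) (varCoeff (gUp E X) (fun i j k => DE E i j k X)
        (fun i j k => CE E i j k X) (fun i => cD E i d X) (fun i => cDb E i d X))
      - ctr2 (gUp E X) (fun i j => Δ X i j) (elHalf (gUp E X) (fun i j k => DE E i j k X)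
        (fun i j k => CE E i j k X) (fun i => cD E i d X) (fun i => cDb E i d X)
        (fun r a b c => nabUUB E (DE E) r a b c X)
        (fun i j => nabB E (fun i => cDb E i d) i j X)) := by
  have := sum_div_flux (G := gUp E) (X := X) (ξ := uVec E X) (A := fun X i j k => DE E i j k X)
    (v := fun X i => cDb E i d X) (Δ := fun X i j => Δ X i j) (C := fun i j k => CE E i j k X)
    (dA := fun r a b c => cD E r (DE E a b c) X) (α := fun i j k => cD E i (fun Y => Δ Y j k) X)
    (dv := fun i j => cD E i (cDb E j d) X) (u := fun i => cD E i d X)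
    (V' := fun i => cD E i (fluxU E d Δ i) X) (gUp_symm E X)
    (fun r => h.isCompat_line fun i j => by
      have := ((IsBackground.hasDerivAt_line_cD (h.smooth_E i j) E X r).fun_add
        (IsBackground.hasDerivAt_line_cD (h.smooth_E j i) E X r)).const_mul (1 / 2)
      refine this.congr_deriv ?_
      simp only [DE]
      ring)
    (fun r i j k => IsBackground.hasDerivAt_line_cD (h.contDiff_DE i j k) E X r)
    (fun r i => IsBackground.hasDerivAt_line_cD (h.contDiff_cDb h.smooth_d i) E X r)
    (fun r i j => IsBackground.hasDerivAt_line_cD (hΔ i j) E X r)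
    (fun i => IsBackground.hasDerivAt_line_cD (contDiff_fluxU h hΔ i) E X i)
  have hk : ∀ i, ∑ k, pd (Sum.inl k) (fun Y => E Y i k) X =
      1 / 2 * ctr (gUp E X) (fun k l => CE E l k i X - DE E l i k X) := by
    intro i
    rw [mul_ctr]
    refine Finset.sum_congr rfl fun k _ => ?_
    rw [pd_inl_eq E X (h.nondeg X)]
    rfl
  simp only [hk, nabUUB_eq, nabB_eq]
  exact this

lemma sum_div_fluxB (h : IsBackground E d) (hΔ : ∀ i j, ContDiff ℝ ∞ (fun X => Δ X i j))
    (X : Dbl D) :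
    ∑ i, cDb E i (fluxB E d Δ i) X
      + ∑ i, fluxB E d Δ i X * ∑ k, pd (Sum.inl k) (fun Y => E Y k i) X
      - 2 * ∑ i, fluxB E d Δ i X * cDb E i d X =
    lhalfFlux (gUp E X) (fun i j k => CE E i j k X) (fun i j k => DE E i j k X)
      (fun i => cD E i d X) (fun i j k => cDb E i (fun Y => Δ Y k j) X) (fun i j => Δ X j i)
      + ctr2 (gUp E X) (fun i j => Δ X j i) (varCoeff (gUp E X) (fun i j k => CE E i j k X)
        (fun i j k => DE E i j k X) (fun i => cDb E i d X) (fun i => cD E i d X))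
      - ctr2 (gUp E X) (fun i j => Δ X j i) (elHalf (gUp E X) (fun i j k => CE E i j k X)
        (fun i j k => DE E i j k X) (fun i => cDb E i d X) (fun i => cD E i d X)
        (fun r a b c => nabbBUB E (DbE E) r a c b X)
        (fun i j => nabbU E (fun i => cD E i d) i j X)) := by
  have := sum_div_flux (G := gUp E) (X := X) (ξ := bVec E X) (A := fun X i j k => CE E i j k X)
    (v := fun X i => cD E i d X) (Δ := fun X i j => Δ X j i) (C := fun i j k => DE E i j k X)
    (dA := fun r a b c => cDb E r (CE E a b c) X) (α := fun i j k => cDb E i (fun Y => Δ Y k j) X)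
    (dv := fun i j => cDb E i (cD E j d) X) (u := fun i => cDb E i d X)
    (V' := fun i => cDb E i (fluxB E d Δ i) X) (gUp_symm E X)
    (fun r => h.isCompat_line fun i j => by
      have := ((IsBackground.hasDerivAt_line_cDb (h.smooth_E i j) E X r).fun_add
        (IsBackground.hasDerivAt_line_cDb (h.smooth_E j i) E X r)).const_mul (1 / 2)
      refine this.congr_deriv ?_
      simp only [CE, DbE]
      ring)
    (fun r i j k => IsBackground.hasDerivAt_line_cDb (h.contDiff_DbE i k j) E X r)
    (fun r i => IsBackground.hasDerivAt_line_cDb (h.contDiff_cD h.smooth_d i) E X r)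
    (fun r i j => IsBackground.hasDerivAt_line_cDb (hΔ j i) E X r)
    (fun i => IsBackground.hasDerivAt_line_cDb (contDiff_fluxB h hΔ i) E X i)
  have hk : ∀ i, ∑ k, pd (Sum.inl k) (fun Y => E Y k i) X =
      - (1 / 2 * ctr (gUp E X) (fun k l => DE E l k i X - CE E l i k X)) := by
    intro i
    rw [mul_ctr, ← ctr_neg]
    refine Finset.sum_congr rfl fun k _ => ?_
    rw [pd_inl_eq E X (h.nondeg X)]
    refine Finset.sum_congr rfl fun m _ => ?_
    simp only [DE, CE, DbE]
    ring
  simp only [hk, nabbBUB_eq, nabbU_eq, mul_neg, Finset.sum_neg_distrib, ← sub_eq_add_neg]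
  exact this

/-- The boundary vector of the first variation. -/
def bdry (E : MField D) (d : SField D) (Δ : MField D) : Fin D ⊕ Fin D → SField D :=
  Sum.elim
    (fun k X => Real.exp (-2 * d X) *
      (∑ i, E X i k * (- fluxU E d Δ i X) + ∑ i, E X k i * fluxB E d Δ i X))
    (fun i X => Real.exp (-2 * d X) * (fluxU E d Δ i X + fluxB E d Δ i X))

lemma contDiff_exp_dil (h : IsBackground E d) : ContDiff ℝ ∞ (fun X => Real.exp (-2 * d X)) :=
  Real.contDiff_exp.comp (contDiff_const.mul h.smooth_d)

lemma contDiff_bdry (h : IsBackground E d) (hΔ : ∀ i j, ContDiff ℝ ∞ (fun X => Δ X i j))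
    (m : Fin D ⊕ Fin D) : ContDiff ℝ ∞ (bdry E d Δ m) := by
  rcases m with k | i
  · refine (contDiff_exp_dil h).mul (ContDiff.add ?_ ?_)
    · exact ContDiff.sum fun i _ => (h.smooth_E i k).mul (contDiff_fluxU h hΔ i).neg
    · exact ContDiff.sum fun i _ => (h.smooth_E k i).mul (contDiff_fluxB h hΔ i)
  · exact (contDiff_exp_dil h).mul ((contDiff_fluxU h hΔ i).add (contDiff_fluxB h hΔ i))

lemma pd_mul {f g : SField D} {X : Dbl D} (hf : DifferentiableAt ℝ f X)
    (hg : DifferentiableAt ℝ g X) (m : Fin D ⊕ Fin D) :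
    pd m (fun Y => f Y * g Y) X = pd m f X * g X + f X * pd m g X := by
  simp only [pd]
  rw [fderiv_fun_mul hf hg]
  simp
  ring

lemma pd_add {f g : SField D} {X : Dbl D} (hf : DifferentiableAt ℝ f X)
    (hg : DifferentiableAt ℝ g X) (m : Fin D ⊕ Fin D) :
    pd m (fun Y => f Y + g Y) X = pd m f X + pd m g X := by
  simp only [pd]
  rw [fderiv_fun_add hf hg]
  rfl

lemma pd_neg {f : SField D} {X : Dbl D} (m : Fin D ⊕ Fin D) :
    pd m (fun Y => - f Y) X = - pd m f X := by
  simp only [pd]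
  rw [fderiv_fun_neg]
  rfl

lemma pd_sum {ι : Type*} {u : Finset ι} {f : ι → SField D} {X : Dbl D}
    (hf : ∀ i ∈ u, DifferentiableAt ℝ (f i) X) (m : Fin D ⊕ Fin D) :
    pd m (fun Y => ∑ i ∈ u, f i Y) X = ∑ i ∈ u, pd m (f i) X := by
  simp only [pd]
  rw [fderiv_fun_sum hf]
  simp

lemma pd_exp {X : Dbl D} (hd : DifferentiableAt ℝ d X) (m : Fin D ⊕ Fin D) :
    pd m (fun Y => Real.exp (-2 * d Y)) X = Real.exp (-2 * d X) * (-2 * pd m d X) := by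
  simp only [pd]
  rw [fderiv_exp (hd.const_mul (-2)), fderiv_const_mul hd]
  simp

lemma KLow_eq_elHalf (E : MField D) (d : SField D) (X : Dbl D) (p q : Fin D) :
    KLow E d X p q = elHalf (gUp E X) (fun i j k => DE E i j k X)
        (fun i j k => CE E i j k X) (fun i => cD E i d X) (fun i => cDb E i d X)
        (fun r a b c => nabUUB E (DE E) r a b c X)
        (fun i j => nabB E (fun i => cDb E i d) i j X) p q +
      elHalf (gUp E X) (fun i j k => CE E i j k X)
        (fun i j k => DE E i j k X) (fun i => cDb E i d X) (fun i => cD E i d X)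
        (fun r a b c => nabbBUB E (DbE E) r a c b X)
        (fun i j => nabbU E (fun i => cD E i d) i j X) q p := by
  rw [elHalf_add_elHalf (gUp_symm E X), KLow_eq]
  rfl

lemma ctr2_transpose {G : Matrix (Fin D) (Fin D) ℝ} (Δ K : Fin D → Fin D → ℝ) :
    ctr2 G (fun i j => Δ j i) K = ctr2 G Δ (fun p q => K q p) := by
  unfold ctr2
  rw [ctr_comm]

lemma variationDensity_eq (E : MField D) (d : SField D) (Δ : MField D) (X : Dbl D) :
    variationDensity E d Δ X =
      Real.exp (-2 * d X) * ctr2 (gUp E X) (fun i j => Δ X i j) (fun p q => KLow E d X p q) := by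
  rw [variationDensity]
  congr 1
  simp only [KUp, Matrix.of_apply, ctr2, ctr, Finset.mul_sum]
  refine Finset.sum_congr rfl fun p _ => ?_
  rw [Finset.sum_comm]
  exact Finset.sum_congr rfl fun k _ => Finset.sum_congr rfl fun q _ =>
    Finset.sum_congr rfl fun l _ => by ring

/-- The first variation is `𝒦` up to a total derivative. -/
lemma lagSymVar_eq (h : IsBackground E d) (hΔ : ∀ i j, ContDiff ℝ ∞ (fun X => Δ X i j))
    (X : Dbl D) :
    Real.exp (-2 * d X) * lagSymVar E d Δ X =
      variationDensity E d Δ X + ∑ m, pd m (bdry E d Δ m) X := by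
  have hd := differentiableAt_of_smooth h.smooth_d X
  have hE := fun i j => differentiableAt_of_smooth (h.smooth_E i j) X
  have hU := fun i => differentiableAt_of_smooth (contDiff_fluxU h hΔ i) X
  have hB := fun i => differentiableAt_of_smooth (contDiff_fluxB h hΔ i) X
  have hw := differentiableAt_of_smooth (contDiff_exp_dil h) X
  have h1 : ∀ i, pd (Sum.inr i) (bdry E d Δ (Sum.inr i)) X = Real.exp (-2 * d X) *
      (pd (Sum.inr i) (fluxU E d Δ i) X + pd (Sum.inr i) (fluxB E d Δ i) X
        - 2 * (pd (Sum.inr i) d X * (fluxU E d Δ i X + fluxB E d Δ i X))) := by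
    intro i
    simp only [bdry, Sum.elim_inr]
    rw [pd_mul hw ((hU i).fun_add (hB i)), pd_exp hd, pd_add (hU i) (hB i)]
    ring
  have h2 : ∀ k, pd (Sum.inl k) (bdry E d Δ (Sum.inl k)) X = Real.exp (-2 * d X) *
      (∑ i, (- (pd (Sum.inl k) (fun Y => E Y i k) X * fluxU E d Δ i X)
          - E X i k * pd (Sum.inl k) (fluxU E d Δ i) X
          + pd (Sum.inl k) (fun Y => E Y k i) X * fluxB E d Δ i X
          + E X k i * pd (Sum.inl k) (fluxB E d Δ i) X
          - 2 * (pd (Sum.inl k) d X * (E X k i * fluxB E d Δ i X - E X i k * fluxU E d Δ i X)))) := by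
    intro k
    simp only [bdry, Sum.elim_inl]
    have s1 : ∀ i ∈ Finset.univ, DifferentiableAt ℝ (fun Y => E Y i k * (- fluxU E d Δ i Y)) X :=
      fun i _ => (hE i k).fun_mul (hU i).fun_neg
    have s2 : ∀ i ∈ Finset.univ, DifferentiableAt ℝ (fun Y => E Y k i * fluxB E d Δ i Y) X :=
      fun i _ => (hE k i).fun_mul (hB i)
    rw [pd_mul hw ((DifferentiableAt.fun_sum s1).fun_add (DifferentiableAt.fun_sum s2)), pd_exp hd,
      pd_add (DifferentiableAt.fun_sum s1) (DifferentiableAt.fun_sum s2), pd_sum s1, pd_sum s2,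
      mul_assoc, ← mul_add]
    congr 1
    rw [← Finset.sum_add_distrib, ← Finset.sum_add_distrib, Finset.mul_sum,
      ← Finset.sum_add_distrib]
    refine Finset.sum_congr rfl fun i _ => ?_
    rw [pd_mul (hE i k) (hU i).fun_neg, pd_mul (hE k i) (hB i), pd_neg]
    ring
  -- `bdry` holds the coordinate components of e^{-2d} (`fluxU`^i `uVec`_i + `fluxB`^i `bVec`_i), so
  -- its divergence regroups into the two frame divergences computed before.
  have h3 : ∑ m, pd m (bdry E d Δ m) X = Real.exp (-2 * d X) *
      ((∑ i, cD E i (fluxU E d Δ i) X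
        - ∑ i, fluxU E d Δ i X * ∑ k, pd (Sum.inl k) (fun Y => E Y i k) X
        - 2 * ∑ i, fluxU E d Δ i X * cD E i d X) +
      (∑ i, cDb E i (fluxB E d Δ i) X
        + ∑ i, fluxB E d Δ i X * ∑ k, pd (Sum.inl k) (fun Y => E Y k i) X
        - 2 * ∑ i, fluxB E d Δ i X * cDb E i d X)) := by
    rw [Fintype.sum_sum_type]
    simp only [h1, h2, ← Finset.mul_sum]
    rw [← mul_add]
    congr 1
    rw [Finset.sum_comm, ← Finset.sum_add_distrib]
    simp only [Finset.mul_sum, ← Finset.sum_add_distrib, ← Finset.sum_sub_distrib]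
    refine Finset.sum_congr rfl fun i _ => ?_
    simp only [cD, cDb, mul_sub, mul_add, Finset.mul_sum, Finset.sum_add_distrib,
      Finset.sum_sub_distrib, Finset.sum_neg_distrib]
    simp only [mul_comm, mul_left_comm, mul_assoc]
    ring
  rw [h3, sum_div_fluxU h hΔ, sum_div_fluxB h hΔ, variationDensity_eq, lagSymVar]
  simp only [KLow_eq_elHalf]
  have e := ctr2_transpose (G := gUp E X) (fun i j => Δ X i j)
    (elHalf (gUp E X) (fun i j k => CE E i j k X)
        (fun i j k => DE E i j k X) (fun i => cDb E i d X) (fun i => cD E i d X)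
        (fun r a b c => nabbBUB E (DbE E) r a c b X)
        (fun i j => nabbU E (fun i => cD E i d) i j X))
  rw [ctr2_add, ← e]
  ring

end

/-! ### Analysis on boxes: divergence theorem and differentiation under the integral -/

open MeasureTheory Set in
/-- The integral of a divergence over a box vanishes if opposite faces carry the same flux. -/
lemma integral_sum_fderiv_eq_zero {ι : Type*} [Fintype ι] [DecidableEq ι] (a b : ι → ℝ)
    (hle : a ≤ b) (W : ι → (ι → ℝ) → ℝ) (hW : ∀ m, ContDiff ℝ 1 (W m))
    (hper : ∀ m X, X m = a m → W m (X + Pi.single m (b m - a m)) = W m X) :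
    ∫ X in Icc a b, ∑ m, fderiv ℝ (W m) X (Pi.single m 1) = 0 := by
  rcases isEmpty_or_nonempty ι with hι | hι
  · simp
  obtain ⟨n, hn⟩ : ∃ n, Fintype.card ι = n + 1 :=
    Nat.exists_eq_succ_of_ne_zero Fintype.card_ne_zero
  -- The coordinates are numbered so that the faces of the box can be parametrized by
  -- `Fin.insertNth`.
  let e : ι ≃ Fin (n + 1) := Fintype.equivFinOfCardEq hn
  let eL : (ι → ℝ) ≃L[ℝ] (Fin (n + 1) → ℝ) := ContinuousLinearEquiv.piCongrLeft ℝ (fun _ => ℝ) e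
  have heL : ∀ X k, eL X k = X (e.symm k) := fun X k => by
    obtain ⟨i, rfl⟩ := e.surjective k
    simp only [Equiv.symm_apply_apply]
    exact Equiv.piCongrLeft_apply_apply (fun _ => ℝ) e X i
  have heLs : ∀ Y i, eL.symm Y i = Y (e i) := fun Y i => by
    have := heL (eL.symm Y) (e i)
    simpa using this.symm
  have hcont : ∀ m, Continuous fun X => fderiv ℝ (W m) X (Pi.single m 1) := fun m =>
    ((hW m).continuous_fderiv one_ne_zero).clm_apply continuous_const
  have key := integral_divergence_of_hasFDerivAt_off_countable_of_equiv eL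
    (fun x y => by
      simp only [Pi.le_def, heL]
      exact ⟨fun h i => by simpa using h (e i), fun h k => h _⟩)
    (volume_measurePreserving_piCongrLeft (fun _ => ℝ) e)
    (fun k => W (e.symm k)) (fun k X => fderiv ℝ (W (e.symm k)) X) ∅ countable_empty a b hle
    (fun k => (hW _).continuous.continuousOn)
    (fun X _ k => ((hW _).differentiable one_ne_zero X).hasFDerivAt)
    (fun X => ∑ m, fderiv ℝ (W m) X (Pi.single m 1))
    (fun X => by
      rw [← e.symm.sum_comp]
      refine Finset.sum_congr rfl fun k _ => ?_
      congr 1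
      ext i
      rw [heLs]
      by_cases h : e i = k
      · subst h; simp
      · have : i ≠ e.symm k := fun h' => h (by rw [h']; simp)
        simp [Pi.single_apply, h, this])
    ((continuous_finsetSum _ fun m _ => hcont m).continuousOn.integrableOn_compact isCompact_Icc)
  rw [key]
  refine Finset.sum_eq_zero fun k _ => sub_eq_zero.mpr ?_
  refine integral_congr_ae (Filter.Eventually.of_forall fun Y => ?_)
  simp only []
  -- Corresponding points of opposite faces differ by the edge vector, which is the translation
  -- occurring in `hper`.
  have h1 : eL.symm (k.insertNth (eL b k) Y) = eL.symm (k.insertNth (eL a k) Y) +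
      Pi.single (e.symm k) (b (e.symm k) - a (e.symm k)) := by
    ext i
    rw [Pi.add_apply, heLs, heLs, heL, heL]
    by_cases h : e i = k
    · subst h; simp
    · have h' : i ≠ e.symm k := fun h' => h (by rw [h']; simp)
      obtain ⟨j, hj⟩ := Fin.exists_succAbove_eq h
      rw [← hj]
      simp [Pi.single_apply, h']
  rw [h1]
  exact hper _ _ (by rw [heLs, heL]; simp)

open MeasureTheory Set Metric in
/-- Differentiation under the integral sign over a compact box. -/
lemma hasDerivAt_integral_Icc {ι : Type*} [Fintype ι] (a b : ι → ℝ) {F : ℝ → (ι → ℝ) → ℝ}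
    {F' : (ι → ℝ) → ℝ}
    (hF : ∀ X ∈ Icc a b, ContDiffAt ℝ 1 (fun p : ℝ × (ι → ℝ) => F p.1 p.2) (0, X))
    (hF' : ∀ X ∈ Icc a b, HasDerivAt (fun s => F s X) (F' X) 0) :
    (∀ᶠ s in 𝓝 (0 : ℝ), IntegrableOn (F s) (Icc a b)) ∧
      HasDerivAt (fun s => ∫ X in Icc a b, F s X) (∫ X in Icc a b, F' X) 0 := by
  set f : ℝ × (ι → ℝ) → ℝ := fun p => F p.1 p.2 with hf
  let U : Set (ℝ × (ι → ℝ)) := interior {p | ContDiffAt ℝ 1 f p}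
  have hU : ({0} : Set ℝ) ×ˢ Icc a b ⊆ U := by
    rintro ⟨s, X⟩ ⟨hs, hX⟩
    obtain rfl : s = 0 := hs
    exact mem_interior_iff_mem_nhds.mpr ((hF X hX).eventually (by simp))
  -- Regularity is assumed only at s = 0. Compactness of the box gives one interval of s that works
  -- for all its points, and hence a constant bound on the s-derivative as dominating function.
  obtain ⟨u, v, hu, hv, hsu, htv, huv⟩ := generalized_tube_lemma isCompact_singleton
    (isCompact_Icc (a := a) (b := b)) isOpen_interior hU
  obtain ⟨ε, hε, hεu⟩ := nhds_basis_closedBall.mem_iff.mp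
    (hu.mem_nhds (hsu (mem_singleton (0 : ℝ))))
  have hsm : ∀ s ∈ closedBall (0 : ℝ) ε, ∀ X ∈ Icc a b, ContDiffAt ℝ 1 f (s, X) :=
    fun s hs X hX => interior_subset (huv ⟨hεu hs, htv hX⟩)
  let f' : ℝ × (ι → ℝ) → ℝ := fun p => fderiv ℝ f p (1, 0)
  have hcont : ContinuousOn f' (closedBall (0 : ℝ) ε ×ˢ Icc a b) := by
    rintro ⟨s, X⟩ ⟨hs, hX⟩
    have := ((hsm s hs X hX).fderiv_right (m := 0) (by simp)).continuousAt
    exact (this.clm_apply continuousAt_const).continuousWithinAt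
  obtain ⟨K, hK⟩ := ((isCompact_closedBall (0 : ℝ) ε).prod
    (isCompact_Icc (a := a) (b := b))).exists_bound_of_continuousOn hcont
  have hcF : ∀ s ∈ closedBall (0 : ℝ) ε, ContinuousOn (F s) (Icc a b) := fun s hs X hX =>
    ((hsm s hs X hX).continuousAt.comp (f := fun X => (s, X)) (by fun_prop)).continuousWithinAt
  have hder : ∀ s ∈ closedBall (0 : ℝ) ε, ∀ X ∈ Icc a b,
      HasDerivAt (fun s => F s X) (f' (s, X)) s := by
    intro s hs X hX
    have h1 : HasFDerivAt f (fderiv ℝ f (s, X)) (s, X) :=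
      ((hsm s hs X hX).differentiableAt one_ne_zero).hasFDerivAt
    have h2 : HasDerivAt (fun s : ℝ => (s, X)) ((1 : ℝ), (0 : ι → ℝ)) s :=
      (hasDerivAt_id s).prodMk (hasDerivAt_const s X)
    exact h1.comp_hasDerivAt s h2
  have hmem : ∀ᶠ s in 𝓝 (0 : ℝ), s ∈ closedBall (0 : ℝ) ε := closedBall_mem_nhds 0 hε
  have h0 : (0 : ℝ) ∈ closedBall (0 : ℝ) ε := mem_closedBall_self hε.le
  refine ⟨hmem.mono fun s hs => (hcF s hs).integrableOn_compact isCompact_Icc, ?_⟩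
  have key := (hasDerivAt_integral_of_dominated_loc_of_deriv_le
    (μ := volume.restrict (Icc a b)) (F := F) (x₀ := (0 : ℝ)) (F' := fun s X => f' (s, X))
    (bound := fun _ => K) (s := closedBall (0 : ℝ) ε) (closedBall_mem_nhds 0 hε)
    (hmem.mono fun s hs => (hcF s hs).aestronglyMeasurable measurableSet_Icc)
    ((hcF 0 h0).integrableOn_compact isCompact_Icc)
    ((hcont.comp (f := fun X => ((0 : ℝ), X)) (by fun_prop)
      fun X hX => ⟨h0, hX⟩).aestronglyMeasurable measurableSet_Icc)
    ((ae_restrict_mem measurableSet_Icc).mono fun X hX s hs => hK (s, X) ⟨hs, hX⟩)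
    ((continuousOn_const (c := K)).integrableOn_compact isCompact_Icc)
    ((ae_restrict_mem measurableSet_Icc).mono fun X hX s hs => hder s hs X hX)).2
  refine key.congr_deriv (setIntegral_congr_fun measurableSet_Icc fun X hX => ?_)
  exact (hder 0 h0 X hX).unique (hF' X hX)

/-! Invariance under translations -/

/-- `f` is invariant under translation by `t`. -/
def TransInv {α : Type*} (t : Dbl D) (f : Dbl D → α) : Prop := ∀ X, f (X + t) = f X

section inv
variable {t : Dbl D} {E Δ : MField D} {d f : SField D}

lemma TransInv.pd (hf : TransInv t f) (m : Fin D ⊕ Fin D) : TransInv t (pd m f) := by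
  intro X
  have : (fun Y => f (Y + t)) = f := funext hf
  rw [DFT.pd, ← fderiv_comp_add_right t, this]
  rfl

lemma TransInv.comp (hE : TransInv t E) (i j : Fin D) : TransInv t (fun X => E X i j) :=
  fun X => by simp only [hE X]

lemma TransInv.gUp (hE : TransInv t E) : TransInv t (gUp E) := fun X => by
  simp only [DFT.gUp, gLow, hE X]

lemma TransInv.cD (hE : TransInv t E) (hf : TransInv t f) (i : Fin D) : TransInv t (cD E i f) :=
  fun X => by simp only [DFT.cD, hE X, hf.pd _ X]

lemma TransInv.cDb (hE : TransInv t E) (hf : TransInv t f) (i : Fin D) : TransInv t (cDb E i f) :=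
  fun X => by simp only [DFT.cDb, hE X, hf.pd _ X]

lemma TransInv.DE (hE : TransInv t E) (i j k : Fin D) : TransInv t (DE E i j k) :=
  hE.cD (hE.comp j k) i

lemma TransInv.DbE (hE : TransInv t E) (i j k : Fin D) : TransInv t (DbE E i j k) :=
  hE.cDb (hE.comp j k) i

lemma TransInv.CE (hE : TransInv t E) (i j k : Fin D) : TransInv t (CE E i j k) :=
  hE.DbE i k j

lemma TransInv.KLow (hE : TransInv t E) (hd : TransInv t d) : TransInv t (KLow E d) := by
  intro X
  ext p q
  simp only [KLow_eq, kHalfU, kHalfB, nabUUB_eq, nabbBUB_eq, nabB_eq, nabbU_eq,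
    hE.gUp X, hE.DE _ _ _ X, hE.CE _ _ _ X, hE.cD (hE.DE _ _ _) _ X, hE.cDb (hE.DbE _ _ _) _ X,
    hE.cD (hE.cDb hd _) _ X, hE.cDb (hE.cD hd _) _ X, hE.cD hd _ X, hE.cDb hd _ X,
    hE.DbE _ _ _ X]

lemma TransInv.KUp (hE : TransInv t E) (hd : TransInv t d) : TransInv t (KUp E d) := by
  intro X
  ext p q
  simp only [DFT.KUp, Matrix.of_apply, hE.KLow hd X, hE.gUp X]

lemma TransInv.bdry (hE : TransInv t E) (hd : TransInv t d) (hΔ : TransInv t Δ)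
    (m : Fin D ⊕ Fin D) : TransInv t (bdry E d Δ m) := by
  intro X
  rcases m with k | i <;>
  simp only [DFT.bdry, Sum.elim_inl, Sum.elim_inr, fluxU, fluxB, hE X, hd X, hΔ X, hE.gUp X,
    hE.DE _ _ _ X, hE.CE _ _ _ X, hE.cD hd _ X, hE.cDb hd _ X]

end inv

/-- The translations that leave `f` invariant. -/
def invSubgroup {α : Type*} (f : Dbl D → α) : AddSubgroup (Dbl D) where
  carrier := {t | TransInv t f}
  zero_mem' X := by simp
  add_mem' {a b} ha hb X := by rw [← add_assoc, hb, ha]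
  neg_mem' {a} ha X := by rw [← ha (X + -a), neg_add_cancel_right]

/-- A representative of `X` in the fundamental domain. -/
lemma exists_mem_cell (ℓ : Fin D ⊕ Fin D → ℝ) (X : Dbl D) :
    ∃ Y ∈ cell ℓ, (∀ m, ℓ m ≤ 0 → Y m = X m) ∧
      ∀ {α : Type} (f : Dbl D → α), HasPeriods ℓ f → f Y = f X := by
  classical
  let z : Fin D ⊕ Fin D → ℤ := fun m => if 0 < ℓ m then ⌊X m / ℓ m⌋ else 0
  let t : Dbl D := fun m => -((z m : ℝ) * ℓ m)
  have htsum : t = - ∑ m, z m • Pi.single m (ℓ m) := by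
    rw [← Finset.univ_sum_single t, ← Finset.sum_neg_distrib]
    refine Finset.sum_congr rfl fun m _ => ?_
    rw [← Pi.single_smul, ← Pi.single_neg, zsmul_eq_mul]
  have ht : ∀ m, t m = -((z m : ℝ) * ℓ m) := fun m => rfl
  refine ⟨X + t, fun m hm => ?_, fun m hm => ?_, fun f hf => ?_⟩
  · rw [Pi.add_apply, ht, show z m = ⌊X m / ℓ m⌋ from if_pos hm]
    have h1 := Int.floor_le (X m / ℓ m)
    have h2 := Int.lt_floor_add_one (X m / ℓ m)
    rw [le_div_iff₀ hm] at h1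
    rw [div_lt_iff₀ hm] at h2
    constructor <;> linarith
  · rw [Pi.add_apply, ht, show z m = 0 from if_neg (not_lt.mpr hm)]
    simp
  · have : t ∈ invSubgroup f := htsum ▸
      neg_mem (sum_mem fun m _ => zsmul_mem (show TransInv _ f from hf m) _)
    exact this X

/-! Smoothness of `𝒦` -/

section smooth
variable {E : MField D} {d : SField D}

lemma contDiff_nab3 {G : Dbl D → Matrix (Fin D) (Fin D) ℝ}
    {A C T : Dbl D → Fin D → Fin D → Fin D → ℝ} {dT : Dbl D → Fin D → Fin D → Fin D → Fin D → ℝ}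
    (hG : ∀ i j, ContDiff ℝ ∞ (fun x => G x i j)) (hA : ∀ i j k, ContDiff ℝ ∞ (fun x => A x i j k))
    (hC : ∀ i j k, ContDiff ℝ ∞ (fun x => C x i j k))
    (hT : ∀ i j k, ContDiff ℝ ∞ (fun x => T x i j k))
    (hdT : ∀ r i j k, ContDiff ℝ ∞ (fun x => dT x r i j k)) (r a b c : Fin D) :
    ContDiff ℝ ∞ (fun x => nab3 (G x) (A x) (C x) (dT x) (T x) r a b c) := by
  refine (((hdT r a b c).sub (contDiff_ctr hG fun l m => ?_)).sub
    (contDiff_ctr hG fun l m => ?_)).sub (contDiff_ctr hG fun l m => ?_)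
  · exact (contDiff_const.mul (hA _ _ _)).mul (hT _ _ _)
  · exact (contDiff_const.mul (hA _ _ _)).mul (hT _ _ _)
  · exact (contDiff_const.mul (((hA _ _ _).add (hC _ _ _)).sub (hC _ _ _))).mul (hT _ _ _)

lemma contDiff_nab1 {G : Dbl D → Matrix (Fin D) (Fin D) ℝ}
    {A C : Dbl D → Fin D → Fin D → Fin D → ℝ} {v : Dbl D → Fin D → ℝ}
    {dv : Dbl D → Fin D → Fin D → ℝ}
    (hG : ∀ i j, ContDiff ℝ ∞ (fun x => G x i j)) (hA : ∀ i j k, ContDiff ℝ ∞ (fun x => A x i j k))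
    (hC : ∀ i j k, ContDiff ℝ ∞ (fun x => C x i j k)) (hv : ∀ i, ContDiff ℝ ∞ (fun x => v x i))
    (hdv : ∀ r i, ContDiff ℝ ∞ (fun x => dv x r i)) (r c : Fin D) :
    ContDiff ℝ ∞ (fun x => nab1 (G x) (A x) (C x) (dv x) (v x) r c) :=
  (hdv r c).sub (contDiff_ctr hG fun _ _ =>
    (contDiff_const.mul (((hA _ _ _).add (hC _ _ _)).sub (hC _ _ _))).mul (hv _))

lemma contDiff_khalf {G : Dbl D → Matrix (Fin D) (Fin D) ℝ}
    {A C : Dbl D → Fin D → Fin D → Fin D → ℝ} {nA : Dbl D → Fin D → Fin D → Fin D → Fin D → ℝ}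
    {nv : Dbl D → Fin D → Fin D → ℝ}
    (hG : ∀ i j, ContDiff ℝ ∞ (fun x => G x i j)) (hA : ∀ i j k, ContDiff ℝ ∞ (fun x => A x i j k))
    (hC : ∀ i j k, ContDiff ℝ ∞ (fun x => C x i j k))
    (hnA : ∀ r i j k, ContDiff ℝ ∞ (fun x => nA x r i j k))
    (hnv : ∀ r i, ContDiff ℝ ∞ (fun x => nv x r i)) (p q : Fin D) :
    ContDiff ℝ ∞ (fun x => khalf (G x) (A x) (C x) (nA x) (nv x) p q) := by
  have h2 : ∀ f : Dbl D → Fin D → Fin D → Fin D → Fin D → ℝ,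
      (∀ i j k l, ContDiff ℝ ∞ (fun x => f x i j k l)) →
      ContDiff ℝ ∞ (fun x => ctr (G x) fun i j => ctr (G x) fun k l => f x i j k l) :=
    fun f hf => contDiff_ctr hG fun i j => contDiff_ctr hG fun k l => hf i j k l
  have hc := fun c : ℝ => contDiff_const (𝕜 := ℝ) (E := Dbl D) (n := ∞) (c := c)
  refine ((((((((hc _).mul (contDiff_ctr hG fun _ _ => hnA _ _ _ _)).sub
    ((hc _).mul (contDiff_ctr hG fun _ _ => hnA _ _ _ _))).sub (hnv p q)).add
    ((hc _).mul (h2 _ fun _ _ _ _ => ?_))).add ((hc _).mul (h2 _ fun _ _ _ _ => ?_))).sub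
    ((hc _).mul (h2 _ fun _ _ _ _ => ?_))).sub ((hc _).mul (h2 _ fun _ _ _ _ => ?_))).sub
    ((hc _).mul (h2 _ fun _ _ _ _ => ?_))
  · exact (hA _ _ _).mul (hC _ _ _)
  · exact (hA _ _ _).mul (hC _ _ _)
  all_goals exact (hC _ _ _).mul (hA _ _ _)

lemma IsBackground.contDiff_KLow (h : IsBackground E d) (p q : Fin D) :
    ContDiff ℝ ∞ fun X => KLow E d X p q := by
  have hC : ∀ i j k, ContDiff ℝ ∞ (CE E i j k) := fun i j k => h.contDiff_DbE i k j
  simp only [KLow_eq, kHalfU, kHalfB, nabUUB_eq, nabbBUB_eq, nabB_eq, nabbU_eq]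
  refine (contDiff_khalf h.contDiff_gUp h.contDiff_DE hC
    (contDiff_nab3 h.contDiff_gUp h.contDiff_DE hC h.contDiff_DE
      fun r i j k => h.contDiff_cD (h.contDiff_DE i j k) r)
    (contDiff_nab1 h.contDiff_gUp h.contDiff_DE hC (h.contDiff_cDb h.smooth_d)
      fun r i => h.contDiff_cD (h.contDiff_cDb h.smooth_d i) r) p q).add
    (contDiff_khalf h.contDiff_gUp hC h.contDiff_DE
    (contDiff_nab3 h.contDiff_gUp hC h.contDiff_DE (fun i j k => h.contDiff_DbE i k j)
      fun r i j k => h.contDiff_cDb (h.contDiff_DbE i k j) r)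
    (contDiff_nab1 h.contDiff_gUp hC h.contDiff_DE (h.contDiff_cD h.smooth_d)
      fun r i => h.contDiff_cDb (h.contDiff_cD h.smooth_d i) r) q p)

lemma IsBackground.contDiff_KUp (h : IsBackground E d) (p q : Fin D) :
    ContDiff ℝ ∞ fun X => KUp E d X p q := by
  simp only [KUp, Matrix.of_apply]
  exact ContDiff.sum fun k _ => ContDiff.sum fun l _ =>
    ((h.contDiff_gUp p k).mul (h.contDiff_gUp q l)).mul (h.contDiff_KLow k l)

end smooth

/-! Locality -/

/-- Both brackets see ℰ only through its value and its first derivatives at the point. -/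
lemma lag_congr {E E' : MField D} {X : Dbl D} (h : E =ᶠ[𝓝 X] E') (d : SField D) :
    lag E d X = lag E' d X ∧ lagSym E d X = lagSym E' d X := by
  have hX : E X = E' X := h.eq_of_nhds
  have h1 : ∀ i j m, pd m (fun Y => E Y i j) X = pd m (fun Y => E' Y i j) X := by
    intro i j m
    have : (fun Y => E Y i j) =ᶠ[𝓝 X] fun Y => E' Y i j := h.mono fun Y hY => by simp only [hY]
    simp only [pd, this.fderiv_eq]
  have hg : gUp E X = gUp E' X := by simp only [gUp, gLow, hX]
  constructor <;>
  simp only [lag, lagSym, DEUp, DbEUp, cDUp, cDbUp, DE, DbE, cD, cDb, h1, hX, hg]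

/-! ### From the pointwise identity to the variation of the action -/

section assembly
variable {E Δ : MField D} {d : SField D} {ℓ : Fin D ⊕ Fin D → ℝ}

/-- The support is bounded only inside the fundamental domain. Moving a point there by periods
leaves its line coordinates unchanged, so the bound on these coordinates holds on the whole doubled
space. -/
lemma IsVariation.exists_bound (hΔ : IsVariation ℓ Δ) :
    ∃ R, 0 ≤ R ∧ ∀ X m, ℓ m ≤ 0 → R < |X m| → Δ X = 0 := by
  obtain ⟨R, hR⟩ := hΔ.bounded_support.exists_norm_le
  refine ⟨max R 0, le_max_right _ _, fun X m hm hX => ?_⟩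
  obtain ⟨Y, hY, hYX, hYf⟩ := exists_mem_cell ℓ X
  rw [← hYf Δ hΔ.periodic]
  by_contra hne
  have h1 := (norm_le_pi_norm Y m).trans (hR Y ⟨hY, hne⟩)
  rw [hYX m hm, Real.norm_eq_abs] at h1
  exact absurd (hX.trans_le h1) (not_lt.mpr (le_max_left _ _))

open MeasureTheory Set in
lemma measurableSet_cell : MeasurableSet (cell ℓ) := by
  have : cell ℓ = ⋂ m, {X : Dbl D | 0 < ℓ m → X m ∈ Ico 0 (ℓ m)} := by
    ext X; simp [cell]
  rw [this]
  refine MeasurableSet.iInter fun m => ?_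
  by_cases hm : 0 < ℓ m
  · simp only [hm, true_imp_iff]
    exact measurableSet_Ico.preimage (measurable_pi_apply m)
  · simp [hm]

/-- Lower corner of a box that represents the space of integration up to distance `R`. -/
def boxLow (ℓ : Fin D ⊕ Fin D → ℝ) (R : ℝ) : Dbl D := fun m => if 0 < ℓ m then 0 else -(R + 1)

/-- Upper corner of a box that represents the space of integration up to distance `R`. -/
def boxUp (ℓ : Fin D ⊕ Fin D → ℝ) (R : ℝ) : Dbl D := fun m => if 0 < ℓ m then ℓ m else R + 1

lemma boxLow_le_boxUp {R : ℝ} (hR : 0 ≤ R) : boxLow ℓ R ≤ boxUp ℓ R := fun m => by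
  simp only [boxLow, boxUp]
  split_ifs with h
  · exact h.le
  · linarith

open MeasureTheory Set in
-- The half-open version of the box lies in the fundamental domain, f vanishes on the rest of the
-- domain, and the half-open and closed boxes differ by a null set.
lemma cell_box {R : ℝ} {f : SField D}
    (hf : ∀ X m, ℓ m ≤ 0 → R < |X m| → f X = 0) :
    ∫ X in cell ℓ, f X = ∫ X in Icc (boxLow ℓ R) (boxUp ℓ R), f X ∧
    (IntegrableOn f (Icc (boxLow ℓ R) (boxUp ℓ R)) → IntegrableOn f (cell ℓ)) := by
  set C : Set (Dbl D) := Set.pi univ fun m => Ico (boxLow ℓ R m) (boxUp ℓ R m) with hC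
  have hsub : C ⊆ cell ℓ := fun X hX m hm => by
    simpa [boxLow, boxUp, hm] using hX m (mem_univ m)
  have hzero : ∀ X ∈ cell ℓ \ C, f X = 0 := by
    rintro X ⟨hX, hXC⟩
    simp only [hC, mem_univ_pi, not_forall] at hXC
    obtain ⟨m, hm⟩ := hXC
    have hl : ¬ 0 < ℓ m := fun h => hm (by simpa [boxLow, boxUp, h] using hX m h)
    refine hf X m (not_lt.mp hl) ?_
    by_contra hle
    rw [not_lt, abs_le] at hle
    apply hm
    simp only [boxLow, boxUp, hl, if_false, mem_Ico]
    constructor <;> linarith [hle.1, hle.2]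
  have hae : C =ᵐ[volume] Icc (boxLow ℓ R) (boxUp ℓ R) := Measure.univ_pi_Ico_ae_eq_Icc
  constructor
  · rw [← setIntegral_congr_set hae,
      setIntegral_eq_of_subset_of_forall_sdiff_eq_zero measurableSet_cell hsub hzero]
  · intro h
    exact (h.congr_set_ae hae).of_forall_sdiff_eq_zero measurableSet_cell hzero

open MeasureTheory Set in
lemma setIntegral_cell_sum_pd_eq_zero {R : ℝ} (hR : 0 ≤ R) {W : Fin D ⊕ Fin D → SField D}
    (hW : ∀ m, ContDiff ℝ ∞ (W m)) (hW0 : ∀ k X m, ℓ m ≤ 0 → R < |X m| → W k X = 0)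
    (hper : ∀ m, HasPeriods ℓ (W m)) :
    ∫ X in Icc (boxLow ℓ R) (boxUp ℓ R), ∑ m, pd m (W m) X = 0 := by
  refine integral_sum_fderiv_eq_zero _ _ (boxLow_le_boxUp hR) W
    (fun m => (hW m).of_le (by simp)) fun m X hX => ?_
  by_cases hm : 0 < ℓ m
  · simp only [boxLow, boxUp, hm, if_true, sub_zero]
    exact hper m m X
  -- In a line direction both faces lie at distance R + 1 from the origin, beyond the support, so
  -- the flux through each is zero.
  · rw [hW0 m _ m (not_lt.mp hm), hW0 m X m (not_lt.mp hm)]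
    · rw [hX, boxLow, if_neg hm, abs_neg, abs_of_pos] <;> linarith
    · simp only [Pi.add_apply, hX, Pi.single_eq_same, boxLow, boxUp, hm, if_false]
      rw [abs_of_pos] <;> linarith

open MeasureTheory Set in
/-- A first variation that is `variationDensity` up to a divergence gives the variation of the
action. -/
lemma hasActionVariation_of {L : MField D → SField D → SField D} (h : IsBackground E d)
    (hΔ : IsVariation ℓ Δ)
    (hloc : ∀ E' X, E =ᶠ[𝓝 X] E' → L E d X = L E' d X)
    (hsm : ∀ X, ContDiffAt ℝ 1 (fun p : ℝ × Dbl D => L (shift E Δ p.1) d p.2) (0, X))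
    {dL : SField D} (hdL : ∀ X, HasDerivAt (fun s => L (shift E Δ s) d X) (dL X) 0)
    {W : Fin D ⊕ Fin D → SField D} (hW : ∀ m, ContDiff ℝ ∞ (W m))
    (hW0 : ∀ m X, Δ X = 0 → W m X = 0) (hper : ∀ m, HasPeriods ℓ (W m))
    (heq : ∀ X, Real.exp (-2 * d X) * dL X = variationDensity E d Δ X + ∑ m, pd m (W m) X) :
    IntegrableOn (variationDensity E d Δ) (cell ℓ) ∧
    HasActionVariation L ℓ E d Δ (∫ X in cell ℓ, variationDensity E d Δ X) := by
  obtain ⟨R, hR, hΔR⟩ := hΔ.exists_bound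
  have hv0 : ∀ X m, ℓ m ≤ 0 → R < |X m| → variationDensity E d Δ X = 0 := by
    intro X m hm hX
    simp [variationDensity, hΔR X m hm hX]
  have hcv : Continuous (variationDensity E d Δ) := by
    refine (contDiff_exp_dil h).continuous.mul (continuous_finsetSum _ fun p _ =>
      continuous_finsetSum _ fun q _ => (hΔ.smooth p q).continuous.mul (h.contDiff_KUp p q).continuous)
  have hF0 : ∀ s X m, ℓ m ≤ 0 → R < |X m| → actionDiffDensity L E d Δ s X = 0 := by
    intro s X m hm hX
    -- Equality at X alone would not be enough, since the bracket involves derivatives; the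
    -- condition on X m is open.
    have : E =ᶠ[𝓝 X] shift E Δ s := by
      have ho : {Y : Dbl D | R < |Y m|} ∈ 𝓝 X :=
        (isOpen_lt continuous_const (continuous_apply m).abs).mem_nhds hX
      filter_upwards [ho] with Y hY
      rw [shift, hΔR Y m hm hY, smul_zero, add_zero]
    have := hloc _ X this
    simp only [actionDiffDensity]
    rw [sub_eq_zero]
    exact congrArg _ this.symm
  have hF : ∀ X ∈ Icc (boxLow ℓ R) (boxUp ℓ R), ContDiffAt ℝ 1
      (fun p : ℝ × Dbl D => actionDiffDensity L E d Δ p.1 p.2) (0, X) := by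
    intro X _
    have he : ContDiff ℝ 1 (fun p : ℝ × Dbl D => Real.exp (-2 * d p.2)) :=
      ((contDiff_exp_dil h).of_le (by simp)).comp contDiff_snd
    have h0 : ContDiffAt ℝ 1 (fun p : ℝ × Dbl D => L E d p.2) (0, X) := by
      have := (hsm X).comp (x := ((0 : ℝ), X)) (f := fun p : ℝ × Dbl D => ((0 : ℝ), p.2))
        (contDiffAt_const.prodMk contDiffAt_snd)
      simpa [Function.comp_def, shift_zero] using this
    exact (he.contDiffAt.mul (hsm X)).sub (he.contDiffAt.mul h0)
  have hF' : ∀ X ∈ Icc (boxLow ℓ R) (boxUp ℓ R),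
      HasDerivAt (fun s => actionDiffDensity L E d Δ s X) (Real.exp (-2 * d X) * dL X) 0 :=
    fun X _ => ((hdL X).const_mul _).sub_const _
  obtain ⟨k1, k2⟩ := hasDerivAt_integral_Icc _ _ hF hF'
  have hiv : IntegrableOn (variationDensity E d Δ) (Icc (boxLow ℓ R) (boxUp ℓ R)) :=
    hcv.continuousOn.integrableOn_compact isCompact_Icc
  refine ⟨(cell_box hv0).2 hiv, k1.mono fun s hs => (cell_box (hF0 s)).2 hs, ?_⟩
  have e1 : (fun s => ∫ X in cell ℓ, actionDiffDensity L E d Δ s X) =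
      fun s => ∫ X in Icc (boxLow ℓ R) (boxUp ℓ R), actionDiffDensity L E d Δ s X :=
    funext fun s => (cell_box (hF0 s)).1
  rw [e1, (cell_box hv0).1]
  refine k2.congr_deriv ?_
  simp only [heq]
  rw [integral_add hiv, setIntegral_cell_sum_pd_eq_zero hR hW
    (fun k X m hm hX => hW0 k X (hΔR X m hm hX)) hper, add_zero]
  exact (continuous_finsetSum _ fun m _ =>
    (contDiff_pd (hW m) m).continuous).continuousOn.integrableOn_compact isCompact_Icc

end assembly

section
variable {E Δ : MField D} {d : SField D} {ℓ : Fin D ⊕ Fin D → ℝ}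

lemma contDiff_cD_shift {f g : SField D} (h : IsBackground E d)
    (hΔ : ∀ i j, ContDiff ℝ ∞ (fun X => Δ X i j)) (hf : ContDiff ℝ ∞ f) (hg : ContDiff ℝ ∞ g)
    (i : Fin D) :
    ContDiff ℝ ∞ (fun p : ℝ × Dbl D =>
      cD (shift E Δ p.1) i (fun Y => f Y + p.1 * g Y) p.2) ∧
    ContDiff ℝ ∞ (fun p : ℝ × Dbl D =>
      cDb (shift E Δ p.1) i (fun Y => f Y + p.1 * g Y) p.2) := by
  have hp : ∀ m, ContDiff ℝ ∞ (fun p : ℝ × Dbl D => pd m f p.2 + p.1 * pd m g p.2) := fun m =>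
    ((contDiff_pd hf m).comp contDiff_snd).add
      (contDiff_fst.mul ((contDiff_pd hg m).comp contDiff_snd))
  have hE : ∀ j k, ContDiff ℝ ∞ (fun p : ℝ × Dbl D => E p.2 j k + p.1 * Δ p.2 j k) := fun j k =>
    ((h.smooth_E j k).comp contDiff_snd).add (contDiff_fst.mul ((hΔ j k).comp contDiff_snd))
  simp only [cD, cDb, pd_add_mul (differentiableAt_of_smooth hf _)
    (differentiableAt_of_smooth hg _), shift, Matrix.add_apply, Matrix.smul_apply, smul_eq_mul]
  exact ⟨(hp _).sub (ContDiff.sum fun k _ => (hE _ _).mul (hp _)),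
    (hp _).add (ContDiff.sum fun k _ => (hE _ _).mul (hp _))⟩

/-- Joint regularity in s and X is what the differentiation under the integral uses. It is claimed
only at s = 0, because the shifted metric may degenerate for larger s. -/
lemma contDiffAt_lag_shift (h : IsBackground E d) (hΔ : ∀ i j, ContDiff ℝ ∞ (fun X => Δ X i j))
    (X : Dbl D) :
    ContDiffAt ℝ 1 (fun p : ℝ × Dbl D => lag (shift E Δ p.1) d p.2) (0, X) ∧
    ContDiffAt ℝ 1 (fun p : ℝ × Dbl D => lagSym (shift E Δ p.1) d p.2) (0, X) := by
  have hle : (1 : WithTop ℕ∞) ≤ ∞ := by simp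
  have hG : ∀ i j, ContDiffAt ℝ 1 (fun p : ℝ × Dbl D => gUp (shift E Δ p.1) p.2 i j) (0, X) := by
    refine contDiffAt_inv (fun i j => ?_) (by simpa [shift_zero] using h.nondeg X)
    simp only [gLow_shift, Matrix.add_apply, Matrix.smul_apply, smul_eq_mul]
    have h1 : ContDiff ℝ ∞ (fun Y => gLow Δ Y i j) := by
      simp only [gLow, Matrix.smul_apply, Matrix.add_apply, Matrix.transpose_apply]
      exact ((hΔ i j).add (hΔ j i)).const_smul _
    exact ((((h.contDiff_gLow i j).comp contDiff_snd).add
      (contDiff_fst.mul (h1.comp contDiff_snd))).of_le hle).contDiffAt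
  have hA : ∀ i j k, ContDiffAt ℝ 1 (fun p : ℝ × Dbl D => DE (shift E Δ p.1) i j k p.2) (0, X) :=
    fun i j k => ((contDiff_cD_shift h hΔ (h.smooth_E j k) (hΔ j k) i).1.of_le hle).contDiffAt
  have hB : ∀ i j k, ContDiffAt ℝ 1 (fun p : ℝ × Dbl D => DbE (shift E Δ p.1) i j k p.2) (0, X) :=
    fun i j k => ((contDiff_cD_shift h hΔ (h.smooth_E j k) (hΔ j k) i).2.of_le hle).contDiffAt
  have h0 : ∀ i, _ := contDiff_cD_shift h hΔ h.smooth_d (contDiff_const (c := (0 : ℝ)))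
  simp only [mul_zero, add_zero] at h0
  have hu : ∀ i, ContDiffAt ℝ 1 (fun p : ℝ × Dbl D => cD (shift E Δ p.1) i d p.2) (0, X) :=
    fun i => ((h0 i).1.of_le hle).contDiffAt
  have hv : ∀ i, ContDiffAt ℝ 1 (fun p : ℝ × Dbl D => cDb (shift E Δ p.1) i d p.2) (0, X) :=
    fun i => ((h0 i).2.of_le hle).contDiffAt
  have hA' : ∀ i j k, ContDiffAt ℝ 1
      (fun p : ℝ × Dbl D => DEUp (shift E Δ p.1) i j k p.2) (0, X) :=
    fun i j k => by
      simp only [DEUp, cDUp]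
      exact ContDiffAt.sum fun s _ => (hG i s).mul (hA s j k)
  have hB' : ∀ i j k, ContDiffAt ℝ 1
      (fun p : ℝ × Dbl D => DbEUp (shift E Δ p.1) i j k p.2) (0, X) :=
    fun i j k => by
      simp only [DbEUp, cDbUp]
      exact ContDiffAt.sum fun s _ => (hG i s).mul (hB s j k)
  have hu' : ∀ i, ContDiffAt ℝ 1 (fun p : ℝ × Dbl D => cDUp (shift E Δ p.1) i d p.2) (0, X) :=
    fun i => ContDiffAt.sum fun s _ => (hG i s).mul (hu s)
  have hv' : ∀ i, ContDiffAt ℝ 1 (fun p : ℝ × Dbl D => cDbUp (shift E Δ p.1) i d p.2) (0, X) :=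
    fun i => ContDiffAt.sum fun s _ => (hG i s).mul (hv s)
  have hc := fun c : ℝ => contDiffAt_const (𝕜 := ℝ) (E := ℝ × Dbl D) (n := 1) (x := (0, X)) (c := c)
  have h2 : ContDiffAt ℝ 1 (fun p : ℝ × Dbl D => ∑ i, ∑ j, ∑ k, ∑ l, gUp (shift E Δ p.1) p.2 k l *
      (DEUp (shift E Δ p.1) j i k p.2 * DEUp (shift E Δ p.1) i j l p.2 +
        DbEUp (shift E Δ p.1) j k i p.2 * DbEUp (shift E Δ p.1) i l j p.2)) (0, X) :=
    ContDiffAt.sum fun i _ => ContDiffAt.sum fun j _ => ContDiffAt.sum fun k _ =>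
    ContDiffAt.sum fun l _ => (hG _ _).mul (((hA' _ _ _).mul (hA' _ _ _)).add
      ((hB' _ _ _).mul (hB' _ _ _)))
  have h3 : ContDiffAt ℝ 1 (fun p : ℝ × Dbl D => ∑ i, ∑ j,
      (cDUp (shift E Δ p.1) i d p.2 * DbEUp (shift E Δ p.1) j i j p.2 +
        cDbUp (shift E Δ p.1) i d p.2 * DEUp (shift E Δ p.1) j j i p.2)) (0, X) :=
    ContDiffAt.sum fun i _ => ContDiffAt.sum fun j _ => ((hu' _).mul (hB' _ _ _)).add
      ((hv' _).mul (hA' _ _ _))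
  constructor
  · refine ((((hc _).mul (ContDiffAt.sum fun i _ => ContDiffAt.sum fun j _ =>
      ContDiffAt.sum fun k _ => ContDiffAt.sum fun l _ => ContDiffAt.sum fun p _ => ?_)).add
      ((hc _).mul h2)).add h3).add ((hc _).mul (ContDiffAt.sum fun i _ => (hu' i).mul (hu i)))
    exact (((hG _ _).mul (hG _ _)).mul (hA' _ _ _)).mul (hA _ _ _)
  · refine ((((hc _).mul (ContDiffAt.sum fun i _ => ContDiffAt.sum fun j _ =>
      ContDiffAt.sum fun k _ => ContDiffAt.sum fun l _ => ContDiffAt.sum fun p _ => ?_)).add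
      ((hc _).mul h2)).add h3).add ((hc _).mul (ContDiffAt.sum fun i _ =>
        ((hu' i).mul (hu i)).add ((hv' i).mul (hv i))))
    exact ((hG _ _).mul (hG _ _)).mul (((hc _).mul ((hA' _ _ _).mul (hA _ _ _))).add
      ((hc _).mul ((hB' _ _ _).mul (hB _ _ _))))

lemma bdry_eq_zero {X : Dbl D} (h : Δ X = 0) (m : Fin D ⊕ Fin D) : bdry E d Δ m X = 0 := by
  rcases m with k | i <;> simp [bdry, fluxU, fluxB, flux, ctr, h]

/-- The variation of the symmetrized action, without the strong constraint. -/
lemma hasActionVariation_lagSym (h : IsBackground E d) (hE : HasPeriods ℓ E)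
    (hd : HasPeriods ℓ d) (hΔ : IsVariation ℓ Δ) :
    MeasureTheory.IntegrableOn (variationDensity E d Δ) (cell ℓ) ∧
    HasActionVariation lagSym ℓ E d Δ (∫ X in cell ℓ, variationDensity E d Δ X) := by
  refine hasActionVariation_of h hΔ (fun E' X he => (lag_congr he d).2)
    (fun X => (contDiffAt_lag_shift h hΔ.smooth X).2)
    (fun X => lagSym_hasDerivAt (h.nondeg X)
      (fun i j => differentiableAt_of_smooth (h.smooth_E i j) X)
      (differentiableAt_of_smooth h.smooth_d X)
      (fun i j => differentiableAt_of_smooth (hΔ.smooth i j) X))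
    (contDiff_bdry h hΔ.smooth) (fun m X hX => bdry_eq_zero hX m)
    (fun m k => ?_) (lagSymVar_eq h hΔ.smooth)
  exact TransInv.bdry (hE k) (hd k) (hΔ.periodic k) m

end

/-! The `O(D,D)` invariant pairing of gradients -/

/-- `∂^M f ∂_M f'`. -/
def etaPair (f f' : SField D) : SField D := fun X => ∑ m, pd m f X * pd m.swap f' X

/-- The gradient of `f` with its index raised by `η`. -/
def etaVec (f : SField D) (X : Dbl D) : Dbl D := fun m => pd m.swap f X

lemma sum_swap (F : Fin D ⊕ Fin D → ℝ) : ∑ m : Fin D ⊕ Fin D, F m.swap = ∑ m, F m :=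
  Fintype.sum_equiv (Equiv.sumComm _ _) _ _ fun _ => rfl

lemma etaPair_comm (f f' : SField D) (X : Dbl D) : etaPair f f' X = etaPair f' f X := by
  rw [etaPair, ← sum_swap]
  simp only [Sum.swap_swap, etaPair]
  exact Finset.sum_congr rfl fun m _ => mul_comm _ _

lemma etaPair_eq_fderiv (f f' : SField D) (X : Dbl D) :
    etaPair f f' X = fderiv ℝ f X (etaVec f' X) := by
  conv_rhs => rw [← Finset.univ_sum_single (etaVec f' X), map_sum]
  refine Finset.sum_congr rfl fun m _ => ?_
  have : Pi.single m (etaVec f' X m) = etaVec f' X m • (Pi.single m 1 : Dbl D) := by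
    rw [← Pi.single_smul, smul_eq_mul, mul_one]
  rw [this, map_smul, smul_eq_mul, mul_comm]
  rfl

lemma etaPair_mul {f g : SField D} {X : Dbl D} (hf : DifferentiableAt ℝ f X)
    (hg : DifferentiableAt ℝ g X) (f' : SField D) :
    etaPair (fun Y => f Y * g Y) f' X = etaPair f f' X * g X + f X * etaPair g f' X := by
  simp only [etaPair, Finset.sum_mul, Finset.mul_sum, ← Finset.sum_add_distrib, pd_mul hf hg]
  exact Finset.sum_congr rfl fun m _ => by ring

lemma pd_comm {f : SField D} (hf : ContDiff ℝ ∞ f) (m n : Fin D ⊕ Fin D) (X : Dbl D) :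
    pd m (pd n f) X = pd n (pd m f) X := by
  have hd : DifferentiableAt ℝ (fderiv ℝ f) X :=
    ((hf.fderiv_right (m := ∞) le_rfl).differentiable (by simp)) X
  have h2 : ∀ a b, pd a (pd b f) X =
      fderiv ℝ (fderiv ℝ f) X (Pi.single a 1) (Pi.single b 1) := by
    intro a b
    have : pd b f = fun Y => fderiv ℝ f Y (Pi.single b 1) := rfl
    rw [this, pd, fderiv_clm_apply hd (differentiableAt_const _)]
    simp
  rw [h2, h2]
  exact (hf.contDiffAt.isSymmSndFDerivAt (by
    rw [minSmoothness_of_isRCLikeNormedField]; exact WithTop.coe_le_coe.2 (show (2 : ℕ∞) ≤ ⊤ from le_top))).eq _ _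

lemma box_eq {f : SField D} (hf : ContDiff ℝ ∞ f) (X : Dbl D) :
    box f X = ∑ m : Fin D ⊕ Fin D, pd m (pd m.swap f) X := by
  rw [box, Fintype.sum_sum_type, two_mul]
  congr 1
  exact Finset.sum_congr rfl fun i _ => pd_comm hf _ _ X

lemma box_mul {f g : SField D} (hf : ContDiff ℝ ∞ f) (hg : ContDiff ℝ ∞ g) (X : Dbl D) :
    box (fun Y => f Y * g Y) X = box f X * g X + f X * box g X + 2 * etaPair f g X := by
  have df := differentiableAt_of_smooth hf
  have dg := differentiableAt_of_smooth hg
  have e : ∀ m, pd m (fun Y => f Y * g Y) = fun Y => pd m f Y * g Y + f Y * pd m g Y :=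
    fun m => funext fun Y => pd_mul (df Y) (dg Y) m
  have p := fun m => differentiableAt_of_smooth (contDiff_pd hf m) X
  have q := fun m => differentiableAt_of_smooth (contDiff_pd hg m) X
  rw [box_eq (hf.mul hg), box_eq hf, box_eq hg, two_mul]
  nth_rw 2 [etaPair_comm]
  simp only [e, etaPair, Finset.sum_mul, Finset.mul_sum, ← Finset.sum_add_distrib]
  refine Finset.sum_congr rfl fun m _ => ?_
  rw [pd_add ((p _).fun_mul (dg X)) ((df X).fun_mul (q _)), pd_mul (p _) (dg X),
    pd_mul (df X) (q _)]
  ring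

/-- The product rule `box_mul` isolates the pairing of gradients as the difference between the
constraint on a product and the constraints on its factors. -/
lemma StrongConstraint.etaPair_eq_zero {E : MField D} {d : SField D} (h : IsBackground E d)
    (hs : StrongConstraint E d) {f f' : SField D} (hf : f ∈ components E d)
    (hf' : f' ∈ components E d) (X : Dbl D) : etaPair f f' X = 0 := by
  have sm : ∀ g ∈ components E d, ContDiff ℝ ∞ g := by
    rintro g (rfl | ⟨i, j, rfl⟩)
    exacts [h.smooth_d, h.smooth_E i j]
  have := box_mul (sm f hf) (sm f' hf') X
  rw [hs.2 f hf f' hf' X, hs.1 f hf X, hs.1 f' hf' X] at this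
  linarith

/-- A polarized difference of squares. The factor (𝒟̄ - 𝒟)/2 contracted with g^{ij} is ∂̃, while 𝒟 +
𝒟̄ is 2∂ plus the antisymmetric part of ℰ applied to ∂̃; the latter cancels after symmetrization in
f and f'. -/
lemma ctr_cD_sub_ctr_cDb (E : MField D) {X : Dbl D} (hE : (gLow E X).det ≠ 0) (f f' : SField D) :
    ctr (gUp E X) (fun i j => cD E i f X * cD E j f' X - cDb E i f X * cDb E j f' X) =
      -2 * etaPair f f' X := by
  have hs := gUp_symm E X
  have key : ∀ f f' : SField D, ctr (gUp E X) (fun i j => (cD E i f X + cDb E i f X) *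
      (1 / 2 * (cDb E j f' X - cD E j f' X))) =
      2 * ∑ k, pd (Sum.inr k) f X * pd (Sum.inl k) f' X
      + ∑ i, ∑ k, (E X k i - E X i k) * pd (Sum.inl k) f X * pd (Sum.inl i) f' X := by
    intro f f'
    have : ctr (gUp E X) (fun i j => (cD E i f X + cDb E i f X) *
      (1 / 2 * (cDb E j f' X - cD E j f' X))) =
      ∑ i, (cD E i f X + cDb E i f X) * pd (Sum.inl i) f' X := by
      refine Finset.sum_congr rfl fun i _ => ?_
      rw [pd_inl_eq E X hE, Finset.mul_sum]
      exact Finset.sum_congr rfl fun j _ => by ring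
    rw [this, Finset.mul_sum, ← Finset.sum_add_distrib]
    refine Finset.sum_congr rfl fun i _ => ?_
    simp only [cD, cDb, sub_mul, add_mul, Finset.sum_mul, Finset.sum_sub_distrib]
    ring
  have h1 := key f f'
  have h2 := key f' f
  have h3 : ∑ i, ∑ k, (E X k i - E X i k) * pd (Sum.inl k) f' X * pd (Sum.inl i) f X =
      - ∑ i, ∑ k, (E X k i - E X i k) * pd (Sum.inl k) f X * pd (Sum.inl i) f' X := by
    rw [Finset.sum_comm, ← Finset.sum_neg_distrib]
    refine Finset.sum_congr rfl fun i _ => ?_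
    rw [← Finset.sum_neg_distrib]
    exact Finset.sum_congr rfl fun j _ => by ring
  rw [ctr_flip hs] at h2
  have h4 : etaPair f f' X = ∑ k, pd (Sum.inr k) f X * pd (Sum.inl k) f' X +
      ∑ k, pd (Sum.inr k) f' X * pd (Sum.inl k) f X := by
    rw [etaPair, Fintype.sum_sum_type, add_comm]
    congr 1
    exact Finset.sum_congr rfl fun k _ => mul_comm _ _
  have h5 : ctr (gUp E X) (fun i j => cD E i f X * cD E j f' X - cDb E i f X * cDb E j f' X) =
      - (ctr (gUp E X) (fun i j => (cD E i f X + cDb E i f X) *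
      (1 / 2 * (cDb E j f' X - cD E j f' X))) + ctr (gUp E X) (fun i j =>
        (cD E j f' X + cDb E j f' X) * (1 / 2 * (cDb E i f X - cD E i f X)))) := by
    rw [← ctr_add, ← ctr_neg]
    exact ctr_congr _ fun i j => by ring
  rw [h5, h1, h2, h3, h4]
  ring

/-! ### Comparison of the two brackets -/

lemma tr3_eq_inner (G : Matrix (Fin D) (Fin D) ℝ) (T U : Fin D → Fin D → Fin D → ℝ) :
    tr3 G T U = ctr G fun j b => ctr G fun k c => ctr G fun i a => T i j k * U a b c := by
  rw [tr3, ctr_comm]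
  exact ctr_congr _ fun j b => ctr_comm _ _

/-- The two forms of the bracket differ by terms that the strong constraint annihilates. -/
lemma lag_eq (E : MField D) (d : SField D) {X : Dbl D} (hE : (gLow E X).det ≠ 0) :
    lag E d X = lagSym E d X + 1 / 4 * ctr (gUp E X) (fun j b => ctr (gUp E X) fun k c =>
      etaPair (fun Y => E Y j k) (fun Y => E Y b c) X) - 4 * etaPair d d X := by
  have hs := gUp_symm E X
  have t1 := tr3_self_eq (G := gUp E X) (fun i j k => DE E i j k X)
  have t2 := tr3_self_eq (G := gUp E X) (fun i j k => DbE E i j k X)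
  have t3 := ctr_self_eq hs (fun i => cD E i d X)
  have t4 := ctr_self_eq hs (fun i => cDb E i d X)
  have e1 : tr3 (gUp E X) (fun i j k => DE E i j k X) (fun i j k => DE E i j k X) -
      tr3 (gUp E X) (fun i j k => DbE E i j k X) (fun i j k => DbE E i j k X) =
      -2 * ctr (gUp E X) (fun j b => ctr (gUp E X) fun k c =>
        etaPair (fun Y => E Y j k) (fun Y => E Y b c) X) := by
    simp only [mul_ctr, ← ctr_cD_sub_ctr_cDb E hE, ctr_sub, tr3_eq_inner]
    rfl
  have e2 : ctr (gUp E X) (fun i j => cD E i d X * cD E j d X) -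
      ctr (gUp E X) (fun i j => cDb E i d X * cDb E j d X) = -2 * etaPair d d X := by
    rw [← ctr_sub, ctr_cD_sub_ctr_cDb E hE]
  have e3 : lag E d X - lagSym E d X =
      -(1 / 8) * (tr3 (gUp E X) (fun i j k => DE E i j k X) (fun i j k => DE E i j k X) -
        tr3 (gUp E X) (fun i j k => DbE E i j k X) (fun i j k => DbE E i j k X)) +
      2 * (ctr (gUp E X) (fun i j => cD E i d X * cD E j d X) -
        ctr (gUp E X) (fun i j => cDb E i d X * cDb E j d X)) := by
    rw [← t1, ← t2, ← t3, ← t4]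
    simp only [lag, lagSym, DEUp, DbEUp, cDUp, cDbUp, mul_add, Finset.sum_add_distrib,
      mul_left_comm _ (1 / 2 : ℝ), ← Finset.mul_sum]
    simp only [DE, DbE, mul_assoc, ← Finset.mul_sum]
    ring
  rw [e1, e2] at e3
  linarith

lemma StrongConstraint.lag_eq {E : MField D} {d : SField D} (h : IsBackground E d)
    (hs : StrongConstraint E d) (X : Dbl D) : lag E d X = lagSym E d X := by
  have h1 : ∀ i j k l, etaPair (fun Y => E Y i j) (fun Y => E Y k l) X = 0 := fun i j k l =>
    hs.etaPair_eq_zero h (Or.inr ⟨i, j, rfl⟩) (Or.inr ⟨k, l, rfl⟩) X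
  rw [DFT.lag_eq E d (h.nondeg X), hs.etaPair_eq_zero h (Or.inl rfl) (Or.inl rfl)]
  simp [h1, ctr]

/-! ### Variation of the unsymmetrized action -/

section variation
variable {E Δ : MField D} {d : SField D} {ℓ : Fin D ⊕ Fin D → ℝ}

lemma etaPair_add_mul {f g f' g' : SField D} {X : Dbl D} (hf : DifferentiableAt ℝ f X)
    (hg : DifferentiableAt ℝ g X) (hf' : DifferentiableAt ℝ f' X)
    (hg' : DifferentiableAt ℝ g' X) (s : ℝ) :
    etaPair (fun Y => f Y + s * g Y) (fun Y => f' Y + s * g' Y) X =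
      etaPair f f' X + s * (etaPair g f' X + etaPair f g' X + s * etaPair g g' X) := by
  simp only [etaPair, pd_add_mul hf hg, pd_add_mul hf' hg', Finset.mul_sum,
    ← Finset.sum_add_distrib]
  exact Finset.sum_congr rfl fun m _ => by ring

/-- The difference of the first variations of `lag` and `lagSym`. -/
def pairVar (E Δ : MField D) : SField D := fun X =>
  1 / 2 * ctr (gUp E X) (fun j b => ctr (gUp E X) fun k c =>
    etaPair (fun Y => Δ Y j k) (fun Y => E Y b c) X)

/-- The shifted field need not satisfy the constraint, so the brackets are compared through
`DFT.lag_eq` at each small s. The pairing of ℰ + sΔ with itself has no term of order zero; its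
linear term gives `pairVar`. -/
lemma lag_hasDerivAt (h : IsBackground E d) (hs : StrongConstraint E d)
    (hΔ : ∀ i j, ContDiff ℝ ∞ (fun X => Δ X i j)) (X : Dbl D) :
    HasDerivAt (fun s => lag (shift E Δ s) d X) (lagSymVar E d Δ X + pairVar E Δ X) 0 := by
  have dE := fun i j => differentiableAt_of_smooth (h.smooth_E i j) X
  have dΔ := fun i j => differentiableAt_of_smooth (hΔ i j) X
  have hsym := gUp_symm E X
  have h0 : ∀ i j k l, etaPair (fun Y => E Y i j) (fun Y => E Y k l) X = 0 := fun i j k l =>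
    hs.etaPair_eq_zero h (Or.inr ⟨i, j, rfl⟩) (Or.inr ⟨k, l, rfl⟩) X
  -- The difference of the brackets is s r(s), so its derivative at 0 is r(0). The variation of the
  -- inverse metrics therefore does not contribute.
  let r : ℝ → ℝ := fun s => 1 / 4 * ctr (gUp (shift E Δ s) X) (fun j b =>
    ctr (gUp (shift E Δ s) X) fun k c => etaPair (fun Y => Δ Y j k) (fun Y => E Y b c) X +
      etaPair (fun Y => E Y j k) (fun Y => Δ Y b c) X +
      s * etaPair (fun Y => Δ Y j k) (fun Y => Δ Y b c) X)
  have hr : DifferentiableAt ℝ r 0 := by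
    have hG : ∀ i j, DifferentiableAt ℝ (fun s => gUp (shift E Δ s) X i j) 0 := fun i j =>
      (isCompat_shift E Δ (h.nondeg X) i j).differentiableAt
    simp only [r, ctr]
    refine (DifferentiableAt.fun_sum fun i _ => DifferentiableAt.fun_sum fun j _ =>
      (hG i j).fun_mul (DifferentiableAt.fun_sum fun k _ => DifferentiableAt.fun_sum fun l _ =>
      (hG k l).fun_mul ?_)).const_mul _
    fun_prop
  have hr0 : r 0 = pairVar E Δ X := by
    simp only [r, shift_zero, zero_mul, add_zero]
    simp only [ctr_add, pairVar]
    have : ctr (gUp E X) (fun j b => ctr (gUp E X) fun k c =>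
        etaPair (fun Y => E Y j k) (fun Y => Δ Y b c) X) =
        ctr (gUp E X) (fun j b => ctr (gUp E X) fun k c =>
        etaPair (fun Y => Δ Y j k) (fun Y => E Y b c) X) := by
      rw [ctr_flip hsym]
      refine ctr_congr _ fun j b => ?_
      rw [ctr_flip hsym]
      exact ctr_congr _ fun k c => etaPair_comm _ _ X
    rw [this]
    ring
  have h1 : HasDerivAt (fun s => lagSym (shift E Δ s) d X + s * r s)
      (lagSymVar E d Δ X + pairVar E Δ X) 0 := by
    refine ((lagSym_hasDerivAt (h.nondeg X) dE (differentiableAt_of_smooth h.smooth_d X) dΔ).fun_add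
      ((hasDerivAt_id (0 : ℝ)).fun_mul hr.hasDerivAt)).congr_deriv ?_
    simp [hr0]
  refine h1.congr_of_eventuallyEq ?_
  have hdet : ∀ᶠ s : ℝ in 𝓝 0, (gLow (shift E Δ s) X).det ≠ 0 := by
    refine ContinuousAt.eventually_ne ?_ (by simpa [shift_zero] using h.nondeg X)
    refine (contDiffAt_det (m := 0) fun i j => ?_).continuousAt
    simp only [gLow_shift, Matrix.add_apply, Matrix.smul_apply, smul_eq_mul]
    fun_prop
  filter_upwards [hdet] with s hsd
  rw [DFT.lag_eq _ d hsd, hs.etaPair_eq_zero h (Or.inl rfl) (Or.inl rfl)]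
  simp only [r, mul_zero, sub_zero]
  rw [mul_left_comm, mul_ctr _ s]
  simp only [mul_ctr _ s]
  congr 2
  refine ctr_congr _ fun j b => ctr_congr _ fun k c => ?_
  have := etaPair_add_mul (dE j k) (dΔ j k) (dE b c) (dΔ b c) s
  rw [h0, zero_add] at this
  exact this

/-- The vector field whose divergence is the difference of the first variations. -/
def pairBdry (E : MField D) (d : SField D) (Δ : MField D) (m : Fin D ⊕ Fin D) : SField D :=
  fun X => ∑ j, ∑ b, ∑ k, ∑ c, 1 / 2 * ((Real.exp (-2 * d X) * (gUp E X j b * gUp E X k c)) *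
    Δ X j k * pd m.swap (fun Y => E Y b c) X)

lemma contDiff_pairBdry (h : IsBackground E d) (hΔ : ∀ i j, ContDiff ℝ ∞ (fun X => Δ X i j))
    (m : Fin D ⊕ Fin D) : ContDiff ℝ ∞ (pairBdry E d Δ m) :=
  ContDiff.sum fun j _ => ContDiff.sum fun b _ => ContDiff.sum fun k _ => ContDiff.sum fun c _ =>
    contDiff_const.mul ((((contDiff_exp_dil h).mul ((h.contDiff_gUp j b).mul
      (h.contDiff_gUp k c))).mul (hΔ j k)).mul (contDiff_pd (h.smooth_E b c) _))

/-- The pairing is a directional derivative along the η-raised gradient of ℰ_{bc}. All components of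
ℰ, hence the metric and its inverse, are stationary in that direction. -/
lemma StrongConstraint.etaPair_gUp (h : IsBackground E d) (hs : StrongConstraint E d)
    (i j b c : Fin D) (X : Dbl D) :
    etaPair (fun Y => gUp E Y i j) (fun Y => E Y b c) X = 0 := by
  have hE : ∀ k l, etaPair (fun Y => E Y k l) (fun Y => E Y b c) X = 0 := fun k l =>
    hs.etaPair_eq_zero h (Or.inr ⟨k, l, rfl⟩) (Or.inr ⟨b, c, rfl⟩) X
  simp only [etaPair_eq_fderiv] at hE ⊢
  set ξ := etaVec (fun Y => E Y b c) X
  have h1 : IsCompat (fun t => gUp E (X + t • ξ)) 0 (fun _ _ => 0) := by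
    refine h.isCompat_line fun k l => ?_
    have e := fun k l => hE k l ▸ hasDerivAt_line (differentiableAt_of_smooth (h.smooth_E k l) X) ξ
    refine (((e k l).fun_add (e l k)).const_mul (1 / 2)).congr_deriv ?_
    simp
  refine (hasDerivAt_line (differentiableAt_of_smooth (h.contDiff_gUp i j) X) ξ).unique
    ((h1 i j).congr_deriv ?_)
  simp

/-- In the divergence, the derivative hits e^{-2d}, an inverse metric, Δ or the gradient of ℰ. The
first two give pairings annihilated by the constraint, the last gives ∂^M ∂_M ℰ = 0, and only the
pairing of Δ with ℰ remains. -/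
lemma sum_pd_pairBdry (h : IsBackground E d) (hs : StrongConstraint E d)
    (hΔ : ∀ i j, ContDiff ℝ ∞ (fun X => Δ X i j)) (X : Dbl D) :
    ∑ m, pd m (pairBdry E d Δ m) X = Real.exp (-2 * d X) * pairVar E Δ X := by
  have hw : ∀ j b k c, ContDiff ℝ ∞ (fun X => Real.exp (-2 * d X) * (gUp E X j b * gUp E X k c)) :=
    fun j b k c => (contDiff_exp_dil h).mul ((h.contDiff_gUp j b).mul (h.contDiff_gUp k c))
  have dF : ∀ j b k c, DifferentiableAt ℝ
      (fun X => Real.exp (-2 * d X) * (gUp E X j b * gUp E X k c) * Δ X j k) X := fun j b k c =>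
    differentiableAt_of_smooth ((hw j b k c).mul (hΔ j k)) X
  have dP := fun b c m => differentiableAt_of_smooth (contDiff_pd (h.smooth_E b c) m) X
  have e1 : ∀ m, pd m (pairBdry E d Δ m) X = ∑ j, ∑ b, ∑ k, ∑ c, 1 / 2 *
      (pd m (fun X => Real.exp (-2 * d X) * (gUp E X j b * gUp E X k c) * Δ X j k) X *
          pd m.swap (fun Y => E Y b c) X +
        Real.exp (-2 * d X) * (gUp E X j b * gUp E X k c) * Δ X j k *
          pd m (pd m.swap (fun Y => E Y b c)) X) := by
    intro m
    have dt : ∀ j b k c, DifferentiableAt ℝ (fun X => 1 / 2 *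
      ((Real.exp (-2 * d X) * (gUp E X j b * gUp E X k c)) *
      Δ X j k * pd m.swap (fun Y => E Y b c) X)) X := fun j b k c =>
      ((dF j b k c).fun_mul (dP b c _)).const_mul _
    have d1 := fun j b k => DifferentiableAt.fun_sum (u := Finset.univ) fun c _ => dt j b k c
    have d2 := fun j b => DifferentiableAt.fun_sum (u := Finset.univ) fun k _ => d1 j b k
    have d3 := fun j => DifferentiableAt.fun_sum (u := Finset.univ) fun b _ => d2 j b
    unfold pairBdry
    rw [pd_sum fun j _ => d3 j]
    refine Finset.sum_congr rfl fun j _ => ?_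
    rw [pd_sum fun b _ => d2 j b]
    refine Finset.sum_congr rfl fun b _ => ?_
    rw [pd_sum fun k _ => d1 j b k]
    refine Finset.sum_congr rfl fun k _ => ?_
    rw [pd_sum fun c _ => dt j b k c]
    refine Finset.sum_congr rfl fun c _ => ?_
    rw [pd_mul (differentiableAt_const _) ((dF j b k c).fun_mul (dP b c _)),
      pd_mul (dF j b k c) (dP b c _)]
    simp [pd]
  have e2 : ∀ j b k c, etaPair
      (fun X => Real.exp (-2 * d X) * (gUp E X j b * gUp E X k c) * Δ X j k)
      (fun Y => E Y b c) X = Real.exp (-2 * d X) * (gUp E X j b * gUp E X k c) *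
        etaPair (fun X => Δ X j k) (fun Y => E Y b c) X := by
    intro j b k c
    have hdE := hs.etaPair_eq_zero h (Or.inl rfl) (Or.inr ⟨b, c, rfl⟩) X
    have hexp : etaPair (fun X => Real.exp (-2 * d X)) (fun Y => E Y b c) X = 0 := by
      have : etaPair (fun X => Real.exp (-2 * d X)) (fun Y => E Y b c) X =
          Real.exp (-2 * d X) * (-2 * etaPair d (fun Y => E Y b c) X) := by
        simp only [etaPair, pd_exp (differentiableAt_of_smooth h.smooth_d X), Finset.mul_sum]
        exact Finset.sum_congr rfl fun m _ => by ring
      rw [this, hdE]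
      ring
    rw [etaPair_mul (differentiableAt_of_smooth (hw j b k c) X)
        (differentiableAt_of_smooth (hΔ j k) X),
      etaPair_mul (differentiableAt_of_smooth (contDiff_exp_dil h) X)
        (differentiableAt_of_smooth ((h.contDiff_gUp j b).mul (h.contDiff_gUp k c)) X),
      etaPair_mul (differentiableAt_of_smooth (h.contDiff_gUp j b) X)
        (differentiableAt_of_smooth (h.contDiff_gUp k c) X), hexp, hs.etaPair_gUp h,
      hs.etaPair_gUp h]
    ring
  simp only [e1]
  rw [Finset.sum_comm, pairVar, ctr, Finset.mul_sum, Finset.mul_sum]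
  refine Finset.sum_congr rfl fun j _ => ?_
  rw [Finset.sum_comm, Finset.mul_sum, Finset.mul_sum]
  refine Finset.sum_congr rfl fun b _ => ?_
  rw [Finset.sum_comm, ctr, Finset.mul_sum, Finset.mul_sum, Finset.mul_sum]
  refine Finset.sum_congr rfl fun k _ => ?_
  rw [Finset.sum_comm, Finset.mul_sum, Finset.mul_sum, Finset.mul_sum]
  refine Finset.sum_congr rfl fun c _ => ?_
  have hb := hs.1 _ (Or.inr ⟨b, c, rfl⟩) X
  rw [box_eq (h.smooth_E b c)] at hb
  rw [← Finset.mul_sum, Finset.sum_add_distrib, ← Finset.mul_sum, hb, mul_zero, add_zero]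
  have := e2 j b k c
  rw [etaPair] at this
  rw [this]
  ring

lemma TransInv.pairBdry {t : Dbl D} (hE : TransInv t E) (hd : TransInv t d) (hΔ : TransInv t Δ)
    (m : Fin D ⊕ Fin D) : TransInv t (pairBdry E d Δ m) := by
  intro X
  simp only [DFT.pairBdry, hd X, hΔ X, hE.gUp X, (hE.comp _ _).pd _ X]

/-- The variation of the action under the strong constraint. -/
lemma hasActionVariation_lag (h : IsBackground E d) (hs : StrongConstraint E d)
    (hE : HasPeriods ℓ E) (hd : HasPeriods ℓ d) (hΔ : IsVariation ℓ Δ) :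
    MeasureTheory.IntegrableOn (variationDensity E d Δ) (cell ℓ) ∧
    HasActionVariation lag ℓ E d Δ (∫ X in cell ℓ, variationDensity E d Δ X) := by
  have db := fun m X => differentiableAt_of_smooth (contDiff_bdry h hΔ.smooth m) X
  have dp := fun m X => differentiableAt_of_smooth (contDiff_pairBdry h hΔ.smooth m) X
  refine hasActionVariation_of (W := fun m X => bdry E d Δ m X + pairBdry E d Δ m X) h hΔ
    (fun E' X he => (lag_congr he d).1)
    (fun X => (contDiffAt_lag_shift h hΔ.smooth X).1)
    (fun X => lag_hasDerivAt h hs hΔ.smooth X)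
    (fun m => (contDiff_bdry h hΔ.smooth m).add (contDiff_pairBdry h hΔ.smooth m))
    (fun m X hX => ?_) (fun m k X => ?_) (fun X => ?_)
  · rw [bdry_eq_zero hX]
    simp [pairBdry, hX]
  · exact congrArg₂ (· + ·) (TransInv.bdry (hE k) (hd k) (hΔ.periodic k) m X)
      (TransInv.pairBdry (hE k) (hd k) (hΔ.periodic k) m X)
  · rw [mul_add, lagSymVar_eq h hΔ.smooth, ← sum_pd_pairBdry h hs hΔ.smooth, add_assoc,
      ← Finset.sum_add_distrib]
    congr 1
    exact Finset.sum_congr rfl fun m _ => (pd_add (db m X) (dp m X) m).symm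

end variation

/-! ### The field equation -/

section
variable {E : MField D} {d : SField D} {ℓ : Fin D ⊕ Fin D → ℝ}

lemma KUp_eq_mul (E : MField D) (d : SField D) (X : Dbl D) :
    KUp E d X = gUp E X * KLow E d X * gUp E X := by
  ext p q
  simp only [KUp, Matrix.of_apply, Matrix.mul_apply, Finset.sum_mul]
  rw [Finset.sum_comm]
  refine Finset.sum_congr rfl fun l _ => Finset.sum_congr rfl fun k _ => ?_
  rw [gUp_symm E X q l]
  ring

lemma KLow_eq_zero_of_KUp (h : IsBackground E d) {X : Dbl D} (hK : KUp E d X = 0) :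
    KLow E d X = 0 := by
  have hu := isUnit_iff_ne_zero.mpr (h.nondeg X)
  have h1 : gLow E X * gUp E X = 1 := Matrix.mul_nonsing_inv _ hu
  have h2 : gUp E X * gLow E X = 1 := Matrix.nonsing_inv_mul _ hu
  calc KLow E d X = gLow E X * gUp E X * KLow E d X * (gUp E X * gLow E X) := by
        rw [h1, h2, Matrix.one_mul, Matrix.mul_one]
    _ = gLow E X * KUp E d X * gLow E X := by
        rw [KUp_eq_mul]
        simp only [Matrix.mul_assoc]
    _ = 0 := by rw [hK, Matrix.mul_zero, Matrix.zero_mul]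

/-- A cutoff in the line coordinates. -/
def cutoff (ℓ : Fin D ⊕ Fin D → ℝ) (b : ContDiffBump (0 : ℝ)) : SField D := fun X =>
  ∏ m, if 0 < ℓ m then 1 else b (X m)

lemma contDiff_cutoff (b : ContDiffBump (0 : ℝ)) : ContDiff ℝ ∞ (cutoff ℓ b) := by
  refine contDiff_prod fun m _ => ?_
  split_ifs
  · exact contDiff_const
  · exact b.contDiff.comp (contDiff_apply ℝ ℝ m)

lemma cutoff_nonneg (b : ContDiffBump (0 : ℝ)) (X : Dbl D) : 0 ≤ cutoff ℓ b X :=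
  Finset.prod_nonneg fun m _ => by
    split_ifs
    exacts [zero_le_one, b.nonneg]

lemma cutoff_pos {b : ContDiffBump (0 : ℝ)} {X : Dbl D} (hX : ∀ m, ℓ m ≤ 0 → |X m| < b.rOut) :
    0 < cutoff ℓ b X :=
  Finset.prod_pos fun m _ => by
    split_ifs with h
    · exact zero_lt_one
    · exact b.pos_of_mem_ball (by simpa using hX m (not_lt.mp h))

lemma abs_lt_of_cutoff_ne_zero {b : ContDiffBump (0 : ℝ)} {X : Dbl D} (hX : cutoff ℓ b X ≠ 0)
    {m : Fin D ⊕ Fin D} (hm : ¬ 0 < ℓ m) : |X m| < b.rOut := by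
  have h1 := Finset.prod_ne_zero_iff.mp hX m (Finset.mem_univ m)
  rw [if_neg hm] at h1
  have : X m ∈ Function.support b := h1
  simpa [b.support_eq] using this

lemma cutoff_add_single (b : ContDiffBump (0 : ℝ)) {m : Fin D ⊕ Fin D} (hm : 0 < ℓ m) (t : ℝ)
    (X : Dbl D) : cutoff ℓ b (X + Pi.single m t) = cutoff ℓ b X := by
  refine Finset.prod_congr rfl fun k _ => ?_
  by_cases hk : k = m
  · subst hk; simp [hm]
  · simp [Pi.single_eq_of_ne hk]

/-- The test variation. Its components are set equal to the upper components 𝒦^{pq}, without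
lowering indices, so that the density is a sum of squares whatever the signature of g. -/
lemma isVariation_cutoff (h : IsBackground E d) (hℓ : ∀ m, 0 ≤ ℓ m) (hE : HasPeriods ℓ E)
    (hd : HasPeriods ℓ d) (b : ContDiffBump (0 : ℝ)) :
    IsVariation ℓ (fun X => cutoff ℓ b X • KUp E d X) where
  smooth i j := (contDiff_cutoff b).mul (h.contDiff_KUp i j)
  periodic m X := by
    rcases (hℓ m).eq_or_lt with hm | hm
    · simp [← hm]
    · simp only [cutoff_add_single b hm]
      rw [TransInv.KUp (hE m) (hd m) X]
  bounded_support := by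
    refine (Metric.isBounded_closedBall (x := (0 : Dbl D)) (r := ∑ m, ℓ m + b.rOut)).subset ?_
    rintro X ⟨hX, hne⟩
    have hc : cutoff ℓ b X ≠ 0 := fun hc => hne (by simp [hc])
    have hsum : ∀ m, ℓ m ≤ ∑ m, ℓ m := fun m =>
      Finset.single_le_sum (fun m _ => hℓ m) (Finset.mem_univ m)
    have hs0 : 0 ≤ ∑ m, ℓ m := Finset.sum_nonneg fun m _ => hℓ m
    have hb := b.rOut_pos
    rw [mem_closedBall_zero_iff, pi_norm_le_iff_of_nonneg (by linarith)]
    intro m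
    rw [Real.norm_eq_abs]
    by_cases hm : 0 < ℓ m
    · have := hX m hm
      rw [abs_of_nonneg this.1]
      linarith [this.2, hsum m]
    · linarith [abs_lt_of_cutoff_ne_zero hc hm]

open MeasureTheory Set in
/-- A continuous nonnegative function with vanishing integral vanishes on the fundamental
domain. -/
lemma eq_zero_of_setIntegral_cell {F : SField D} (hF : Continuous F) (h0 : ∀ X, 0 ≤ F X)
    (hi : IntegrableOn F (cell ℓ)) (hz : ∫ X in cell ℓ, F X = 0) {Y : Dbl D} (hY : Y ∈ cell ℓ) :
    F Y = 0 := by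
  by_contra hne
  have hae := (setIntegral_eq_zero_iff_of_nonneg_ae (ae_of_all _ h0) hi).mp hz
  -- Y may lie on the boundary of the half-open domain. This open box inside the domain has Y in its
  -- closure, so it meets the open set where F is nonzero in positive measure.
  let B : Set (Dbl D) := Set.pi univ fun m => Ioo (Y m) (if 0 < ℓ m then ℓ m else Y m + 1)
  have hB : IsOpen B := isOpen_set_pi finite_univ fun m _ => isOpen_Ioo
  have hBc : B ⊆ cell ℓ := fun Z hZ m hm => by
    have := hZ m (mem_univ m)
    simp only [hm, if_true] at this
    exact ⟨(hY m hm).1.trans this.1.le, this.2⟩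
  have hYB : Y ∈ closure B := by
    rw [closure_pi_set]
    intro m _
    have hlt : Y m < if 0 < ℓ m then ℓ m else Y m + 1 := by
      split_ifs with hm
      · exact (hY m hm).2
      · linarith
    simp only
    rw [closure_Ioo hlt.ne]
    exact left_mem_Icc.mpr hlt.le
  have hU : IsOpen {Z | F Z ≠ 0} := isOpen_ne_fun hF continuous_const
  obtain ⟨Z, hZ1, hZ2⟩ := mem_closure_iff.mp hYB _ hU hne
  have hpos := (hU.inter hB).measure_pos volume ⟨Z, hZ1, hZ2⟩
  have hnull : volume ({Z | F Z ≠ 0} ∩ cell ℓ) = 0 := by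
    have := ae_iff.mp hae
    rwa [Measure.restrict_apply' measurableSet_cell] at this
  exact hpos.ne' (measure_mono_null (inter_subset_inter_right _ hBc) hnull)

/-- If `𝒦` is orthogonal to all variations that depend only on the coordinates in `I`, it
vanishes. -/
lemma KLow_eq_zero_of_integral (h : IsBackground E d) (hℓ : ∀ m, 0 ≤ ℓ m) (hE : HasPeriods ℓ E)
    (hd : HasPeriods ℓ d) {I : Set (Fin D ⊕ Fin D)} (hI : ∀ m ∉ I, 0 < ℓ m)
    (hEI : DependsOnlyOn I E) (hdI : DependsOnlyOn I d)
    (hint : ∀ Δ : MField D, IsVariation ℓ Δ → DependsOnlyOn I Δ →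
      MeasureTheory.IntegrableOn (variationDensity E d Δ) (cell ℓ) ∧
      ∫ X in cell ℓ, variationDensity E d Δ X = 0) (X : Dbl D) : KLow E d X = 0 := by
  refine KLow_eq_zero_of_KUp h ?_
  obtain ⟨Y, hY, hYX, hYf⟩ := exists_mem_cell ℓ X
  have hKp : HasPeriods ℓ (KUp E d) := fun m => TransInv.KUp (hE m) (hd m)
  rw [← hYf _ hKp]
  have hS : 0 ≤ ∑ m, |X m| := Finset.sum_nonneg fun m _ => abs_nonneg _
  -- The radius exceeds every |X m|, so the cutoff is positive at the chosen point.
  let b : ContDiffBump (0 : ℝ) := ⟨∑ m, |X m| + 1, ∑ m, |X m| + 2, by linarith, by linarith⟩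
  have hpos : 0 < cutoff ℓ b Y := cutoff_pos fun m hm => by
    rw [hYX m hm]
    have := Finset.single_le_sum (f := fun m => |X m|) (fun m _ => abs_nonneg _)
      (Finset.mem_univ m)
    change |X m| < ∑ m, |X m| + 2
    linarith
  have hv := isVariation_cutoff h hℓ hE hd b
  -- Coordinates outside I are circles, and the cutoff involves only lines; 𝒦 depends only on I
  -- because the background does.
  obtain ⟨i1, i2⟩ := hint _ hv fun m hm t X => by
    simp only [cutoff_add_single b (hI m hm)]
    rw [TransInv.KUp (hEI m hm t) (hdI m hm t) X]
  have hF : ∀ Z, variationDensity E d (fun X => cutoff ℓ b X • KUp E d X) Z =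
      Real.exp (-2 * d Z) * (cutoff ℓ b Z * ∑ p, ∑ q, KUp E d Z p q ^ 2) := by
    intro Z
    simp only [variationDensity, Matrix.smul_apply, smul_eq_mul, Finset.mul_sum]
    exact Finset.sum_congr rfl fun p _ => Finset.sum_congr rfl fun q _ => by ring
  have hsq : ∀ Z, 0 ≤ ∑ p, ∑ q, KUp E d Z p q ^ 2 := fun Z =>
    Finset.sum_nonneg fun p _ => Finset.sum_nonneg fun q _ => sq_nonneg _
  have hcont : Continuous (variationDensity E d fun X => cutoff ℓ b X • KUp E d X) :=
    (contDiff_exp_dil h).continuous.mul (continuous_finsetSum _ fun p _ =>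
      continuous_finsetSum _ fun q _ => (hv.smooth p q).continuous.mul
        (h.contDiff_KUp p q).continuous)
  have := eq_zero_of_setIntegral_cell hcont (fun Z => by
    rw [hF]
    exact mul_nonneg (Real.exp_pos _).le (mul_nonneg (cutoff_nonneg b Z) (hsq Z))) i1 i2 hY
  rw [hF] at this
  have hz : ∑ p, ∑ q, KUp E d Y p q ^ 2 = 0 := by
    rcases mul_eq_zero.mp this with h1 | h1
    · exact absurd h1 (Real.exp_pos _).ne'
    · exact (mul_eq_zero.mp h1).resolve_left hpos.ne'
  ext p q
  have h1 := (Finset.sum_eq_zero_iff_of_nonneg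
    (fun p _ => Finset.sum_nonneg fun q _ => sq_nonneg _)).mp hz p (Finset.mem_univ p)
  have h2 := (Finset.sum_eq_zero_iff_of_nonneg (fun q _ => sq_nonneg _)).mp h1 q (Finset.mem_univ q)
  exact pow_eq_zero_iff two_ne_zero |>.mp h2

/-- The field equation. -/
lemma variation_eq_zero_iff {L : MField D → SField D → SField D} (h : IsBackground E d)
    (hℓ : ∀ m, 0 ≤ ℓ m) (hE : HasPeriods ℓ E) (hd : HasPeriods ℓ d)
    (hL : ∀ Δ : MField D, IsVariation ℓ Δ →
      MeasureTheory.IntegrableOn (variationDensity E d Δ) (cell ℓ) ∧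
      HasActionVariation L ℓ E d Δ (∫ X in cell ℓ, variationDensity E d Δ X))
    {I : Set (Fin D ⊕ Fin D)} (hI : ∀ m ∉ I, 0 < ℓ m)
    (hEI : DependsOnlyOn I E) (hdI : DependsOnlyOn I d) :
    (∀ Δ : MField D, IsVariation ℓ Δ → DependsOnlyOn I Δ → HasActionVariation L ℓ E d Δ 0) ↔
      ∀ X p q, KLow E d X p q = 0 := by
  constructor
  · intro hv X p q
    rw [KLow_eq_zero_of_integral h hℓ hE hd hI hEI hdI (fun Δ hΔ hΔI =>
      ⟨(hL Δ hΔ).1, (hL Δ hΔ).2.2.unique (hv Δ hΔ hΔI).2⟩) X]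
    rfl
  · intro hK Δ hΔ _
    have h0 : ∀ X, variationDensity E d Δ X = 0 := fun X => by
      simp [variationDensity, KUp, hK]
    simpa [h0] using (hL Δ hΔ).2

end

/-! Evaluation of tensors on vectors -/

/-- Evaluation of a covector. -/
def ev1 (f : Fin D → ℝ) (x : Fin D → ℝ) : ℝ := ∑ k, x k * f k

/-- Evaluation of a tensor with two indices. -/
def ev2 (F : Fin D → Fin D → ℝ) (x y : Fin D → ℝ) : ℝ := ev1 (fun k => ev1 (F k) y) x

/-- Evaluation of a tensor with three indices. -/
def ev3 (F : Fin D → Fin D → Fin D → ℝ) (x y z : Fin D → ℝ) : ℝ := ev1 (fun k => ev2 (F k) y z) x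

/-- Evaluation of a tensor with four indices. -/
def ev4 (F : Fin D → Fin D → Fin D → Fin D → ℝ) (w x y z : Fin D → ℝ) : ℝ :=
  ev1 (fun k => ev3 (F k) x y z) w

/-- The standard basis vector. -/
abbrev bv (k : Fin D) : Fin D → ℝ := Pi.single k 1

/-- Linearity, expressed by the values on the standard basis. -/
def IsLin (f : (Fin D → ℝ) → ℝ) : Prop := ∀ x, f x = ev1 (fun k => f (bv k)) x

lemma ev1_bv (f : Fin D → ℝ) (k : Fin D) : ev1 f (bv k) = f k := by
  simp [ev1, Pi.single_apply]

lemma ev2_bv (F : Fin D → Fin D → ℝ) (k l : Fin D) : ev2 F (bv k) (bv l) = F k l := by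
  simp only [ev2, ev1_bv]

lemma ev3_bv (F : Fin D → Fin D → Fin D → ℝ) (k l m : Fin D) :
    ev3 F (bv k) (bv l) (bv m) = F k l m := by
  simp only [ev3, ev2, ev1_bv]

lemma ev4_bv (F : Fin D → Fin D → Fin D → Fin D → ℝ) (k l m n : Fin D) :
    ev4 F (bv k) (bv l) (bv m) (bv n) = F k l m n := by
  simp only [ev4, ev3, ev2, ev1_bv]

lemma isLin_ev1 (f : Fin D → ℝ) : IsLin (ev1 f) := fun x => by simp only [ev1_bv]

section lin
variable {f g : (Fin D → ℝ) → ℝ}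

lemma IsLin.add (hf : IsLin f) (hg : IsLin g) : IsLin fun x => f x + g x := fun x => by
  beta_reduce
  rw [hf x, hg x]
  simp only [ev1, mul_add, Finset.sum_add_distrib]

lemma IsLin.sub (hf : IsLin f) (hg : IsLin g) : IsLin fun x => f x - g x := fun x => by
  beta_reduce
  rw [hf x, hg x]
  simp only [ev1, mul_sub, Finset.sum_sub_distrib]

lemma IsLin.const_mul (hf : IsLin f) (c : ℝ) : IsLin fun x => c * f x := fun x => by
  beta_reduce
  rw [hf x]
  simp only [ev1, Finset.mul_sum]
  exact Finset.sum_congr rfl fun k _ => by ring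

lemma IsLin.mul_const (hf : IsLin f) (c : ℝ) : IsLin fun x => f x * c := fun x => by
  beta_reduce
  rw [hf x]
  simp only [ev1, Finset.sum_mul]
  exact Finset.sum_congr rfl fun k _ => by ring

lemma IsLin.sum {ι : Type*} {u : Finset ι} {φ : ι → (Fin D → ℝ) → ℝ} (h : ∀ k, IsLin (φ k)) :
    IsLin fun x => ∑ k ∈ u, φ k x := fun x => by
  simp only [ev1, Finset.mul_sum]
  rw [Finset.sum_comm]
  exact Finset.sum_congr rfl fun k _ => h k x

lemma IsLin.ev1 {φ : Fin D → (Fin D → ℝ) → ℝ} (h : ∀ k, IsLin (φ k)) (y : Fin D → ℝ) :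
    IsLin fun x => ev1 (fun k => φ k x) y :=
  IsLin.sum fun k => (h k).const_mul _

lemma IsLin.ctr {φ : Fin D → Fin D → (Fin D → ℝ) → ℝ} (h : ∀ k l, IsLin (φ k l))
    (G : Matrix (Fin D) (Fin D) ℝ) : IsLin fun x => ctr G fun k l => φ k l x :=
  IsLin.sum fun k => IsLin.sum fun l => (h k l).const_mul _

lemma isLin_ev2₁ (F : Fin D → Fin D → ℝ) (y : Fin D → ℝ) : IsLin fun x => ev2 F x y :=
  isLin_ev1 _

lemma isLin_ev2₂ (F : Fin D → Fin D → ℝ) (x : Fin D → ℝ) : IsLin fun y => ev2 F x y :=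
  IsLin.ev1 (fun k => isLin_ev1 (F k)) x

lemma isLin_ev3₁ (F : Fin D → Fin D → Fin D → ℝ) (y z : Fin D → ℝ) :
    IsLin fun x => ev3 F x y z := isLin_ev1 _

lemma isLin_ev3₂ (F : Fin D → Fin D → Fin D → ℝ) (x z : Fin D → ℝ) :
    IsLin fun y => ev3 F x y z := IsLin.ev1 (fun k => isLin_ev2₁ (F k) z) x

lemma isLin_ev3₃ (F : Fin D → Fin D → Fin D → ℝ) (x y : Fin D → ℝ) :
    IsLin fun z => ev3 F x y z := IsLin.ev1 (fun k => isLin_ev2₂ (F k) y) x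

lemma isLin_ev4₁ (F : Fin D → Fin D → Fin D → Fin D → ℝ) (x y z : Fin D → ℝ) :
    IsLin fun w => ev4 F w x y z := isLin_ev1 _

lemma isLin_ev4₂ (F : Fin D → Fin D → Fin D → Fin D → ℝ) (w y z : Fin D → ℝ) :
    IsLin fun x => ev4 F w x y z := IsLin.ev1 (fun k => isLin_ev3₁ (F k) y z) w

lemma isLin_ev4₃ (F : Fin D → Fin D → Fin D → Fin D → ℝ) (w x z : Fin D → ℝ) :
    IsLin fun y => ev4 F w x y z := IsLin.ev1 (fun k => isLin_ev3₂ (F k) x z) w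

lemma isLin_ev4₄ (F : Fin D → Fin D → Fin D → Fin D → ℝ) (w x y : Fin D → ℝ) :
    IsLin fun z => ev4 F w x y z := IsLin.ev1 (fun k => isLin_ev3₃ (F k) x y) w

end lin

lemma eq_ev2 {φ : (Fin D → ℝ) → (Fin D → ℝ) → ℝ} (h1 : ∀ y, IsLin fun x => φ x y)
    (h2 : ∀ x, IsLin fun y => φ x y) (x y : Fin D → ℝ) :
    φ x y = ev2 (fun k l => φ (bv k) (bv l)) x y := by
  refine (h1 y x).trans ?_
  rw [ev2]
  congr 1
  exact funext fun k => h2 (bv k) y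

lemma eq_ev4 {φ : (Fin D → ℝ) → (Fin D → ℝ) → (Fin D → ℝ) → (Fin D → ℝ) → ℝ}
    (h1 : ∀ x y z, IsLin fun w => φ w x y z) (h2 : ∀ w y z, IsLin fun x => φ w x y z)
    (h3 : ∀ w x z, IsLin fun y => φ w x y z) (h4 : ∀ w x y, IsLin fun z => φ w x y z)
    (w x y z : Fin D → ℝ) :
    φ w x y z = ev4 (fun k l m n => φ (bv k) (bv l) (bv m) (bv n)) w x y z := by
  refine (h1 x y z w).trans ?_
  rw [ev4]
  congr 1
  funext k
  refine (h2 (bv k) y z x).trans ?_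
  rw [ev3]
  congr 1
  funext l
  exact eq_ev2 (fun z => h3 _ _ z) (fun y => h4 _ _ y) y z

/-- Change of basis for a bilinear form: the rows of N and P are moved from the arguments into the
contracting matrix. -/
lemma ctr_pull {φ : (Fin D → ℝ) → (Fin D → ℝ) → ℝ} (h1 : ∀ y, IsLin fun x => φ x y)
    (h2 : ∀ x, IsLin fun y => φ x y) (G N P : Matrix (Fin D) (Fin D) ℝ) :
    ctr G (fun i j => φ (N i) (P j)) =
      ctr (N.transpose * G * P) (fun k l => φ (bv k) (bv l)) := by
  simp only [eq_ev2 h1 h2 (N _), ctr, ev2, ev1, Matrix.mul_apply, Matrix.transpose_apply,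
    Finset.mul_sum, Finset.sum_mul]
  refine sum4_congr ⟨fun x => (x.2.2.1, x.2.2.2, x.2.1, x.1),
    fun x => (x.2.2.2, x.2.2.1, x.1, x.2.1), fun _ => rfl, fun _ => rfl⟩ fun x => ?_
  simp only [Equiv.coe_fn_mk]
  ring

/-! ### Contractions and covariant derivatives under a change of frame -/

/-- The algebraic relations between the metrics and the matrices `M`, `M̄` of an `O(D,D)`
transformation with lower left block `c`. -/
structure IsFrame (G G' M Mb c : Matrix (Fin D) (Fin D) ℝ) : Prop where
  left : M.transpose * G * M = G'
  right : Mb.transpose * G * Mb = G'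
  mixed : Mb.transpose * G * M = G' - (2 : ℝ) • (Mb.transpose * c.transpose)
  mixed' : M.transpose * G * Mb = G' + (2 : ℝ) • (M.transpose * c.transpose)

section frame
variable {G G' M Mb c : Matrix (Fin D) (Fin D) ℝ}

lemma IsFrame.symm (h : IsFrame G G' M Mb c) : IsFrame G G' Mb M (-c) where
  left := h.right
  right := h.left
  mixed := by rw [h.mixed', Matrix.transpose_neg, Matrix.mul_neg, smul_neg, sub_neg_eq_add]
  mixed' := by rw [h.mixed, Matrix.transpose_neg, Matrix.mul_neg, smul_neg, sub_eq_add_neg]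

lemma ctr_add_smul (G N c : Matrix (Fin D) (Fin D) ℝ) (s : ℝ)
    {φ : (Fin D → ℝ) → (Fin D → ℝ) → ℝ} (h1 : ∀ y, IsLin fun x => φ x y) :
    ctr (G + s • (N.transpose * c.transpose)) (fun k l => φ (bv k) (bv l)) =
      ctr G (fun k l => φ (bv k) (bv l)) + s * ∑ k, ∑ l, c k l * φ (N l) (bv k) := by
  have : ∀ k l, φ (N l) (bv k) = ∑ n, N l n * φ (bv n) (bv k) := fun k l => h1 (bv k) (N l)
  simp only [ctr, this, Matrix.add_apply, Matrix.smul_apply, Matrix.mul_apply,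
    Matrix.transpose_apply, smul_eq_mul, add_mul, Finset.sum_add_distrib, Finset.mul_sum,
    Finset.sum_mul]
  congr 1
  rw [Finset.sum_comm]
  refine Finset.sum_congr rfl fun k _ => ?_
  rw [Finset.sum_comm]
  exact Finset.sum_congr rfl fun l _ => Finset.sum_congr rfl fun n _ => by ring

variable {φ : (Fin D → ℝ) → (Fin D → ℝ) → ℝ}

lemma IsFrame.ctr_left (h : IsFrame G G' M Mb c) (h1 : ∀ y, IsLin fun x => φ x y)
    (h2 : ∀ x, IsLin fun y => φ x y) :
    ctr G (fun i j => φ (M i) (M j)) = ctr G' (fun k l => φ (bv k) (bv l)) := by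
  rw [ctr_pull h1 h2, h.left]

lemma IsFrame.ctr_right (h : IsFrame G G' M Mb c) (h1 : ∀ y, IsLin fun x => φ x y)
    (h2 : ∀ x, IsLin fun y => φ x y) :
    ctr G (fun i j => φ (Mb i) (Mb j)) = ctr G' (fun k l => φ (bv k) (bv l)) := by
  rw [ctr_pull h1 h2, h.right]

lemma IsFrame.ctr_mixed (h : IsFrame G G' M Mb c) (h1 : ∀ y, IsLin fun x => φ x y)
    (h2 : ∀ x, IsLin fun y => φ x y) :
    ctr G (fun i j => φ (Mb i) (M j)) =
      ctr G' (fun k l => φ (bv k) (bv l)) - 2 * ∑ k, ∑ l, c k l * φ (Mb l) (bv k) := by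
  rw [ctr_pull h1 h2, h.mixed, sub_eq_add_neg, ← neg_smul, ctr_add_smul _ _ _ _ h1]
  ring

lemma IsFrame.ctr_mixed' (h : IsFrame G G' M Mb c) (h1 : ∀ y, IsLin fun x => φ x y)
    (h2 : ∀ x, IsLin fun y => φ x y) :
    ctr G (fun i j => φ (M i) (Mb j)) =
      ctr G' (fun k l => φ (bv k) (bv l)) + 2 * ∑ k, ∑ l, c k l * φ (M l) (bv k) := by
  rw [ctr_pull h1 h2, h.mixed', ctr_add_smul _ _ _ _ h1]

lemma IsFrame.ctr_ctr (h : IsFrame G G' M Mb c)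
    {φ : (Fin D → ℝ) → (Fin D → ℝ) → (Fin D → ℝ) → (Fin D → ℝ) → ℝ}
    (h1 : ∀ x y z, IsLin fun w => φ w x y z) (h2 : ∀ w y z, IsLin fun x => φ w x y z)
    (h3 : ∀ w x z, IsLin fun y => φ w x y z) (h4 : ∀ w x y, IsLin fun z => φ w x y z) :
    ctr G (fun j j' => ctr G (fun i i' => φ (M j) (M j') (Mb i) (Mb i'))) =
      ctr G' (fun j j' => ctr G' (fun i i' => φ (bv j) (bv j') (bv i) (bv i'))) := by
  rw [← h.ctr_left (φ := fun x y => ctr G' (fun i i' => φ x y (bv i) (bv i')))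
    (fun y => IsLin.ctr (fun _ _ => h1 _ _ _) _) (fun x => IsLin.ctr (fun _ _ => h2 _ _ _) _)]
  exact ctr_congr _ fun j j' => h.ctr_right (φ := φ (M j) (M j')) (fun _ => h3 _ _ _)
    (fun _ => h4 _ _ _)

variable {A C A' C' : Fin D → Fin D → Fin D → ℝ}

/-- In ½ g^{kl} A_{ral} the index l is barred, while k is contracted with an unbarred index of the
tensor. This mixed contraction produces an extra term in c, which is cancelled by the inhomogeneous
term from the derivative of M_a. -/
lemma IsFrame.unbarred_connection (h : IsFrame G G' M Mb c)
    (hA : ∀ i j k, A i j k = ev3 A' (M i) (M j) (Mb k))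
    {t : (Fin D → ℝ) → ℝ} (ht : IsLin t) (r a : Fin D) :
    t (fun k => - ∑ l, A r a l * c k l) - ctr G (fun l m => 1 / 2 * A r a l * t (M m)) =
      - ctr G' (fun l m => 1 / 2 * ev3 A' (M r) (M a) (bv l) * t (bv m)) := by
  have := h.ctr_mixed (φ := fun x y => 1 / 2 * ev3 A' (M r) (M a) x * t y)
    (fun y => ((isLin_ev3₃ A' _ _).const_mul _).mul_const _) (fun x => ht.const_mul _)
  simp only [hA]
  rw [this, ht]
  simp only [ev1, neg_mul, Finset.sum_neg_distrib, Finset.sum_mul, Finset.mul_sum]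
  have e : ∑ k, ∑ l, ev3 A' (M r) (M a) (Mb l) * c k l * t (bv k) =
      ∑ k, ∑ l, 2 * (c k l * (1 / 2 * ev3 A' (M r) (M a) (Mb l) * t (bv k))) :=
    Finset.sum_congr rfl fun k _ => Finset.sum_congr rfl fun l _ => by ring
  rw [e]
  ring

/-- Only the A-term contracts an unbarred with a barred index, and its extra term cancels the
derivative of M̄_s. The two C-terms contract barred indices only and are covariant by themselves. -/
lemma IsFrame.barred_connection (h : IsFrame G G' M Mb c)
    (hA : ∀ i j k, A i j k = ev3 A' (M i) (M j) (Mb k))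
    (hC : ∀ i j k, C i j k = ev3 C' (Mb i) (Mb j) (M k))
    {t : (Fin D → ℝ) → ℝ} (ht : IsLin t) (r s : Fin D) :
    t (fun k => ∑ l, A r l s * c k l)
        - ctr G (fun l m => 1 / 2 * (A r l s + C s l r - C l s r) * t (Mb m)) =
      - ctr G' (fun l m => 1 / 2 * (ev3 A' (M r) (bv l) (Mb s) + ev3 C' (Mb s) (bv l) (M r)
          - ev3 C' (bv l) (Mb s) (M r)) * t (bv m)) := by
  have h1 := h.ctr_mixed' (φ := fun x y => 1 / 2 * ev3 A' (M r) x (Mb s) * t y)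
    (fun y => ((isLin_ev3₂ A' _ _).const_mul _).mul_const _) (fun x => ht.const_mul _)
  have h2 := h.ctr_right (φ := fun x y => 1 / 2 * (ev3 C' (Mb s) x (M r)
      - ev3 C' x (Mb s) (M r)) * t y)
    (fun y => (((isLin_ev3₂ C' _ _).sub (isLin_ev3₁ C' _ _)).const_mul _).mul_const _)
    (fun x => ht.const_mul _)
  have e1 : ctr G (fun l m => 1 / 2 * (A r l s + C s l r - C l s r) * t (Mb m)) =
      ctr G (fun l m => 1 / 2 * ev3 A' (M r) (M l) (Mb s) * t (Mb m)) +
      ctr G (fun l m => 1 / 2 * (ev3 C' (Mb s) (Mb l) (M r)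
        - ev3 C' (Mb l) (Mb s) (M r)) * t (Mb m)) := by
    rw [← ctr_add]
    exact ctr_congr _ fun l m => by rw [hA, hC, hC]; ring
  have e2 : ctr G' (fun l m => 1 / 2 * (ev3 A' (M r) (bv l) (Mb s) + ev3 C' (Mb s) (bv l) (M r)
          - ev3 C' (bv l) (Mb s) (M r)) * t (bv m)) =
      ctr G' (fun l m => 1 / 2 * ev3 A' (M r) (bv l) (Mb s) * t (bv m)) +
      ctr G' (fun l m => 1 / 2 * (ev3 C' (Mb s) (bv l) (M r)
        - ev3 C' (bv l) (Mb s) (M r)) * t (bv m)) := by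
    rw [← ctr_add]
    exact ctr_congr _ fun l m => by ring
  rw [e1, e2, h1, h2, ht]
  simp only [hA, ev1, Finset.sum_mul, Finset.mul_sum]
  have e : ∑ k, ∑ l, ev3 A' (M r) (M l) (Mb s) * c k l * t (bv k) =
      ∑ k, ∑ l, 2 * (c k l * (1 / 2 * ev3 A' (M r) (M l) (Mb s) * t (bv k))) :=
    Finset.sum_congr rfl fun k _ => Finset.sum_congr rfl fun l _ => by ring
  rw [e]
  ring

/-- `nab3` evaluated on vectors. -/
def nab3V (G : Matrix (Fin D) (Fin D) ℝ) (A C : Fin D → Fin D → Fin D → ℝ)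
    (dT : Fin D → Fin D → Fin D → Fin D → ℝ) (T : Fin D → Fin D → Fin D → ℝ)
    (w x y z : Fin D → ℝ) : ℝ :=
  ev4 dT w x y z - ctr G (fun l m => 1 / 2 * ev3 A w x (bv l) * ev3 T (bv m) y z)
    - ctr G (fun l m => 1 / 2 * ev3 A w y (bv l) * ev3 T x (bv m) z)
    - ctr G (fun l m => 1 / 2 * (ev3 A w (bv l) z + ev3 C z (bv l) w - ev3 C (bv l) z w)
        * ev3 T x y (bv m))

/-- Both sides are linear in each argument and agree on basis vectors. The linearity goals follow
the syntax of the expression. -/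
lemma nab3V_eq_ev4 (dT : Fin D → Fin D → Fin D → Fin D → ℝ) (T : Fin D → Fin D → Fin D → ℝ)
    (w x y z : Fin D → ℝ) :
    nab3V G A C dT T w x y z = ev4 (nab3 G A C dT T) w x y z := by
  have h1 : (fun k l m n => nab3V G A C dT T (bv k) (bv l) (bv m) (bv n)) = nab3 G A C dT T := by
    funext k l m n
    simp only [nab3V, nab3, ev4_bv, ev3_bv]
  rw [← h1]
  unfold nab3V
  refine eq_ev4 (φ := nab3V G A C dT T) (fun x y z => ?_) (fun w y z => ?_) (fun w x z => ?_)
    (fun w x y => ?_) w x y z <;> unfold nab3V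
  · repeat' first
      | with_reducible apply IsLin.sub | with_reducible apply IsLin.add | (with_reducible refine IsLin.ctr (fun _ _ => ?_) _)
      | with_reducible apply IsLin.mul_const | with_reducible apply IsLin.const_mul
      | with_reducible apply isLin_ev3₁ | with_reducible apply isLin_ev3₃ | with_reducible apply isLin_ev4₁
  · repeat' first
      | with_reducible apply IsLin.sub | (with_reducible refine IsLin.ctr (fun _ _ => ?_) _)
      | with_reducible apply IsLin.mul_const | with_reducible apply IsLin.const_mul
      | with_reducible apply isLin_ev3₁ | with_reducible apply isLin_ev3₂ | with_reducible apply isLin_ev4₂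
  · repeat' first
      | with_reducible apply IsLin.sub | (with_reducible refine IsLin.ctr (fun _ _ => ?_) _)
      | with_reducible apply IsLin.mul_const | with_reducible apply IsLin.const_mul
      | with_reducible apply isLin_ev3₂ | with_reducible apply isLin_ev4₃
  · repeat' first
      | with_reducible apply IsLin.sub | with_reducible apply IsLin.add | (with_reducible refine IsLin.ctr (fun _ _ => ?_) _)
      | with_reducible apply IsLin.mul_const | with_reducible apply IsLin.const_mul
      | with_reducible apply isLin_ev3₁ | with_reducible apply isLin_ev3₂ | with_reducible apply isLin_ev3₃ | with_reducible apply isLin_ev4₄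

/-- Covariance of the derivative of a tensor with two unbarred indices and a barred one. -/
lemma IsFrame.nab3_eq (h : IsFrame G G' M Mb c)
    (hA : ∀ i j k, A i j k = ev3 A' (M i) (M j) (Mb k))
    (hC : ∀ i j k, C i j k = ev3 C' (Mb i) (Mb j) (M k))
    {T T' : Fin D → Fin D → Fin D → ℝ} {dT dT' : Fin D → Fin D → Fin D → Fin D → ℝ}
    (hT : ∀ i j k, T i j k = ev3 T' (M i) (M j) (Mb k))
    (hdT : ∀ r i j k, dT r i j k = ev4 dT' (M r) (M i) (M j) (Mb k)
      + ev3 T' (fun k => - ∑ l, A r i l * c k l) (M j) (Mb k)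
      + ev3 T' (M i) (fun k => - ∑ l, A r j l * c k l) (Mb k)
      + ev3 T' (M i) (M j) (fun n => ∑ l, A r l k * c n l)) (r i j k : Fin D) :
    nab3 G A C dT T r i j k = ev4 (nab3 G' A' C' dT' T') (M r) (M i) (M j) (Mb k) := by
  have h1 := h.unbarred_connection hA (isLin_ev3₁ T' (M j) (Mb k)) r i
  have h2 := h.unbarred_connection hA (isLin_ev3₂ T' (M i) (Mb k)) r j
  have h3 := h.barred_connection hA hC (isLin_ev3₃ T' (M i) (M j)) r k
  rw [← nab3V_eq_ev4]
  simp only [nab3, nab3V, hdT, hT]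
  linear_combination h1 + h2 + h3

/-- Covariance of the derivative of a barred covector. -/
lemma IsFrame.nab1_eq (h : IsFrame G G' M Mb c)
    (hA : ∀ i j k, A i j k = ev3 A' (M i) (M j) (Mb k))
    (hC : ∀ i j k, C i j k = ev3 C' (Mb i) (Mb j) (M k))
    {v v' : Fin D → ℝ} {dv dv' : Fin D → Fin D → ℝ}
    (hv : ∀ i, v i = ev1 v' (Mb i))
    (hdv : ∀ r i, dv r i = ev2 dv' (M r) (Mb i) + ev1 v' (fun n => ∑ l, A r l i * c n l))
    (r i : Fin D) :
    nab1 G A C dv v r i = ev2 (nab1 G' A' C' dv' v') (M r) (Mb i) := by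
  have h3 := h.barred_connection hA hC (isLin_ev1 v') r i
  simp only [ev1_bv] at h3
  have h4 := eq_ev2 (φ := fun x y => ev2 dv' x y - ctr G' (fun l m => 1 / 2 *
    (ev3 A' x (bv l) y + ev3 C' y (bv l) x - ev3 C' (bv l) y x) * ev1 v' (bv m)))
    (fun y => (isLin_ev2₁ dv' y).sub (IsLin.ctr (fun _ _ => ((((isLin_ev3₁ A' _ _).add
      (isLin_ev3₃ C' _ _)).sub (isLin_ev3₃ C' _ _)).const_mul _).mul_const _) _))
    (fun x => (isLin_ev2₂ dv' x).sub (IsLin.ctr (fun _ _ => ((((isLin_ev3₃ A' _ _).add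
      (isLin_ev3₁ C' _ _)).sub (isLin_ev3₂ C' _ _)).const_mul _).mul_const _) _)) (M r) (Mb i)
  simp only [ev2_bv, ev3_bv, ev1_bv] at h4
  have h5 : nab1 G' A' C' dv' v' = fun r c => dv' r c - ctr G' (fun l m => 1 / 2 *
    (A' r l c + C' c l r - C' l c r) * v' m) := rfl
  rw [h5, ← h4]
  simp only [nab1, hdv, hv]
  linear_combination h3

/-- `khalf` evaluated on vectors. -/
def khalfV (G : Matrix (Fin D) (Fin D) ℝ) (A C : Fin D → Fin D → Fin D → ℝ)
    (nA : Fin D → Fin D → Fin D → Fin D → ℝ) (nv : Fin D → Fin D → ℝ) (x y : Fin D → ℝ) : ℝ :=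
  1 / 4 * ctr G (fun s r => ev4 nA (bv r) (bv s) x y)
  - 1 / 2 * ctr G (fun s r => ev4 nA (bv r) x (bv s) y) - ev2 nv x y
  + 1 / 4 * ctr G (fun j j' => ctr G (fun i i' => ev3 A x (bv j) y * ev3 C (bv i) (bv i') (bv j')))
  + 1 / 8 * ctr G (fun j j' => ctr G (fun i i' => ev3 A x (bv j) (bv i) * ev3 C (bv i') y (bv j')))
  - 1 / 8 * ctr G (fun j j' => ctr G (fun i i' => ev3 C (bv i) (bv i') (bv j) * ev3 A (bv j') x y))
  - 1 / 8 * ctr G (fun j j' => ctr G (fun i i' => ev3 C (bv j) y (bv i) * ev3 A (bv i') x (bv j')))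
  - 1 / 8 * ctr G (fun j j' => ctr G (fun i i' => ev3 C y (bv j) (bv i) * ev3 A x (bv i') (bv j')))

lemma khalfV_eq_ev2 (nA : Fin D → Fin D → Fin D → Fin D → ℝ) (nv : Fin D → Fin D → ℝ)
    (x y : Fin D → ℝ) : khalfV G A C nA nv x y = ev2 (khalf G A C nA nv) x y := by
  have h1 : (fun k l => khalfV G A C nA nv (bv k) (bv l)) = khalf G A C nA nv := by
    funext k l
    simp only [khalfV, khalf, ev4_bv, ev3_bv, ev2_bv]
  rw [← h1]
  refine eq_ev2 (φ := khalfV G A C nA nv) (fun y => ?_) (fun x => ?_) x y <;> unfold khalfV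
  · repeat' first
      | with_reducible apply IsLin.sub | with_reducible apply IsLin.add | (with_reducible refine IsLin.ctr (fun _ _ => ?_) _)
      | with_reducible apply IsLin.mul_const | with_reducible apply IsLin.const_mul
      | with_reducible apply isLin_ev3₁ | with_reducible apply isLin_ev3₂ | with_reducible apply isLin_ev2₁ | with_reducible apply isLin_ev4₂ | with_reducible apply isLin_ev4₃
  · repeat' first
      | with_reducible apply IsLin.sub | with_reducible apply IsLin.add | (with_reducible refine IsLin.ctr (fun _ _ => ?_) _)
      | with_reducible apply IsLin.mul_const | with_reducible apply IsLin.const_mul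
      | with_reducible apply isLin_ev3₁ | with_reducible apply isLin_ev3₂ | with_reducible apply isLin_ev3₃ | with_reducible apply isLin_ev2₂
      | with_reducible apply isLin_ev4₄

/-- Covariance of the halves of `𝒦`. -/
lemma IsFrame.khalf_eq (h : IsFrame G G' M Mb c)
    (hA : ∀ i j k, A i j k = ev3 A' (M i) (M j) (Mb k))
    (hC : ∀ i j k, C i j k = ev3 C' (Mb i) (Mb j) (M k))
    {nA nA' : Fin D → Fin D → Fin D → Fin D → ℝ} {nv nv' : Fin D → Fin D → ℝ}
    (hnA : ∀ r i j k, nA r i j k = ev4 nA' (M r) (M i) (M j) (Mb k))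
    (hnv : ∀ r i, nv r i = ev2 nv' (M r) (Mb i)) (p q : Fin D) :
    khalf G A C nA nv p q = ev2 (khalf G' A' C' nA' nv') (M p) (Mb q) := by
  rw [← khalfV_eq_ev2]
  simp only [khalf, khalfV, hA, hC, hnA, hnv]
  have e1 := (h.ctr_left (φ := fun x y => ev4 nA' y x (M p) (Mb q))
    (fun _ => isLin_ev4₂ _ _ _ _) (fun _ => isLin_ev4₁ _ _ _ _))
  have e2 := (h.ctr_left (φ := fun x y => ev4 nA' y (M p) x (Mb q))
    (fun _ => isLin_ev4₃ _ _ _ _) (fun _ => isLin_ev4₁ _ _ _ _))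
  have e4 := h.ctr_ctr (φ := fun j j' i i' => ev3 A' (M p) j (Mb q) * ev3 C' i i' j')
    (fun _ _ _ => (isLin_ev3₂ _ _ _).mul_const _) (fun _ _ _ => (isLin_ev3₃ _ _ _).const_mul _)
    (fun _ _ _ => (isLin_ev3₁ _ _ _).const_mul _) (fun _ _ _ => (isLin_ev3₂ _ _ _).const_mul _)
  have e5 := h.ctr_ctr (φ := fun j j' i i' => ev3 A' (M p) j i * ev3 C' i' (Mb q) j')
    (fun _ _ _ => (isLin_ev3₂ _ _ _).mul_const _) (fun _ _ _ => (isLin_ev3₃ _ _ _).const_mul _)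
    (fun _ _ _ => (isLin_ev3₃ _ _ _).mul_const _) (fun _ _ _ => (isLin_ev3₁ _ _ _).const_mul _)
  have e6 := h.ctr_ctr (φ := fun j j' i i' => ev3 C' i i' j * ev3 A' j' (M p) (Mb q))
    (fun _ _ _ => (isLin_ev3₃ _ _ _).mul_const _) (fun _ _ _ => (isLin_ev3₁ _ _ _).const_mul _)
    (fun _ _ _ => (isLin_ev3₁ _ _ _).mul_const _) (fun _ _ _ => (isLin_ev3₂ _ _ _).mul_const _)
  -- In this term and the next the outer pair is barred and the inner one unbarred, hence the frame
  -- with M and M̄ exchanged.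
  have e7 := h.symm.ctr_ctr (φ := fun j j' i i' => ev3 C' j (Mb q) i * ev3 A' i' (M p) j')
    (fun _ _ _ => (isLin_ev3₁ _ _ _).mul_const _) (fun _ _ _ => (isLin_ev3₃ _ _ _).const_mul _)
    (fun _ _ _ => (isLin_ev3₃ _ _ _).mul_const _) (fun _ _ _ => (isLin_ev3₁ _ _ _).const_mul _)
  have e8 := h.symm.ctr_ctr (φ := fun j j' i i' => ev3 C' (Mb q) j i * ev3 A' (M p) i' j')
    (fun _ _ _ => (isLin_ev3₂ _ _ _).mul_const _) (fun _ _ _ => (isLin_ev3₃ _ _ _).const_mul _)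
    (fun _ _ _ => (isLin_ev3₃ _ _ _).mul_const _) (fun _ _ _ => (isLin_ev3₂ _ _ _).const_mul _)
  rw [e1, e2, e4, e5, e6, e7, e8]

end frame

/-! ### Matrix identities for the blocks of an O(D,D) element -/

section algebra
variable {a b c δ e e' : Matrix (Fin D) (Fin D) ℝ}

/-- The relations between the blocks of an element of `O(D,D)`. -/
structure IsBlockODD (a b c δ : Matrix (Fin D) (Fin D) ℝ) : Prop where
  ac : a.transpose * c + c.transpose * a = 0
  ad : a.transpose * δ + c.transpose * b = 1
  bc : b.transpose * c + δ.transpose * a = 1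
  bd : b.transpose * δ + δ.transpose * b = 0

lemma IsODD.isBlockODD {h : Matrix (Fin D ⊕ Fin D) (Fin D ⊕ Fin D) ℝ} (hh : IsODD h) :
    IsBlockODD h.toBlocks₁₁ h.toBlocks₁₂ h.toBlocks₂₁ h.toBlocks₂₂ := by
  have h1 := hh
  rw [IsODD, ← Matrix.fromBlocks_toBlocks h, etaMat, Matrix.fromBlocks_transpose,
    Matrix.fromBlocks_multiply, Matrix.fromBlocks_multiply, Matrix.fromBlocks_inj] at h1
  simp only [Matrix.mul_zero, Matrix.mul_one, zero_add, add_zero] at h1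
  obtain ⟨h1, h2, h3, h4⟩ := h1
  exact ⟨by rw [add_comm]; exact h1, by rw [add_comm]; exact h2, by rw [add_comm]; exact h3,
    by rw [add_comm]; exact h4⟩

/-- A second form of the fractional linear action, with the denominator on the left;
cross-multiplying, the two forms agree by the four block relations. -/
lemma IsBlockODD.mul_left (h : IsBlockODD a b c δ) (hdet : (c * e + δ).det ≠ 0)
    (he : e' = (a * e + b) * (c * e + δ)⁻¹) :
    (δ.transpose - e * c.transpose) * e' = e * a.transpose - b.transpose := by
  have hN : (c * e + δ) * (c * e + δ)⁻¹ = 1 :=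
    Matrix.mul_nonsing_inv _ (isUnit_iff_ne_zero.mpr hdet)
  have key : (δ.transpose - e * c.transpose) * (a * e + b) =
      (e * a.transpose - b.transpose) * (c * e + δ) := by
    rw [← sub_eq_zero]
    have : (δ.transpose - e * c.transpose) * (a * e + b) -
        (e * a.transpose - b.transpose) * (c * e + δ) =
        (b.transpose * c + δ.transpose * a) * e + (b.transpose * δ + δ.transpose * b)
        - e * (a.transpose * c + c.transpose * a) * e - e * (a.transpose * δ + c.transpose * b) := by
      noncomm_ring
    rw [this, h.ac, h.ad, h.bc, h.bd]
    simp
  rw [he, ← Matrix.mul_assoc, key, Matrix.mul_assoc, hN, Matrix.mul_one]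

lemma mul_right_eq (hdet : (c * e + δ).det ≠ 0) (he : e' = (a * e + b) * (c * e + δ)⁻¹) :
    (δ.transpose + e.transpose * c.transpose) * e'.transpose =
      e.transpose * a.transpose + b.transpose := by
  have hN : (c * e + δ)⁻¹ * (c * e + δ) = 1 :=
    Matrix.nonsing_inv_mul _ (isUnit_iff_ne_zero.mpr hdet)
  have key : e' * (c * e + δ) = a * e + b := by
    rw [he, Matrix.mul_assoc, hN, Matrix.mul_one]
  have := congrArg Matrix.transpose key
  simp only [Matrix.transpose_mul, Matrix.transpose_add] at this
  rw [add_comm δ.transpose]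
  exact this

/-- An explicit inverse of M. It yields invertibility of M from the relations alone, once ℰ' is
eliminated with `h1`. -/
lemma IsBlockODD.left_inverse (h : IsBlockODD a b c δ)
    (h1 : (δ.transpose - e * c.transpose) * e' = e * a.transpose - b.transpose) :
    (δ.transpose - e * c.transpose) * (a - e' * c) = 1 := by
  rw [Matrix.mul_sub, ← Matrix.mul_assoc, h1]
  have : (δ.transpose - e * c.transpose) * a - (e * a.transpose - b.transpose) * c =
      (b.transpose * c + δ.transpose * a) - e * (a.transpose * c + c.transpose * a) := by
    noncomm_ring
  rw [this, h.ac, h.bc]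
  simp

lemma IsBlockODD.right_inverse (h : IsBlockODD a b c δ)
    (h2 : (δ.transpose + e.transpose * c.transpose) * e'.transpose =
      e.transpose * a.transpose + b.transpose) :
    (δ.transpose + e.transpose * c.transpose) * (a + e'.transpose * c) = 1 := by
  rw [Matrix.mul_add, ← Matrix.mul_assoc, h2]
  have : (δ.transpose + e.transpose * c.transpose) * a
      + (e.transpose * a.transpose + b.transpose) * c =
      (b.transpose * c + δ.transpose * a) + e.transpose * (a.transpose * c + c.transpose * a) := by
    noncomm_ring
  rw [this, h.ac, h.bc]
  simp

/-- Eliminating ℰ' by `h1` and its transpose leaves a polynomial in ℰ whose quadratic and constant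
parts vanish by the block relations. -/
lemma IsBlockODD.metric_left (h : IsBlockODD a b c δ)
    (h1 : (δ.transpose - e * c.transpose) * e' = e * a.transpose - b.transpose) :
    (δ.transpose - e * c.transpose) * (e' + e'.transpose) *
      (δ.transpose - e * c.transpose).transpose = e + e.transpose := by
  set M := δ.transpose - e * c.transpose with hM
  have hMt : M.transpose = δ - c * e.transpose := by
    simp [hM, Matrix.transpose_sub, Matrix.transpose_mul]
  have h1t : e'.transpose * M.transpose = a * e.transpose - b := by
    rw [← Matrix.transpose_mul, h1]
    simp [Matrix.transpose_sub, Matrix.transpose_mul]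
  have : M * (e' + e'.transpose) * M.transpose =
      (M * e') * M.transpose + M * (e'.transpose * M.transpose) := by noncomm_ring
  rw [this, h1, h1t, hMt, hM]
  have : (e * a.transpose - b.transpose) * (δ - c * e.transpose)
      + (δ.transpose - e * c.transpose) * (a * e.transpose - b) =
      e * (a.transpose * δ + c.transpose * b)
      + (b.transpose * c + δ.transpose * a) * e.transpose
      - e * (a.transpose * c + c.transpose * a) * e.transpose
      - (b.transpose * δ + δ.transpose * b) := by noncomm_ring
  rw [this, h.ac, h.ad, h.bc, h.bd]
  simp

lemma IsBlockODD.metric_right (h : IsBlockODD a b c δ)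
    (h2 : (δ.transpose + e.transpose * c.transpose) * e'.transpose =
      e.transpose * a.transpose + b.transpose) :
    (δ.transpose + e.transpose * c.transpose) * (e' + e'.transpose) *
      (δ.transpose + e.transpose * c.transpose).transpose = e + e.transpose := by
  set M := δ.transpose + e.transpose * c.transpose with hM
  have hMt : M.transpose = δ + c * e := by
    simp [hM, Matrix.transpose_mul]
  have h2t : e' * M.transpose = a * e + b := by
    rw [← Matrix.transpose_transpose e', ← Matrix.transpose_mul, h2]
    simp [Matrix.transpose_mul]
  have : M * (e' + e'.transpose) * M.transpose =
      M * (e' * M.transpose) + (M * e'.transpose) * M.transpose := by noncomm_ring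
  rw [this, h2, h2t, hMt, hM]
  have : (δ.transpose + e.transpose * c.transpose) * (a * e + b)
      + (e.transpose * a.transpose + b.transpose) * (δ + c * e) =
      e.transpose * (a.transpose * δ + c.transpose * b)
      + (b.transpose * c + δ.transpose * a) * e
      + e.transpose * (a.transpose * c + c.transpose * a) * e
      + (b.transpose * δ + δ.transpose * b) := by noncomm_ring
  rw [this, h.ac, h.ad, h.bc, h.bd]
  simp [add_comm]

lemma transpose_mul_inv_mul {M g g' : Matrix (Fin D) (Fin D) ℝ} (hM : M.det ≠ 0)
    (h : M * g' * M.transpose = g) : M.transpose * g⁻¹ * M = g'⁻¹ := by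
  have hu := isUnit_iff_ne_zero.mpr hM
  have hut : IsUnit M.transpose.det := by rwa [Matrix.det_transpose]
  rw [← h, Matrix.mul_inv_rev, Matrix.mul_inv_rev, ← Matrix.mul_assoc,
    Matrix.mul_nonsing_inv _ hut, Matrix.one_mul, Matrix.mul_assoc, Matrix.nonsing_inv_mul _ hu,
    Matrix.mul_one]

end algebra

section transform
variable {h : Matrix (Fin D ⊕ Fin D) (Fin D ⊕ Fin D) ℝ} {E E' : MField D} {d d' : SField D}

lemma IsODDTransform.oddM_mul (hh : IsODD h) (ht : IsODDTransform h E d E' d') (X : Dbl D) :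
    oddM h E X * E' (h.mulVec X) = E X * h.toBlocks₁₁.transpose - h.toBlocks₁₂.transpose :=
  hh.isBlockODD.mul_left (ht.isUnit_det X) (ht.map_E X)

lemma IsODDTransform.oddMb_mul (ht : IsODDTransform h E d E' d') (X : Dbl D) :
    oddMb h E X * (E' (h.mulVec X)).transpose =
      (E X).transpose * h.toBlocks₁₁.transpose + h.toBlocks₁₂.transpose :=
  mul_right_eq (ht.isUnit_det X) (ht.map_E X)

lemma IsODDTransform.det_oddM (hh : IsODD h) (ht : IsODDTransform h E d E' d') (X : Dbl D) :
    (oddM h E X).det ≠ 0 := by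
  have := congrArg Matrix.det (hh.isBlockODD.left_inverse (ht.oddM_mul hh X))
  rw [Matrix.det_mul, Matrix.det_one] at this
  exact left_ne_zero_of_mul_eq_one this

lemma IsODDTransform.oddMb_inverse (hh : IsODD h) (ht : IsODDTransform h E d E' d') (X : Dbl D) :
    oddMb h E X * (h.toBlocks₁₁ + (E' (h.mulVec X)).transpose * h.toBlocks₂₁) = 1 :=
  hh.isBlockODD.right_inverse (ht.oddMb_mul X)

lemma IsODDTransform.det_oddMb (hh : IsODD h) (ht : IsODDTransform h E d E' d') (X : Dbl D) :
    (oddMb h E X).det ≠ 0 := by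
  have := congrArg Matrix.det (ht.oddMb_inverse hh X)
  rw [Matrix.det_mul, Matrix.det_one] at this
  exact left_ne_zero_of_mul_eq_one this

lemma IsODDTransform.gLow_left (hh : IsODD h) (ht : IsODDTransform h E d E' d') (X : Dbl D) :
    oddM h E X * gLow E' (h.mulVec X) * (oddM h E X).transpose = gLow E X := by
  have := hh.isBlockODD.metric_left (ht.oddM_mul hh X)
  rw [gLow, gLow, ← this, Matrix.mul_smul, Matrix.smul_mul]
  rfl

lemma IsODDTransform.gLow_right (hh : IsODD h) (ht : IsODDTransform h E d E' d') (X : Dbl D) :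
    oddMb h E X * gLow E' (h.mulVec X) * (oddMb h E X).transpose = gLow E X := by
  have := hh.isBlockODD.metric_right (ht.oddMb_mul X)
  rw [gLow, gLow, ← this, Matrix.mul_smul, Matrix.smul_mul]
  rfl

/-- The pure relations invert the transformation of g. The mixed ones follow by substituting M̄ = M
+ 2 g cᵗ for one of the factors. -/
lemma IsODDTransform.isFrame (hh : IsODD h) (hbg : IsBackground E d)
    (ht : IsODDTransform h E d E' d') (X : Dbl D) :
    IsFrame (gUp E X) (gUp E' (h.mulVec X)) (oddM h E X) (oddMb h E X) h.toBlocks₂₁ := by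
  have l := transpose_mul_inv_mul (ht.det_oddM hh X) (ht.gLow_left hh X)
  have r := transpose_mul_inv_mul (ht.det_oddMb hh X) (ht.gLow_right hh X)
  have hg : gUp E X * gLow E X = 1 :=
    Matrix.nonsing_inv_mul _ (isUnit_iff_ne_zero.mpr (hbg.nondeg X))
  have hM : oddMb h E X = oddM h E X + (2 : ℝ) • (gLow E X * h.toBlocks₂₁.transpose) := by
    rw [oddM, oddMb, gLow, Matrix.smul_mul, smul_smul, Matrix.add_mul]
    norm_num
    abel
  have hM' : oddM h E X = oddMb h E X - (2 : ℝ) • (gLow E X * h.toBlocks₂₁.transpose) := by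
    rw [hM, add_sub_cancel_right]
  refine ⟨l, r, ?_, ?_⟩
  · conv_lhs => rw [hM']
    rw [Matrix.mul_sub, Matrix.mul_smul, Matrix.mul_assoc _ (gUp E X) (gLow E X * _),
      ← Matrix.mul_assoc (gUp E X) (gLow E X), hg, Matrix.one_mul]
    exact congrArg (· - _) r
  · conv_lhs => rw [hM]
    rw [Matrix.mul_add, Matrix.mul_smul, Matrix.mul_assoc _ (gUp E X) (gLow E X * _),
      ← Matrix.mul_assoc (gUp E X) (gLow E X), hg, Matrix.one_mul]
    exact congrArg (· + _) l

lemma etaMat_mul_self : etaMat D * etaMat D = 1 := by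
  simp [etaMat, Matrix.fromBlocks_multiply]

lemma IsODD.inv_mul (hh : IsODD h) : etaMat D * h.transpose * etaMat D * h = 1 := by
  rw [Matrix.mul_assoc, Matrix.mul_assoc, ← Matrix.mul_assoc h.transpose, hh, etaMat_mul_self]

lemma IsODDTransform.isBackground (hh : IsODD h) (hbg : IsBackground E d)
    (ht : IsODDTransform h E d E' d') : IsBackground E' d' := by
  set k := etaMat D * h.transpose * etaMat D with hk
  have hkh : k * h = 1 := hh.inv_mul
  have hhk : ∀ Y, h.mulVec (k.mulVec Y) = Y := fun Y => by
    rw [Matrix.mulVec_mulVec, mul_eq_one_comm.mp hkh, Matrix.one_mulVec]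
  have hks : ContDiff ℝ ∞ fun Y : Dbl D => k.mulVec Y :=
    (LinearMap.toContinuousLinearMap (Matrix.mulVecLin k)).contDiff
  have hE' : ∀ Y, E' Y = (h.toBlocks₁₁ * E (k.mulVec Y) + h.toBlocks₁₂) *
      (h.toBlocks₂₁ * E (k.mulVec Y) + h.toBlocks₂₂)⁻¹ := fun Y => by
    rw [← ht.map_E, hhk]
  have hlin : ∀ (p q : Matrix (Fin D) (Fin D) ℝ) i j,
      ContDiff ℝ ∞ fun Y => (p * E (k.mulVec Y) + q) i j := by
    intro p q i j
    simp only [Matrix.add_apply, Matrix.mul_apply]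
    exact (ContDiff.sum fun l _ => contDiff_const.mul ((hbg.smooth_E l j).comp hks)).add
      contDiff_const
  refine ⟨fun i j => ?_, ?_, fun Y => ?_⟩
  · simp only [hE', Matrix.mul_apply]
    exact ContDiff.sum fun l _ => (hlin _ _ i l).mul (contDiff_iff_contDiffAt.mpr fun Y =>
      contDiffAt_inv (fun i j => (hlin _ _ i j).contDiffAt) (ht.isUnit_det _) l j)
  · have : d' = fun Y => d (k.mulVec Y) := funext fun Y => by rw [← ht.map_d, hhk]
    rw [this]
    exact hbg.smooth_d.comp hks
  · have h1 := congrArg Matrix.det (ht.gLow_left hh (k.mulVec Y))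
    rw [hhk, Matrix.det_mul, Matrix.det_mul] at h1
    intro h0
    rw [h0, mul_zero, zero_mul] at h1
    exact hbg.nondeg _ h1.symm

end transform

/-! ### Derivatives and reordering of evaluated tensors -/

section deriv

lemma ev1_hasDerivAt {f : ℝ → Fin D → ℝ} {f' : Fin D → ℝ} {x : ℝ → Fin D → ℝ} {x' : Fin D → ℝ}
    {s : ℝ} (hf : ∀ k, HasDerivAt (fun t => f t k) (f' k) s)
    (hx : ∀ k, HasDerivAt (fun t => x t k) (x' k) s) :
    HasDerivAt (fun t => ev1 (f t) (x t)) (ev1 f' (x s) + ev1 (f s) x') s := by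
  refine (HasDerivAt.fun_sum (u := Finset.univ) fun k _ => (hx k).mul (hf k)).congr_deriv ?_
  simp only [ev1, ← Finset.sum_add_distrib]
  exact Finset.sum_congr rfl fun k _ => add_comm _ _

lemma ev1_add (f g : Fin D → ℝ) (x : Fin D → ℝ) :
    ev1 (fun k => f k + g k) x = ev1 f x + ev1 g x := by
  simp only [ev1, mul_add, Finset.sum_add_distrib]

lemma ev3_hasDerivAt {F : ℝ → Fin D → Fin D → Fin D → ℝ} {F' : Fin D → Fin D → Fin D → ℝ}
    {x y z : ℝ → Fin D → ℝ} {x' y' z' : Fin D → ℝ} {s : ℝ}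
    (hF : ∀ i j k, HasDerivAt (fun t => F t i j k) (F' i j k) s)
    (hx : ∀ k, HasDerivAt (fun t => x t k) (x' k) s)
    (hy : ∀ k, HasDerivAt (fun t => y t k) (y' k) s)
    (hz : ∀ k, HasDerivAt (fun t => z t k) (z' k) s) :
    HasDerivAt (fun t => ev3 (F t) (x t) (y t) (z t))
      (ev3 F' (x s) (y s) (z s) + ev3 (F s) x' (y s) (z s) + ev3 (F s) (x s) y' (z s)
        + ev3 (F s) (x s) (y s) z') s := by
  have := ev1_hasDerivAt (fun i => ev1_hasDerivAt (fun j => ev1_hasDerivAt (hF i j) hz) hy) hx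
  refine this.congr_deriv ?_
  simp only [ev3, ev2, ev1_add]
  ring

lemma ev3_ev1 (F : Fin D → Fin D → Fin D → Fin D → ℝ) (w x y z : Fin D → ℝ) :
    ev3 (fun i j k => ev1 (fun r => F r i j k) w) x y z = ev4 F w x y z := by
  simp only [ev4, ev3, ev2, ev1, Finset.mul_sum]
  refine sum4_congr ⟨fun x => (x.2.2.2, x.1, x.2.1, x.2.2.1),
    fun x => (x.2.1, x.2.2.1, x.2.2.2, x.1), fun _ => rfl, fun _ => rfl⟩ fun x => ?_
  simp only [Equiv.coe_fn_mk]
  ring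

lemma ev2_ev1 (F : Fin D → Fin D → Fin D → ℝ) (w x y : Fin D → ℝ) :
    ev2 (fun i j => ev1 (fun r => F r i j) w) x y = ev3 F w x y := by
  simp only [ev3, ev2, ev1, Finset.mul_sum]
  have e : ∀ i, ∑ j, ∑ r, x i * (y j * (w r * F r i j)) =
      ∑ r, ∑ j, x i * (y j * (w r * F r i j)) := fun i => Finset.sum_comm
  simp only [e]
  rw [Finset.sum_comm]
  exact Finset.sum_congr rfl fun r _ => Finset.sum_congr rfl fun i _ =>
    Finset.sum_congr rfl fun j _ => by ring

lemma ev3_swap (F : Fin D → Fin D → Fin D → ℝ) (x y z : Fin D → ℝ) :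
    ev3 F x y z = ev3 (fun i j k => F i k j) x z y := by
  simp only [ev3, ev2, ev1, Finset.mul_sum]
  refine Finset.sum_congr rfl fun i _ => ?_
  rw [Finset.sum_comm]
  exact Finset.sum_congr rfl fun j _ => Finset.sum_congr rfl fun k _ => by ring

lemma ev1_ev1 (F : Fin D → Fin D → ℝ) (w x : Fin D → ℝ) :
    ev1 (fun i => ev1 (fun r => F r i) w) x = ev2 F w x := by
  simp only [ev2, ev1, Finset.mul_sum]
  rw [Finset.sum_comm]
  exact Finset.sum_congr rfl fun i _ => Finset.sum_congr rfl fun j _ => by ring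

end deriv

section transform
variable {h : Matrix (Fin D ⊕ Fin D) (Fin D ⊕ Fin D) ℝ} {E E' : MField D} {d d' : SField D}

/-! Chain rule -/

lemma mulVec_eq (h : Matrix (Fin D ⊕ Fin D) (Fin D ⊕ Fin D) ℝ) (X : Dbl D) :
    h.mulVec X = Sum.elim
      (h.toBlocks₁₁.mulVec (X ∘ Sum.inl) + h.toBlocks₁₂.mulVec (X ∘ Sum.inr))
      (h.toBlocks₂₁.mulVec (X ∘ Sum.inl) + h.toBlocks₂₂.mulVec (X ∘ Sum.inr)) := by
  conv_lhs => rw [← Matrix.fromBlocks_toBlocks h, Matrix.fromBlocks_mulVec]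

lemma uVec_eq (E : MField D) (X : Dbl D) (i : Fin D) :
    uVec E X i = Sum.elim (fun k => - E X i k) (Pi.single i 1) := by
  funext m
  rcases m with k | k
  · simp [uVec, Finset.sum_apply, Pi.single_apply]
  · simp [uVec, Finset.sum_apply, Pi.single_apply]

lemma bVec_eq (E : MField D) (X : Dbl D) (i : Fin D) :
    bVec E X i = Sum.elim (fun k => E X k i) (Pi.single i 1) := by
  funext m
  rcases m with k | k
  · simp [bVec, Finset.sum_apply, Pi.single_apply]
  · simp [bVec, Finset.sum_apply, Pi.single_apply]

lemma sum_smul_uVec (E : MField D) (X : Dbl D) (x : Fin D → ℝ) :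
    ∑ k, x k • uVec E X k = Sum.elim (fun l => - ∑ k, x k * E X k l) x := by
  funext m
  rcases m with l | l <;> simp [uVec_eq, Finset.sum_apply, Pi.single_apply]

lemma sum_smul_bVec (E : MField D) (X : Dbl D) (x : Fin D → ℝ) :
    ∑ k, x k • bVec E X k = Sum.elim (fun l => ∑ k, x k * E X l k) x := by
  funext m
  rcases m with l | l <;> simp [bVec_eq, Finset.sum_apply, Pi.single_apply]

/-- The x-components of the image of the frame vector define M; the x̃-components then match by
`oddM_mul`. Thus h maps the span of the 𝒟-frame of ℰ to that of ℰ'. -/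
lemma IsODDTransform.mulVec_uVec (hh : IsODD h) (ht : IsODDTransform h E d E' d') (X : Dbl D)
    (i : Fin D) :
    h.mulVec (uVec E X i) = ∑ k, oddM h E X i k • uVec E' (h.mulVec X) k := by
  have e : ∀ l, ∑ k, oddM h E X i k * E' (h.mulVec X) k l =
      (E X * h.toBlocks₁₁.transpose - h.toBlocks₁₂.transpose) i l := fun l => by
    rw [← ht.oddM_mul hh X, Matrix.mul_apply]
  rw [sum_smul_uVec, mulVec_eq, uVec_eq]
  congr 1
  · funext l
    rw [e]
    simp [Matrix.mulVec, dotProduct, Matrix.mul_apply, Pi.single_apply, mul_comm]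
    ring
  · funext l
    simp [oddM, Matrix.mulVec, dotProduct, Matrix.mul_apply, Pi.single_apply, mul_comm]
    ring

lemma IsODDTransform.mulVec_bVec (ht : IsODDTransform h E d E' d') (X : Dbl D)
    (i : Fin D) :
    h.mulVec (bVec E X i) = ∑ k, oddMb h E X i k • bVec E' (h.mulVec X) k := by
  have e : ∀ l, ∑ k, oddMb h E X i k * E' (h.mulVec X) l k =
      ((E X).transpose * h.toBlocks₁₁.transpose + h.toBlocks₁₂.transpose) i l := fun l => by
    rw [← ht.oddMb_mul X, Matrix.mul_apply]
    rfl
  rw [sum_smul_bVec, mulVec_eq, bVec_eq]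
  congr 1
  · funext l
    rw [e]
    simp [Matrix.mulVec, dotProduct, Matrix.mul_apply, Pi.single_apply, mul_comm]
  · funext l
    simp [oddMb, Matrix.mulVec, dotProduct, Matrix.mul_apply, Pi.single_apply, mul_comm]
    ring

lemma IsODDTransform.fderiv_uVec (hh : IsODD h) (ht : IsODDTransform h E d E' d') (f : SField D)
    (X : Dbl D) (i : Fin D) : fderiv ℝ f (h.mulVec X) (h.mulVec (uVec E X i)) =
      ev1 (fun k => cD E' k f (h.mulVec X)) (oddM h E X i) := by
  rw [ht.mulVec_uVec hh, map_sum]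
  refine Finset.sum_congr rfl fun k _ => ?_
  rw [map_smul, ← cD_eq_fderiv]
  rfl

lemma IsODDTransform.fderiv_bVec (ht : IsODDTransform h E d E' d') (f : SField D)
    (X : Dbl D) (i : Fin D) : fderiv ℝ f (h.mulVec X) (h.mulVec (bVec E X i)) =
      ev1 (fun k => cDb E' k f (h.mulVec X)) (oddMb h E X i) := by
  rw [ht.mulVec_bVec, map_sum]
  refine Finset.sum_congr rfl fun k _ => ?_
  rw [map_smul, ← cDb_eq_fderiv]
  rfl

lemma hasDerivAt_line_mulVec {f : SField D} {X : Dbl D}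
    (hf : DifferentiableAt ℝ f (h.mulVec X)) (ξ : Dbl D) :
    HasDerivAt (fun t : ℝ => f (h.mulVec (X + t • ξ))) (fderiv ℝ f (h.mulVec X) (h.mulVec ξ)) 0 := by
  simpa only [Matrix.mulVec_add, Matrix.mulVec_smul] using hasDerivAt_line hf (h.mulVec ξ)

lemma hasDerivAt_line_oddM (hbg : IsBackground E d) (X ξ : Dbl D) (i k : Fin D) :
    HasDerivAt (fun t : ℝ => oddM h E (X + t • ξ) i k)
      (- ∑ l, fderiv ℝ (fun Y => E Y i l) X ξ * h.toBlocks₂₁ k l) 0 := by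
  simp only [oddM, Matrix.sub_apply, Matrix.mul_apply, Matrix.transpose_apply]
  refine HasDerivAt.const_sub _ ?_
  exact HasDerivAt.fun_sum fun l _ => (hasDerivAt_line
    (differentiableAt_of_smooth (hbg.smooth_E i l) X) ξ).mul_const _

lemma hasDerivAt_line_oddMb (hbg : IsBackground E d) (X ξ : Dbl D) (i k : Fin D) :
    HasDerivAt (fun t : ℝ => oddMb h E (X + t • ξ) i k)
      (∑ l, fderiv ℝ (fun Y => E Y l i) X ξ * h.toBlocks₂₁ k l) 0 := by
  simp only [oddMb, Matrix.add_apply, Matrix.mul_apply, Matrix.transpose_apply]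
  refine HasDerivAt.const_add _ ?_
  exact HasDerivAt.fun_sum fun l _ => (hasDerivAt_line
    (differentiableAt_of_smooth (hbg.smooth_E l i) X) ξ).mul_const _

/-- The derivatives of `ℰ` and `ℰ'` are related by `M` and `M̄`. -/
lemma IsODDTransform.fderiv_E (hh : IsODD h) (hbg : IsBackground E d)
    (ht : IsODDTransform h E d E' d') (X ξ : Dbl D) (j k : Fin D) :
    fderiv ℝ (fun Y => E Y j k) X ξ = ev2 (fun m n =>
      fderiv ℝ (fun Y => E' Y m n) (h.mulVec X) (h.mulVec ξ)) (oddM h E X j) (oddMb h E X k) := by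
  have hbg' := ht.isBackground hh hbg
  set dE : Matrix (Fin D) (Fin D) ℝ := Matrix.of fun j k => fderiv ℝ (fun Y => E Y j k) X ξ
    with hdE
  set dP : Matrix (Fin D) (Fin D) ℝ := Matrix.of fun m n =>
    fderiv ℝ (fun Y => E' Y m n) (h.mulVec X) (h.mulVec ξ) with hdP
  -- The relation `oddM_mul` is differentiated along ξ, where M itself varies by -dℰ cᵗ.
  have h1 : -(dE * h.toBlocks₂₁.transpose) * E' (h.mulVec X) + oddM h E X * dP =
      dE * h.toBlocks₁₁.transpose := by
    ext i n
    have k1 : HasDerivAt (fun t : ℝ => (oddM h E (X + t • ξ) * E' (h.mulVec (X + t • ξ))) i n)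
        ((-(dE * h.toBlocks₂₁.transpose) * E' (h.mulVec X) + oddM h E X * dP) i n) 0 := by
      simp only [Matrix.mul_apply, Matrix.add_apply, ← Finset.sum_add_distrib]
      refine (HasDerivAt.fun_sum (u := Finset.univ) fun m _ => (hasDerivAt_line_oddM (h := h) hbg X ξ i m).mul
        (hasDerivAt_line_mulVec (h := h) (X := X) (f := fun Y => E' Y m n)
          (differentiableAt_of_smooth (hbg'.smooth_E m n) _) ξ)).congr_deriv ?_
      simp [hdE, hdP, Matrix.mul_apply]
    have k2 : HasDerivAt (fun t : ℝ => (oddM h E (X + t • ξ) * E' (h.mulVec (X + t • ξ))) i n)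
        ((dE * h.toBlocks₁₁.transpose) i n) 0 := by
      simp only [ht.oddM_mul hh]
      simp only [Matrix.mul_apply, Matrix.sub_apply]
      have k3 := fun l => hasDerivAt_line (differentiableAt_of_smooth (hbg.smooth_E i l) X) ξ
      exact (HasDerivAt.fun_sum (u := Finset.univ) fun l _ => (k3 l).mul_const _).sub_const _
    exact k1.unique k2
  -- Collecting the terms in dℰ, the bracket is the inverse of M̄, so multiplying by M̄ᵗ isolates
  -- dℰ.
  have h2 : oddM h E X * dP = dE * (h.toBlocks₁₁ +
      (E' (h.mulVec X)).transpose * h.toBlocks₂₁).transpose := by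
    rw [Matrix.transpose_add, Matrix.transpose_mul, Matrix.transpose_transpose, Matrix.mul_add,
      ← h1, ← Matrix.mul_assoc, Matrix.neg_mul]
    abel
  have h3 : oddM h E X * dP * (oddMb h E X).transpose = dE := by
    rw [h2, Matrix.mul_assoc, ← Matrix.transpose_mul, ht.oddMb_inverse hh, Matrix.transpose_one,
      Matrix.mul_one]
  have h4 := congrFun (congrFun h3 j) k
  rw [Matrix.mul_apply] at h4
  simp only [Matrix.mul_apply, Matrix.transpose_apply, Finset.sum_mul] at h4
  rw [Finset.sum_comm] at h4
  refine h4.symm.trans ?_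
  simp only [ev2, ev1, Finset.mul_sum]
  exact Finset.sum_congr rfl fun m _ => Finset.sum_congr rfl fun n _ => by
    simp only [hdP, Matrix.of_apply]
    ring

lemma IsODDTransform.DE_eq (hh : IsODD h) (hbg : IsBackground E d)
    (ht : IsODDTransform h E d E' d') (X : Dbl D) (i j k : Fin D) :
    DE E i j k X = ev3 (fun a b c => DE E' a b c (h.mulVec X)) (oddM h E X i) (oddM h E X j)
      (oddMb h E X k) := by
  rw [DE, cD_eq_fderiv, ht.fderiv_E hh hbg]
  simp only [ht.fderiv_uVec hh, ev2_ev1]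
  rfl

lemma IsODDTransform.CE_eq (hh : IsODD h) (hbg : IsBackground E d)
    (ht : IsODDTransform h E d E' d') (X : Dbl D) (i j k : Fin D) :
    CE E i j k X = ev3 (fun a b c => CE E' a b c (h.mulVec X)) (oddMb h E X i) (oddMb h E X j)
      (oddM h E X k) := by
  rw [CE, DbE, cDb_eq_fderiv, ht.fderiv_E hh hbg]
  simp only [ht.fderiv_bVec, ev2_ev1]
  rw [ev3_swap]
  rfl

lemma IsODDTransform.cD_dil (hh : IsODD h) (hbg : IsBackground E d)
    (ht : IsODDTransform h E d E' d') (X : Dbl D) (i : Fin D) :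
    cD E i d X = ev1 (fun k => cD E' k d' (h.mulVec X)) (oddM h E X i) := by
  have hbg' := ht.isBackground hh hbg
  rw [cD_eq_fderiv, ← ht.fderiv_uVec hh]
  have := hasDerivAt_line_mulVec (h := h) (X := X) (differentiableAt_of_smooth hbg'.smooth_d _)
    (uVec E X i)
  simp only [ht.map_d] at this
  exact (hasDerivAt_line (differentiableAt_of_smooth hbg.smooth_d X) _).unique this

lemma IsODDTransform.cDb_dil (hh : IsODD h) (hbg : IsBackground E d)
    (ht : IsODDTransform h E d E' d') (X : Dbl D) (i : Fin D) :
    cDb E i d X = ev1 (fun k => cDb E' k d' (h.mulVec X)) (oddMb h E X i) := by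
  have hbg' := ht.isBackground hh hbg
  rw [cDb_eq_fderiv, ← ht.fderiv_bVec]
  have := hasDerivAt_line_mulVec (h := h) (X := X) (differentiableAt_of_smooth hbg'.smooth_d _)
    (bVec E X i)
  simp only [ht.map_d] at this
  exact (hasDerivAt_line (differentiableAt_of_smooth hbg.smooth_d X) _).unique this

/-! ### 𝒦 as an O(D,D) tensor -/

/-- The two halves of `𝒦` are tensors. -/
lemma IsODDTransform.kHalfU_eq (hh : IsODD h) (hbg : IsBackground E d)
    (ht : IsODDTransform h E d E' d') (X : Dbl D) (p q : Fin D) :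
    kHalfU E d p q X = ev2 (fun k l => kHalfU E' d' k l (h.mulVec X)) (oddM h E X p)
      (oddMb h E X q) := by
  have hbg' := ht.isBackground hh hbg
  have fr := ht.isFrame hh hbg X
  have hA := ht.DE_eq hh hbg X
  have hC := ht.CE_eq hh hbg X
  simp only [kHalfU, nabUUB_eq, nabB_eq]
  refine fr.khalf_eq hA hC (fr.nab3_eq hA hC hA fun r i j k => ?_)
    (fr.nab1_eq hA hC (ht.cDb_dil hh hbg X) fun r i => ?_) p q
  -- The transformation law of 𝒟ℰ is differentiated along the frame vector; M, M and M̄ contribute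
  -- the three inhomogeneous terms that `IsFrame.nab3_eq` expects.
  · have k1 := ev3_hasDerivAt
      (F := fun t a b c => DE E' a b c (h.mulVec (X + t • uVec E X r)))
      (fun a b c => hasDerivAt_line_mulVec (differentiableAt_of_smooth (hbg'.contDiff_DE a b c) _)
        (uVec E X r))
      (hasDerivAt_line_oddM (h := h) hbg X (uVec E X r) i)
      (hasDerivAt_line_oddM (h := h) hbg X (uVec E X r) j)
      (hasDerivAt_line_oddMb (h := h) hbg X (uVec E X r) k)
    simp only [← ht.DE_eq hh hbg, zero_smul, add_zero, ht.fderiv_uVec hh, ev3_ev1,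
      ← cD_eq_fderiv] at k1
    exact (IsBackground.hasDerivAt_line_cD (hbg.contDiff_DE i j k) E X r).unique k1
  · have k1 := ev1_hasDerivAt
      (f := fun t a => cDb E' a d' (h.mulVec (X + t • uVec E X r)))
      (fun a => hasDerivAt_line_mulVec
        (differentiableAt_of_smooth (hbg'.contDiff_cDb hbg'.smooth_d a) _) (uVec E X r))
      (hasDerivAt_line_oddMb (h := h) hbg X (uVec E X r) i)
    simp only [← ht.cDb_dil hh hbg, zero_smul, add_zero, ht.fderiv_uVec hh, ev1_ev1,
      ← cD_eq_fderiv] at k1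
    exact (IsBackground.hasDerivAt_line_cD (hbg.contDiff_cDb hbg.smooth_d i) E X r).unique k1

lemma IsODDTransform.kHalfB_eq (hh : IsODD h) (hbg : IsBackground E d)
    (ht : IsODDTransform h E d E' d') (X : Dbl D) (p q : Fin D) :
    kHalfB E d p q X = ev2 (fun k l => kHalfB E' d' k l (h.mulVec X)) (oddMb h E X p)
      (oddM h E X q) := by
  have hbg' := ht.isBackground hh hbg
  have fr := (ht.isFrame hh hbg X).symm
  have hA := ht.DE_eq hh hbg X
  have hC := ht.CE_eq hh hbg X
  simp only [kHalfB, nabbBUB_eq, nabbU_eq]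
  refine fr.khalf_eq hC hA (fr.nab3_eq hC hA hC fun r i j k => ?_)
    (fr.nab1_eq hC hA (ht.cD_dil hh hbg X) fun r i => ?_) p q
  · have k1 := ev3_hasDerivAt
      (F := fun t a b c => CE E' a b c (h.mulVec (X + t • bVec E X r)))
      (fun a b c => hasDerivAt_line_mulVec (differentiableAt_of_smooth (hbg'.contDiff_DbE a c b) _)
        (bVec E X r))
      (hasDerivAt_line_oddMb (h := h) hbg X (bVec E X r) i)
      (hasDerivAt_line_oddMb (h := h) hbg X (bVec E X r) j)
      (hasDerivAt_line_oddM (h := h) hbg X (bVec E X r) k)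
    simp only [← ht.CE_eq hh hbg, zero_smul, add_zero, ht.fderiv_bVec, ev3_ev1,
      ← cDb_eq_fderiv] at k1
    -- The exchanged frame carries -c, which accounts for the opposite signs of the derivatives of
    -- M̄ and M.
    simp only [Matrix.neg_apply, mul_neg, Finset.sum_neg_distrib, neg_neg]
    exact (IsBackground.hasDerivAt_line_cDb (hbg.contDiff_DbE i k j) E X r).unique k1
  · have k1 := ev1_hasDerivAt
      (f := fun t a => cD E' a d' (h.mulVec (X + t • bVec E X r)))
      (fun a => hasDerivAt_line_mulVec
        (differentiableAt_of_smooth (hbg'.contDiff_cD hbg'.smooth_d a) _) (bVec E X r))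
      (hasDerivAt_line_oddM (h := h) hbg X (bVec E X r) i)
    simp only [← ht.cD_dil hh hbg, zero_smul, add_zero, ht.fderiv_bVec, ev1_ev1,
      ← cDb_eq_fderiv] at k1
    simp only [Matrix.neg_apply, mul_neg, Finset.sum_neg_distrib]
    exact (IsBackground.hasDerivAt_line_cDb (hbg.contDiff_cD hbg.smooth_d i) E X r).unique k1

/-- `𝒦` as a matrix is `M 𝒦' M̄ᵗ`. -/
lemma IsODDTransform.KLow_eq (hh : IsODD h) (hbg : IsBackground E d)
    (ht : IsODDTransform h E d E' d') (X : Dbl D) (p q : Fin D) :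
    KLow E d X p q = ∑ k, ∑ l, oddM h E X p k * oddMb h E X q l * KLow E' d' (h.mulVec X) k l := by
  rw [DFT.KLow_eq, ht.kHalfU_eq hh hbg, ht.kHalfB_eq hh hbg]
  simp only [DFT.KLow_eq, mul_add, Finset.sum_add_distrib, ev2, ev1, Finset.mul_sum]
  congr 1
  · exact Finset.sum_congr rfl fun k _ => Finset.sum_congr rfl fun l _ => by ring
  · rw [Finset.sum_comm]
    exact Finset.sum_congr rfl fun k _ => Finset.sum_congr rfl fun l _ => by ring

/-- Raising both indices multiplies by g⁻¹ on either side. The inverse metric of ℰ' is expressed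
through M on the left and through M̄ on the right, so that each cancels the factor of the adjacent
index. -/
lemma IsODDTransform.KUp_eq (hh : IsODD h) (hbg : IsBackground E d)
    (ht : IsODDTransform h E d E' d') (X : Dbl D) :
    KUp E d X = (oddM h E X)⁻¹.transpose * KUp E' d' (h.mulVec X) * (oddMb h E X)⁻¹ := by
  have fr := ht.isFrame hh hbg X
  have hK : KLow E d X = oddM h E X * KLow E' d' (h.mulVec X) * (oddMb h E X).transpose := by
    ext p q
    rw [ht.KLow_eq hh hbg, Matrix.mul_apply]
    simp only [Matrix.mul_apply, Finset.sum_mul, Matrix.transpose_apply]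
    rw [Finset.sum_comm]
    exact Finset.sum_congr rfl fun l _ => Finset.sum_congr rfl fun k _ => by ring
  have h1 : (oddM h E X)⁻¹.transpose * (oddM h E X).transpose = 1 := by
    rw [← Matrix.transpose_mul, Matrix.mul_nonsing_inv _
      (isUnit_iff_ne_zero.mpr (ht.det_oddM hh X)), Matrix.transpose_one]
  have h2 : oddMb h E X * (oddMb h E X)⁻¹ = 1 :=
    Matrix.mul_nonsing_inv _ (isUnit_iff_ne_zero.mpr (ht.det_oddMb hh X))
  rw [KUp_eq_mul, KUp_eq_mul, hK]
  conv_rhs => rw [Matrix.mul_assoc (gUp E' _), ← fr.left]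
  have : KLow E' d' (h.mulVec X) * ((oddM h E X).transpose * gUp E X * oddM h E X) =
    KLow E' d' (h.mulVec X) * ((oddMb h E X).transpose * gUp E X * oddMb h E X) := by
    rw [fr.left, fr.right]
  rw [this]
  calc _ = ((oddM h E X)⁻¹.transpose * (oddM h E X).transpose) * gUp E X * oddM h E X *
        KLow E' d' (h.mulVec X) * (oddMb h E X).transpose * gUp E X *
        (oddMb h E X * (oddMb h E X)⁻¹) := by
        rw [h1, h2]
        simp only [Matrix.mul_assoc, Matrix.one_mul, Matrix.mul_one]
    _ = _ := by simp only [Matrix.mul_assoc]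

end transform

end DFT

end

/-! ### Assembly of the three claims -/

theorem mainTheorem3 (D : ℕ) (E : DFT.MField D) (d : DFT.SField D)
    (hbg : DFT.IsBackground E d) :
    -- the variation of the action and of its symmetrized form, and the field equation
    (DFT.StrongConstraint E d →
      (∀ X, DFT.lag E d X = DFT.lagSym E d X) ∧
      ∀ (ℓ : Fin D ⊕ Fin D → ℝ), (∀ m, 0 ≤ ℓ m) →
        DFT.HasPeriods ℓ E → DFT.HasPeriods ℓ d →
        ∀ (L : DFT.MField D → DFT.SField D → DFT.SField D),
          (L = DFT.lag ∨ L = DFT.lagSym) →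
          (∀ δE : DFT.MField D, DFT.IsVariation ℓ δE →
            MeasureTheory.IntegrableOn (DFT.variationDensity E d δE) (DFT.cell ℓ) ∧
            DFT.HasActionVariation L ℓ E d δE
              (∫ X in DFT.cell ℓ, DFT.variationDensity E d δE X)) ∧
          (∀ I : Set (Fin D ⊕ Fin D), (∀ m ∉ I, 0 < ℓ m) →
            DFT.DependsOnlyOn I E → DFT.DependsOnlyOn I d →
            ((∀ δE : DFT.MField D, DFT.IsVariation ℓ δE → DFT.DependsOnlyOn I δE →
                DFT.HasActionVariation L ℓ E d δE 0) ↔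
              ∀ X p q, DFT.KLow E d X p q = 0))) ∧
    -- the first index is unbarred and the second is barred
    (∀ h : Matrix (Fin D ⊕ Fin D) (Fin D ⊕ Fin D) ℝ, DFT.IsODD h →
      ∀ (E' : DFT.MField D) (d' : DFT.SField D), DFT.IsODDTransform h E d E' d' →
        DFT.TransformsLower h E (DFT.KLow E d) (DFT.KLow E' d') ∧
        DFT.TransformsUpper h E (DFT.KUp E d) (DFT.KUp E' d')) ∧
    -- the symmetry exchanges the two calligraphic derivatives and the two indices
    ((∀ (i : Fin D) (f : DFT.SField D), Differentiable ℝ f → ∀ X,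
        DFT.cD (DFT.z2E E) i (DFT.z2S f) X = DFT.cDb E i f (DFT.reflect X) ∧
        DFT.cDb (DFT.z2E E) i (DFT.z2S f) X = DFT.cD E i f (DFT.reflect X)) ∧
      ∀ X p q,
        DFT.KUp (DFT.z2E E) (DFT.z2S d) X p q = DFT.KUp E d (DFT.reflect X) q p ∧
        DFT.KLow (DFT.z2E E) (DFT.z2S d) X p q = DFT.KLow E d (DFT.reflect X) q p) := by
  refine ⟨fun hs => ⟨hs.lag_eq hbg, fun ℓ hℓ hE hd L hL => ?_⟩, fun h hh E' d' ht => ⟨?_, ?_⟩,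
    fun i f _ X => ⟨?_, ?_⟩, fun X p q => ⟨?_, ?_⟩⟩
  · have hv : ∀ δE : DFT.MField D, DFT.IsVariation ℓ δE →
        MeasureTheory.IntegrableOn (DFT.variationDensity E d δE) (DFT.cell ℓ) ∧
        DFT.HasActionVariation L ℓ E d δE
          (∫ X in DFT.cell ℓ, DFT.variationDensity E d δE X) := by
      rcases hL with rfl | rfl
      · exact fun δE hδ => DFT.hasActionVariation_lag hbg hs hE hd hδ
      · exact fun δE hδ => DFT.hasActionVariation_lagSym hbg hE hd hδ
    exact ⟨hv, fun I hI hEI hdI => DFT.variation_eq_zero_iff hbg hℓ hE hd hv hI hEI hdI⟩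
  · exact fun X i j => ht.KLow_eq hh hbg X i j
  · refine fun X => ⟨ht.det_oddM hh X, ht.det_oddMb hh X, fun i j => ?_⟩
    rw [ht.KUp_eq hh hbg, Matrix.mul_apply]
    simp only [Matrix.mul_apply, Matrix.transpose_apply, Finset.sum_mul]
    rw [Finset.sum_comm]
    exact Finset.sum_congr rfl fun k _ => Finset.sum_congr rfl fun l _ => by ring
  · rw [DFT.cD_z2]; rfl
  · rw [DFT.cDb_z2]; rfl
  · exact DFT.KUp_z2 E d p q X
  · exact DFT.KLow_z2 E d p q X
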